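/- Let $d\in\{2,3\}$, $d-6<m\le d$, let $D\subset\mathbb R^d$ be a bounded domain and $\hat g(\xi)=\int_{\mathbb R^d}e^{-\mathrm i x\cdot\xi}g(x)\,dx$. **Source.** Let $f$ be a random distribution on $\mathbb R^d$, defined on a probability space, such that $\langle f,\psi\rangle$ is a centered complex Gaussian random variable for every $\psi\in C_0^\infty(\mathbb R^d;\mathbb C)$. Assume that $f$ is microlocally isotropic of order $-m$ in $D$ with principal symbols $a^c|\xi|^{-m}$ and $a^r|\xi|^{-m}$, where $a^c,a^r\in C_0^\infty(D;\mathbb C)$; that is, the covariance and relation operators, defined by $$\langle \mathcal C_f\varphi,\psi\rangle=\mathbb E\big[\langle\overline f,\varphi\rangle\langle f,\psi\rangle\big],\qquad \langle \mathcal R_f\varphi,\psi\rangle=\mathbb E\big[\langle f,\varphi\rangle\langle f,\psi\rangle\big],$$ are pseudo-differential operators $\varphi\mapsto(2\pi)^{-d}\int e^{\mathrm i x\cdot\xi}\sigma^\eta(x,\xi)\hat\varphi(\xi)\,d\xi$, $\eta\in\{c,r\}$ respectively, whose symbols satisfy $$\sigma^\eta(x,\xi)=a^\eta(x)|\xi|^{-m}+b^\eta(x,\xi)\quad\text{for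 } |\xi|\ge1 .$$ Here $\sigma^\eta\in\mathcal S^{-m}$, $b^\eta\in\mathcal S^{-m-1}$ and $\sigma^\eta(\cdot,\xi),b^\eta(\cdot,\xi)\in C_0^\infty(D)$ for all $\xi$, where $\mathcal S^{s}$ is the set of smooth $\sigma$ on $\mathbb R^d\times\mathbb R^d$ with $|\partial_\xi^{\gamma_1}\partial_x^{\gamma_2}\sigma(x,\xi)|\le C_{\gamma_1,\gamma_2}(1+|\xi|)^{s-|\gamma_1|}$ for all multi-indices $\gamma_1,\gamma_2$. **Wave field.** Almost surely, for all $\kappa>0$, let $u(\cdot,\kappa)$ be the distributional solution of $$\Delta^2u-\kappa^4u=f\quad\text{in }\mathbb R^d$$ such that $u$ and $\Delta u$ satisfy the Sommerfeld radiation condition, i.e. $|x|^{\frac{d-1}2}(\partial_{|x|}w-\mathrm i\kappa w)\to0$ as $|x|\to\infty$, for $w=u$ and $w=\Delta u$. Let $u^\infty(\cdot,\kappa)$ be its far-field pattern, given by $u(x,\kappa)=\frac{e^{\mathrm i\kappa|x|}}{|x|^{(d-1)/2}}\big(u^\infty(x/|x|,\kappa)+O(|x|^{-1})\big)$ as $|x|\to\infty$.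 Put $C_2=\frac{e^{\mathrm i\pi/4}}{\sqrt{8\pi}}$ and $C_3=\frac1{4\pi}$. **Theorem.** (i) For all $\hat x\in\mathbb S^{d-1}$ and $\tau\ge0$, almost surely $$\lim_{Q\to\infty}\frac1Q\int_Q^{2Q}\kappa^{m+7-d}u^\infty(\hat x,\kappa+\tau)\overline{u^\infty(\hat x,\kappa)}\,d\kappa=\frac14|C_d|^2\,\widehat{a^c}(\tau\hat x),$$ $$\lim_{Q\to\infty}\frac1Q\int_Q^{2Q}\kappa^{m+7-d}u^\infty(\hat x,\kappa+\tau)u^\infty(-\hat x,\kappa)\,d\kappa=\frac14C_d^2\,\widehat{a^r}(\tau\hat x).$$ (ii) Let $\Theta\subset[0,\infty)\times\mathbb S^{d-1}$ be any nonempty relatively open set. The first averages with $(\tau,\hat x)\in\Theta$ uniquely determine $a^c$, and the second ones uniquely determine $a^r$, from a single realization. Precisely, let $\tilde f$ be another source, possibly on another probability space and with another bounded domain, satisfying the same assumptions with the same $d$ and $m$ and with principal symbols $\tilde a^c|\xi|^{-m},\tilde a^r|\xi|^{-m}$. Then for almost every realization $\omega$ of $f$ and almost every realization $\tilde\omega$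 of $\tilde f$: if for all $(\tau,\hat x)\in\Theta$ the first averages for $\omega$ converge to a number exactly when those for $\tilde\omega$ converge to the same number, then $a^c=\tilde a^c$; and if the same holds for the second averages, then $a^r=\tilde a^r$. -/

import Mathlib

open Complex Filter Topology MeasureTheory ProbabilityTheory
open TopologicalSpace (Opens)
open scoped Distributions ComplexConjugate NNReal LineDeriv

/-- The Euclidean space `ℝ^d`. -/
abbrev EuclRd (d : ℕ) : Type := EuclideanSpace ℝ (Fin d)

/-- The unit sphere `S^{d-1}` of `ℝ^d`. -/
abbrev UnitSph (d : ℕ) : Type := Metric.sphere (0 : EuclRd d) 1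

/-- Complex valued test functions `C_0^∞(ℝ^d; ℂ)`, with their usual LF topology. -/
abbrev TestFn (d : ℕ) : Type := 𝓓((⊤ : Opens (EuclRd d)), ℂ)

/-- Distributions `𝓓'(ℝ^d; ℂ)`: continuous `ℂ`-linear functionals on the complex valued test
functions. -/
abbrev DistrRd (d : ℕ) : Type := TestFn d →L[ℂ] ℂ

noncomputable section

/-- Pointwise complex conjugate of a test function. -/
def conjTest {d : ℕ} (φ : TestFn d) : TestFn d :=
  TestFunction.postcompCLM (𝕜 := ℝ) (conjCLE : ℂ →L[ℝ] ℂ) φ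

/-- Laplacian of a test function. -/
def lapTest {d : ℕ} (φ : TestFn d) : TestFn d :=
  ∑ i : Fin d, ∂_{(EuclideanSpace.single i (1 : ℝ) : EuclRd d)}
    (∂_{(EuclideanSpace.single i (1 : ℝ) : EuclRd d)} φ)

/-- The Fourier transform `φ̂(ξ) = ∫ e^{-i x·ξ} φ(x) dx`. -/
def fourierHat {d : ℕ} (φ : EuclRd d → ℂ) (ξ : EuclRd d) : ℂ :=
  ∫ x : EuclRd d, cexp (-(I * (inner ℝ x ξ : ℝ))) * φ x

/-! ### Symbols and pseudo-differential operators -/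

/-- The symbol class `𝒮^s(ℝ^d × ℝ^d)`: `σ` is smooth and
`|∂_ξ^{γ₁} ∂_x^{γ₂} σ(x, ξ)| ≤ C (1 + |ξ|)^{s - |γ₁|}` for all multi-indices; the partial
derivatives with `|γ₁| = j`, `|γ₂| = k` are collected in one iterated Fréchet derivative. -/
def IsSymbol {d : ℕ} (s : ℝ) (σ : EuclRd d → EuclRd d → ℂ) : Prop :=
  ContDiff ℝ (⊤ : ℕ∞) (fun p : EuclRd d × EuclRd d => σ p.1 p.2) ∧
  ∀ j k : ℕ, ∃ C : ℝ, ∀ x ξ : EuclRd d,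
    ‖iteratedFDeriv ℝ j (fun ξ' => iteratedFDeriv ℝ k (fun x' => σ x' ξ') x) ξ‖
      ≤ C * (1 + ‖ξ‖) ^ (s - j)

/-- `g ∈ C_0^∞(D)`. -/
def IsTestOn {d : ℕ} (D : Opens (EuclRd d)) (g : EuclRd d → ℂ) : Prop :=
  ContDiff ℝ (⊤ : ℕ∞) g ∧ HasCompactSupport g ∧ tsupport g ⊆ D

/-- `σ` is a symbol of order `-m`, supported in `D` in the variable `x`, of the form
`σ(x, ξ) = a(x) |ξ|^{-m} + b(x, ξ)` for `|ξ| ≥ 1`, where `b` has order `-m-1` and is supported in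
`D` in `x`. (A smooth symbol can have the singular principal part `a(x) |ξ|^{-m}` only away from
`ξ = 0`; the values for small `ξ` do not matter for the order of `b`.) -/
def HasPrincipalSymbol {d : ℕ} (D : Opens (EuclRd d)) (m : ℝ) (a : EuclRd d → ℂ)
    (σ : EuclRd d → EuclRd d → ℂ) : Prop :=
  IsSymbol (-m) σ ∧ (∀ ξ, IsTestOn D (fun x => σ x ξ)) ∧
  ∃ b : EuclRd d → EuclRd d → ℂ, IsSymbol (-m - 1) b ∧ (∀ ξ, IsTestOn D (fun x => b x ξ)) ∧
    ∀ x ξ, 1 ≤ ‖ξ‖ → σ x ξ = a x * ((‖ξ‖ ^ (-m) : ℝ) : ℂ) + b x ξ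

/-- The pseudo-differential operator with symbol `σ`:
`φ ↦ (2π)^{-d} ∫ e^{i x·ξ} σ(x, ξ) φ̂(ξ) dξ`. -/
def pseudoDiff {d : ℕ} (σ : EuclRd d → EuclRd d → ℂ) (φ : EuclRd d → ℂ) (x : EuclRd d) : ℂ :=
  (1 / ((2 * Real.pi) ^ d : ℝ) : ℂ) *
    ∫ ξ : EuclRd d, cexp (I * (inner ℝ x ξ : ℝ)) * σ x ξ * fourierHat φ ξ

/-! ### Generalized Gaussian random fields -/

section RandomField

variable {Ω : Type*} [MeasurableSpace Ω]

/-- The expectation `⟨𝔼 f, ψ⟩ = 𝔼 ⟨f, ψ⟩`. -/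
def fieldMean {d : ℕ} (P : Measure Ω) (f : Ω → DistrRd d) (ψ : TestFn d) : ℂ :=
  ∫ ω, f ω ψ ∂P

/-- The covariance `⟨𝒞_f φ, ψ⟩ = 𝔼[⟨conj (f - 𝔼 f), φ⟩ ⟨f - 𝔼 f, ψ⟩]`, where the conjugate of a
distribution `T` is `⟨conj T, φ⟩ = conj ⟨T, conj φ⟩`. -/
def covForm {d : ℕ} (P : Measure Ω) (f : Ω → DistrRd d) (φ ψ : TestFn d) : ℂ :=
  ∫ ω, conj (f ω (conjTest φ) - fieldMean P f (conjTest φ)) * (f ω ψ - fieldMean P f ψ) ∂P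

/-- The relation (pseudo-covariance) `⟨ℛ_f φ, ψ⟩ = 𝔼[⟨f - 𝔼 f, φ⟩ ⟨f - 𝔼 f, ψ⟩]`. -/
def relForm {d : ℕ} (P : Measure Ω) (f : Ω → DistrRd d) (φ ψ : TestFn d) : ℂ :=
  ∫ ω, (f ω φ - fieldMean P f φ) * (f ω ψ - fieldMean P f ψ) ∂P

/-- `f` is a `ℂ`-valued centered generalized microlocally isotropic Gaussian random field of order
`-m` in `D`, whose covariance and relation operators have the principal symbols
`a^c(x) |ξ|^{-m}` and `a^r(x) |ξ|^{-m}`. -/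
structure IsCenteredGMIG {d : ℕ} (P : Measure Ω) (f : Ω → DistrRd d) (m : ℝ)
    (D : Opens (EuclRd d)) (ac ar : 𝓓(D, ℂ)) : Prop where
  gaussian : ∀ ψ : TestFn d, HasGaussianLaw (fun ω => f ω ψ) P
  centered : ∀ ψ : TestFn d, fieldMean P f ψ = 0
  covariance : ∃ σ : EuclRd d → EuclRd d → ℂ, HasPrincipalSymbol D m ac σ ∧
    ∀ φ ψ : TestFn d, covForm P f φ ψ = ∫ x, pseudoDiff σ φ x * ψ x
  relation : ∃ σ : EuclRd d → EuclRd d → ℂ, HasPrincipalSymbol D m ar σ ∧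
    ∀ φ ψ : TestFn d, relForm P f φ ψ = ∫ x, pseudoDiff σ φ x * ψ x

end RandomField

/-! ### The biharmonic wave equation -/

/-- Outside the ball of radius `R`, the distribution `u` is the smooth function `U`. -/
def IsSmoothOutside {d : ℕ} (u : DistrRd d) (R : ℝ) (U : EuclRd d → ℂ) : Prop :=
  ContDiffOn ℝ (⊤ : ℕ∞) U {x | R < ‖x‖} ∧
  ∀ φ : TestFn d, tsupport φ ⊆ {x | R < ‖x‖} → u φ = ∫ x, U x * φ x

/-- The Sommerfeld radiation condition `|x|^{(d-1)/2} (∂_{|x|} U - i κ U) → 0` as `|x| → ∞`. -/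
def Sommerfeld {d : ℕ} (κ : ℝ) (U : EuclRd d → ℂ) : Prop :=
  Tendsto (fun x : EuclRd d => ((‖x‖ ^ (((d : ℝ) - 1) / 2) : ℝ) : ℂ) *
      (fderiv ℝ U x (‖x‖⁻¹ • x) - I * κ * U x))
    (Bornology.cobounded (EuclRd d)) (𝓝 0)

/-- `u` solves `Δ² u - κ⁴ u = F` in `ℝ^d` in the sense of distributions, and `u` and `Δ u` satisfy
the Sommerfeld radiation condition. -/
def IsRadiatingSolution {d : ℕ} (κ : ℝ) (F u : DistrRd d) : Prop :=
  (∀ φ : TestFn d, u (lapTest (lapTest φ)) - (κ : ℂ) ^ 4 * u φ = F φ) ∧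
  ∃ (R : ℝ) (U : EuclRd d → ℂ), IsSmoothOutside u R U ∧
    Sommerfeld κ U ∧ Sommerfeld κ (Laplacian.laplacian U)

/-- `g` is the far-field pattern of `u` at the wave number `κ`:
`u(x) = e^{iκ|x|} |x|^{-(d-1)/2} (g(x/|x|) + O(1/|x|))` as `|x| → ∞`. -/
def IsFarFieldPattern {d : ℕ} (κ : ℝ) (u : DistrRd d) (g : UnitSph d → ℂ) : Prop :=
  ∃ (R : ℝ) (U : EuclRd d → ℂ), IsSmoothOutside u R U ∧
    ∃ C : ℝ, ∀ (r : ℝ) (θ : UnitSph d), R < r → 1 ≤ r →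
      ‖cexp (-(I * κ * r)) * ((r ^ (((d : ℝ) - 1) / 2) : ℝ) : ℂ) * U (r • (θ : EuclRd d)) - g θ‖
        ≤ C / r

/-- The constant `C_d`: `e^{iπ/4} / √(8π)` for `d = 2` and `1 / (4π)` for `d = 3`. -/
def radConst (d : ℕ) : ℂ :=
  if d = 2 then cexp (I * Real.pi / 4) / (Real.sqrt (8 * Real.pi) : ℂ) else 1 / (4 * Real.pi : ℂ)

/-! ### Frequency averages -/

/-- `L = lim_{Q → ∞} (1/Q) ∫_Q^{2Q} h(κ) dκ`, all the integrals being convergent. -/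
def HasBandAverage (h : ℝ → ℂ) (L : ℂ) : Prop :=
  (∀ Q : ℝ, 0 < Q → IntervalIntegrable h volume Q (2 * Q)) ∧
  Tendsto (fun Q : ℝ => (1 / Q : ℂ) * ∫ κ in Q..(2 * Q), h κ) atTop (𝓝 L)

/-- `κ ↦ κ^{m+7-d} u^∞(x̂, κ+τ) conj (u^∞(x̂, κ))`. -/
def covData {d : ℕ} (m : ℝ) (v : UnitSph d → ℝ → ℂ) (τ : ℝ) (θ : UnitSph d) (κ : ℝ) : ℂ :=
  ((κ ^ (m + 7 - d) : ℝ) : ℂ) * (v θ (κ + τ) * conj (v θ κ))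

/-- `κ ↦ κ^{m+7-d} u^∞(x̂, κ+τ) u^∞(-x̂, κ)`. -/
def relData {d : ℕ} (m : ℝ) (v : UnitSph d → ℝ → ℂ) (τ : ℝ) (θ : UnitSph d) (κ : ℝ) : ℂ :=
  ((κ ^ (m + 7 - d) : ℝ) : ℂ) * (v θ (κ + τ) * v (-θ) κ)

/-- `u(·, κ)`, `κ > 0`, are almost surely the radiating solutions of the biharmonic wave equation
with source `f`, and `v(·, κ)` are their far-field patterns. -/
def IsBiharmonicField {Ω : Type*} [MeasurableSpace Ω] {d : ℕ} (P : Measure Ω)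
    (f : Ω → DistrRd d) (u : ℝ → Ω → DistrRd d) (v : Ω → UnitSph d → ℝ → ℂ) : Prop :=
  ∀ᵐ ω ∂P, ∀ κ : ℝ, 0 < κ → IsRadiatingSolution κ (f ω) (u κ ω) ∧
    IsFarFieldPattern κ (u κ ω) (fun θ => v ω θ κ)

end

noncomputable section

/-! ### Test functions -/

/-! The proof has a deterministic half and a probabilistic half. The deterministic half identifies
the far-field pattern with a Fourier transform of the source: `u^∞(θ, κ) = (C_d/2) κ^{(d-7)/2} ⟨f, χ
e^{-iκ x·θ}⟩`, where `χ = 1` on `D` (`farField_eq`, `exists_cutoff_farField`). No fundamental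
solution is used. The equation is tested against `e^{-iκ x·θ} η(x/ρ)`. Since the plane wave solves
the homogeneous equation, the operator leaves only terms with derivatives on the cutoff, supported
where `2ρ ≤ |x| ≤ 3ρ`, and there the far-field expansion applies. After the substitution `x = ρz`,
the leading term is an oscillatory integral with phase `κρ(|z| - z·θ)`, stationary on the ray
through `θ`. Stationary phase (`tendsto_leadingTerm`) evaluates it as a multiple of `u^∞(θ)`.

The remaining terms have amplitudes that are bounded as `ρ → ∞` but need not tend to zero (for `d =
3` the `O(1/|x|)` error is exactly critical), so they are not small direction by direction. They are
small on average over an arc of directions, by a Riemann–Lebesgue argument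
(`tendsto_setIntegral_bounded_mul_osc`). The sum of the remainders converges pointwise, because the
leading terms converge and the tested source does not depend on large `ρ`. Its limit is continuous
in the direction and has zero integral over every subarc, so it vanishes
(`eq_zero_of_tendsto_sum_osc`).

For the probabilistic half, the second moments of `⟨f, χ e^{ilx·θ}⟩` are bilinear forms of the
covariance and relation operators on modulated cutoffs. Such a form at frequencies `l`, `μ` is
`O((1+|l|)^{-m} (1+|l+μ|)^{-1})` (`exists_norm_oscForm_le`). At `l = κ`, `μ = -(κ+τ)`, multiplied by
`κ^m`, it converges to the Fourier transform of the principal amplitude at `τθ` (`tendsto_oscForm`).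
The expected averages therefore have the right limit. By Wick's formula, the covariance of two
products of field values is a sum of two products of such forms, so after weighting it is
`O((1+|s-t|)^{-2})`, which is integrable in `s - t`. A law of large numbers along the squares, with
control of the gaps between them, gives almost sure convergence (`ae_tendsto_bandAverage`).

For uniqueness, the limits hold simultaneously on a countable dense set of pairs `(τ, θ)`. By
continuity the Fourier transforms of the two amplitudes agree on `Θ`, whose polar image contains an
open set. Fourier transforms of compactly supported functions are analytic, so they agree everywhere
(`coe_eq_of_fourierHat_eq`). -/

lemma norm_iteratedFDeriv_section_continuous {V W G : Type*} [NormedAddCommGroup V]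
    [NormedSpace ℝ V] [NormedAddCommGroup W] [NormedSpace ℝ W] [NormedAddCommGroup G]
    [NormedSpace ℝ G] {g : V × W → G} (hg : ContDiff ℝ (⊤ : ℕ∞) g) (i : ℕ) :
    Continuous fun p : V × W => iteratedFDeriv ℝ i (fun y => g (p.1, y)) p.2 := by
  -- A partial derivative is the full derivative precomposed with the inclusion of the second
  -- factor, which reduces joint continuity to that of the full derivative.
  have h : ∀ p : V × W, iteratedFDeriv ℝ i (fun y => g (p.1, y)) p.2 =
      ContinuousMultilinearMap.compContinuousLinearMapL
        (fun _ => ContinuousLinearMap.inr ℝ V W) (iteratedFDeriv ℝ i g p) := by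
    intro p
    have h1 : (fun y => g (p.1, y)) =
        (fun q => g ((p.1, 0) + q)) ∘ (ContinuousLinearMap.inr ℝ V W) := by
      ext y; simp
    have h2 : ContDiff ℝ (⊤ : ℕ∞) (fun q => g ((p.1, 0) + q)) := by fun_prop
    rw [h1, ContinuousLinearMap.iteratedFDeriv_comp_right _ h2 _ (by exact_mod_cast le_top),
      iteratedFDeriv_comp_add_left]
    simp
  simp_rw [h]
  exact (ContinuousLinearMap.continuous _).comp
    (hg.continuous_iteratedFDeriv (by exact_mod_cast le_top))

variable {d : ℕ}

/-- The test function given by a smooth compactly supported function. -/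
def mkTest (g : EuclRd d → ℂ) (hg : ContDiff ℝ (⊤ : ℕ∞) g) (hc : HasCompactSupport g) :
    TestFn d :=
  ⟨g, hg, hc, Set.subset_univ _⟩

@[simp] lemma mkTest_apply (g : EuclRd d → ℂ) (hg : ContDiff ℝ (⊤ : ℕ∞) g)
    (hc : HasCompactSupport g) (x : EuclRd d) : mkTest g hg hc x = g x := rfl

lemma TestFn.sum_apply {ι : Type*} (s : Finset ι) (f : ι → TestFn d) (x : EuclRd d) :
    (∑ i ∈ s, f i) x = ∑ i ∈ s, f i x := by
  classical
  induction s using Finset.induction_on with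
  | empty => simp
  | insert a s ha ih => simp [Finset.sum_insert ha, ih]

/-- Distributions depend continuously on smooth parameters in the test function. -/
lemma DistrRd.continuous_param {V : Type*} [NormedAddCommGroup V] [NormedSpace ℝ V]
    (F : DistrRd d) (Φ : V → TestFn d)
    (hg : ContDiff ℝ (⊤ : ℕ∞) (fun p : V × EuclRd d => Φ p.1 p.2))
    {K : Set (EuclRd d)} (hK : IsCompact K) (hs : ∀ v, Function.support (Φ v) ⊆ K) :
    Continuous fun v => F (Φ v) := by
  let K' : TopologicalSpace.Compacts (EuclRd d) := ⟨K, hK⟩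
  let Ψ : V → 𝓓^{⊤}_{K'}(EuclRd d, ℂ) := fun v =>
    ContDiffMapSupportedIn.of_support_subset (Φ v).contDiff (hs v)
  have hΨ : Continuous Ψ := by
    rw [ContDiffMapSupportedIn.continuous_iff_comp]
    intro i
    rw [continuous_iff_continuousAt]
    intro v
    rw [ContinuousAt, BoundedContinuousFunction.tendsto_iff_tendstoUniformly]
    have hc := norm_iteratedFDeriv_section_continuous hg i
    intro u hu
    -- Test functions supported in `K` carry the topology of uniform convergence of all derivatives.
    -- Compactness of `K` upgrades joint continuity to uniformity in `y ∈ K`; off `K` every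
    -- derivative is zero.
    obtain ⟨s, hs', hsu⟩ := IsCompact.mem_uniformity_of_prod (s := Set.univ) (q := v)
      (f := fun (w : V) (y : EuclRd d) => iteratedFDeriv ℝ i (Φ w) y) hK
      (by exact hc.continuousOn) (Set.mem_univ v) (symm_le_uniformity hu)
    rw [nhdsWithin_univ] at hs'
    filter_upwards [hs'] with w hw y
    have hval : ∀ w, (ContDiffMapSupportedIn.structureMapCLM ℝ ⊤ i (Ψ w)) y =
        iteratedFDeriv ℝ i (Φ w) y := fun w => by
      rw [ContDiffMapSupportedIn.structureMapCLM_top_apply]; rfl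
    simp only [Function.comp_apply, hval]
    by_cases hy : y ∈ K
    · exact hsu w hw y hy
    · have hz : ∀ w, iteratedFDeriv ℝ i (Φ w) y = 0 := fun w => by
        have := (Ψ w).iteratedFDeriv_zero_on_compl (i := i) hy
        exact this
      rw [hz, hz]
      exact refl_mem_uniformity hu
  have hF : Continuous fun ψ : 𝓓^{⊤}_{K'}(EuclRd d, ℂ) =>
      F (TestFunction.ofSupportedIn (Ω := ⊤) (Set.subset_univ _) ψ) :=
    F.continuous.comp (TestFunction.continuous_ofSupportedIn _)
  exact hF.comp hΨ

/-- The plane wave `e^{-i x·ξ}`. -/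
def planeWave (ξ x : EuclRd d) : ℂ := cexp (-(I * (inner ℝ x ξ : ℝ)))

lemma contDiff_planeWave_uncurry :
    ContDiff ℝ (⊤ : ℕ∞) (fun p : EuclRd d × EuclRd d => planeWave p.1 p.2) := by
  unfold planeWave
  have h : ContDiff ℝ (⊤ : ℕ∞)
      (fun p : EuclRd d × EuclRd d => ((inner ℝ p.2 p.1 : ℝ) : ℂ)) :=
    ofRealCLM.contDiff.comp (contDiff_snd.inner ℝ contDiff_fst)
  exact (contDiff_const.mul h).neg.cexp

lemma contDiff_planeWave (ξ : EuclRd d) : ContDiff ℝ (⊤ : ℕ∞) (fun x => planeWave ξ x) := by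
  have h : ContDiff ℝ (⊤ : ℕ∞) (fun x : EuclRd d => ((inner ℝ x ξ : ℝ) : ℂ)) :=
    ofRealCLM.contDiff.comp (contDiff_id.inner ℝ contDiff_const)
  exact (contDiff_const.mul h).neg.cexp

@[simp] lemma norm_planeWave (ξ x : EuclRd d) : ‖planeWave ξ x‖ = 1 := by
  rw [planeWave, Complex.norm_exp]; simp

lemma planeWave_add (ξ η x : EuclRd d) : planeWave (ξ + η) x = planeWave ξ x * planeWave η x := by
  rw [planeWave, planeWave, planeWave, ← Complex.exp_add, inner_add_right]
  congr 1; push_cast; ring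

lemma conj_planeWave (ξ x : EuclRd d) : conj (planeWave ξ x) = planeWave (-ξ) x := by
  rw [planeWave, planeWave, ← Complex.exp_conj]
  simp

lemma hasFDerivAt_planeWave (ξ x : EuclRd d) (v : EuclRd d) :
    fderiv ℝ (planeWave ξ) x v = -(I * (inner ℝ v ξ : ℝ)) * planeWave ξ x := by
  have h1 : HasDerivAt (fun t : ℝ => planeWave ξ (x + t • v))
      (-(I * (inner ℝ v ξ : ℝ)) * planeWave ξ x) 0 := by
    have h2 : HasDerivAt (fun t : ℝ => -(I * ((inner ℝ x ξ + t * inner ℝ v ξ : ℝ) : ℂ)))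
        (-(I * (inner ℝ v ξ : ℝ))) 0 := by
      have h3 : HasDerivAt (fun t : ℝ => inner ℝ x ξ + t * inner ℝ v ξ) (inner ℝ v ξ) 0 := by
        simpa using ((hasDerivAt_id (0 : ℝ)).mul_const (inner ℝ v ξ)).const_add (inner ℝ x ξ)
      exact (h3.ofReal_comp.const_mul I).neg
    have h4 := h2.cexp
    simp only [zero_mul, add_zero] at h4
    rw [mul_comm, planeWave]
    convert h4 using 1
    ext t
    rw [planeWave, inner_add_left, inner_smul_left]
    simp
  have h5 : HasDerivAt (fun t : ℝ => planeWave ξ (x + t • v)) (fderiv ℝ (planeWave ξ) x v) 0 := by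
    have hd : HasFDerivAt (planeWave ξ) (fderiv ℝ (planeWave ξ) x) (x + (0 : ℝ) • v) := by
      simpa using ((contDiff_planeWave ξ).differentiable (by simp) x).hasFDerivAt
    have hl : HasDerivAt (fun t : ℝ => x + t • v) v 0 := by
      simpa using ((hasDerivAt_id (0 : ℝ)).smul_const v).const_add x
    exact hd.comp_hasDerivAt 0 hl
  exact h5.unique h1

/-- The product of a test function and a plane wave. -/
def waveTest (ξ : EuclRd d) : TestFn d →ₗ[ℂ] TestFn d where
  toFun χ := mkTest (fun x => χ x * planeWave ξ x) (χ.contDiff.mul (contDiff_planeWave ξ))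
    χ.hasCompactSupport.mul_right
  map_add' χ ψ := by ext x; simp [add_mul]
  map_smul' c χ := by ext x; simp [mul_assoc]

@[simp] lemma waveTest_apply (ξ : EuclRd d) (χ : TestFn d) (x : EuclRd d) :
    waveTest ξ χ x = χ x * planeWave ξ x := rfl

/-- This is the continuity of the Fourier transform of `χF`. It extends almost sure identities from
a dense sequence of frequencies to all of them, and makes the limit over an arc of directions
continuous. -/
lemma DistrRd.continuous_waveTest (F : DistrRd d) (χ : TestFn d) :
    Continuous fun ξ => F (waveTest ξ χ) := by
  refine F.continuous_param _ ?_ (K := tsupport χ) χ.hasCompactSupport ?_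
  · exact (χ.contDiff.comp contDiff_snd).mul contDiff_planeWave_uncurry
  · intro ξ x hx
    apply subset_tsupport
    rw [Function.mem_support] at hx ⊢
    intro h; apply hx; simp [h]

lemma lineDerivOp_apply (v : EuclRd d) (φ : TestFn d) (x : EuclRd d) :
    (∂_{v} φ) x = fderiv ℝ φ x v := rfl

/-- Conjugation by the plane wave turns `∂_v` into `∂_v - i v·ξ`, so differential operators on
modulated functions become polynomials in the shifted derivatives acting on the cutoff. -/
lemma lineDerivOp_waveTest (v ξ : EuclRd d) (χ : TestFn d) :
    ∂_{v} (waveTest ξ χ) = waveTest ξ (∂_{v} χ - (I * (inner ℝ v ξ : ℝ)) • χ) := by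
  ext x
  have h : fderiv ℝ (fun x => χ x * planeWave ξ x) x v =
      χ x * fderiv ℝ (planeWave ξ) x v + planeWave ξ x * fderiv ℝ χ x v := by
    rw [fderiv_fun_mul (χ.contDiff.differentiable (by simp) x)
      ((contDiff_planeWave ξ).differentiable (by simp) x)]
    simp
  rw [lineDerivOp_apply, waveTest_apply]
  change fderiv ℝ (fun x => χ x * planeWave ξ x) x v =
    (fderiv ℝ χ x v - (I * (inner ℝ v ξ : ℝ)) * χ x) * planeWave ξ x
  rw [h, hasFDerivAt_planeWave]
  ring

lemma lineDerivOp_sub' (v : EuclRd d) (φ ψ : TestFn d) : ∂_{v} (φ - ψ) = ∂_{v} φ - ∂_{v} ψ :=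
  map_sub (TestFunction.lineDerivCLM ℝ v) φ ψ

lemma lineDerivOp_smul' (v : EuclRd d) (c : ℂ) (φ : TestFn d) : ∂_{v} (c • φ) = c • ∂_{v} φ :=
  map_smul (TestFunction.lineDerivCLM ℂ v) c φ

lemma lineDerivOp_lineDerivOp_apply (v w : EuclRd d) (φ : TestFn d) (x : EuclRd d) :
    (∂_{v} (∂_{w} φ)) x = fderiv ℝ (fderiv ℝ φ) x v w := by
  rw [lineDerivOp_apply]
  change fderiv ℝ (fun y => fderiv ℝ φ y w) x v = _
  have hd : DifferentiableAt ℝ (fderiv ℝ φ) x :=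
    (φ.contDiff.fderiv_right (m := 1) (by norm_num; exact ENat.LEInfty.out)).differentiable
      (by simp) x
  rw [fderiv_clm_apply hd (differentiableAt_const w)]
  simp

lemma lineDerivOp_comm (v w : EuclRd d) (φ : TestFn d) : ∂_{v} (∂_{w} φ) = ∂_{w} (∂_{v} φ) := by
  ext x
  rw [lineDerivOp_lineDerivOp_apply, lineDerivOp_lineDerivOp_apply]
  have hs : IsSymmSndFDerivAt ℝ φ x :=
    (φ.contDiff.contDiffAt).isSymmSndFDerivAt (by simp; exact ENat.LEInfty.out)
  exact hs v w

lemma sum_single_smul (ξ : EuclRd d) :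
    ξ = ∑ i, (ξ i) • (EuclideanSpace.single i (1 : ℝ) : EuclRd d) := by
  ext j
  simp [Pi.single_apply]

lemma lineDerivOp_eq_sum (ξ : EuclRd d) (φ : TestFn d) :
    ∂_{ξ} φ = ∑ i, ((ξ i : ℝ) : ℂ) • ∂_{(EuclideanSpace.single i (1 : ℝ) : EuclRd d)} φ := by
  ext x
  rw [lineDerivOp_apply]
  conv_lhs => rw [sum_single_smul ξ]
  rw [map_sum, TestFn.sum_apply]
  refine Finset.sum_congr rfl fun i _ => ?_
  rw [map_smul]
  simp [lineDerivOp_apply]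

lemma lapTest_apply_sum (φ : TestFn d) : lapTest φ =
    ∑ i : Fin d, ∂_{(EuclideanSpace.single i (1 : ℝ) : EuclRd d)}
    (∂_{(EuclideanSpace.single i (1 : ℝ) : EuclRd d)} φ) := rfl

lemma lapTest_sub (φ ψ : TestFn d) : lapTest (φ - ψ) = lapTest φ - lapTest ψ := by
  simp only [lapTest_apply_sum, lineDerivOp_sub', Finset.sum_sub_distrib]

lemma lapTest_smul (c : ℂ) (φ : TestFn d) : lapTest (c • φ) = c • lapTest φ := by
  simp only [lapTest_apply_sum, lineDerivOp_smul', Finset.smul_sum]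

lemma lineDerivOp_lapTest_comm (v : EuclRd d) (φ : TestFn d) :
    ∂_{v} (lapTest φ) = lapTest (∂_{v} φ) := by
  rw [lapTest_apply_sum, lapTest_apply_sum]
  rw [show ∂_{v} (∑ i : Fin d, ∂_{(EuclideanSpace.single i (1 : ℝ) : EuclRd d)}
    (∂_{(EuclideanSpace.single i (1 : ℝ) : EuclRd d)} φ)) = ∑ i : Fin d, ∂_{v} (∂_{(EuclideanSpace.single i (1 : ℝ) : EuclRd d)}
    (∂_{(EuclideanSpace.single i (1 : ℝ) : EuclRd d)} φ)) from
      map_sum (TestFunction.lineDerivCLM ℝ v) _ _]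
  refine Finset.sum_congr rfl fun i _ => ?_
  rw [lineDerivOp_comm v, lineDerivOp_comm v]

lemma lapTest_waveTest (ξ : EuclRd d) (χ : TestFn d) :
    lapTest (waveTest ξ χ) =
      waveTest ξ (lapTest χ - (2 * I) • ∂_{ξ} χ - ((‖ξ‖ : ℂ) ^ 2) • χ) := by
  have hn : (‖ξ‖ : ℂ) ^ 2 = ∑ i, ((ξ i : ℝ) : ℂ) ^ 2 := by
    have := EuclideanSpace.real_norm_sq_eq ξ
    exact_mod_cast congrArg (fun t : ℝ => (t : ℂ)) this
  rw [lapTest_apply_sum]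
  simp only [lineDerivOp_waveTest, lineDerivOp_sub', lineDerivOp_smul']
  rw [← map_sum, lineDerivOp_eq_sum, lapTest_apply_sum, hn, Finset.smul_sum, Finset.sum_smul,
    ← Finset.sum_sub_distrib, ← Finset.sum_sub_distrib]
  congr 1
  refine Finset.sum_congr rfl fun i _ => ?_
  have : (inner ℝ (EuclideanSpace.single i (1 : ℝ) : EuclRd d) ξ : ℝ) = ξ i := by
    simp [EuclideanSpace.inner_single_left]
  rw [this]
  have hI : (I * (ξ i : ℂ)) * (I * (ξ i : ℂ)) = -((ξ i : ℂ) ^ 2) := by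
    linear_combination ((ξ i : ℂ)^2) * Complex.I_mul_I
  rw [smul_sub, smul_smul, hI]
  module

end

noncomputable section

/-! ### Oscillatory integrals -/

/-- The half-line Gaussian moments `∫_0^∞ β^k e^{-bβ²} dβ` for `k = 0, 1`, continued to `Re b = 0`. -/
def halfGauss (k : ℕ) (b : ℂ) : ℂ :=
  if k = 0 then ((Real.pi : ℂ) / b) ^ (1 / 2 : ℂ) / 2 else (2 * b)⁻¹

/-- The exponent `k` is `d - 2` in the applications, the power of the sine in the spherical measure.
This is why the values 0 and 1 suffice. -/
lemma integral_pow_mul_gauss {k : ℕ} (hk : k = 0 ∨ k = 1) {b : ℂ} (hb : 0 < b.re) :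
    ∫ β : ℝ in Set.Ioi 0, (β : ℂ) ^ k * cexp (-b * (β : ℂ) ^ 2) = halfGauss k b := by
  rcases hk with rfl | rfl
  · simpa [halfGauss] using integral_gaussian_complex_Ioi hb
  · simpa [halfGauss] using integral_mul_cexp_neg_mul_sq hb

/-- In the closed right half-plane without the origin, `π/b` never meets the negative real axis, so
the principal square root has no jump up to the imaginary axis, where the Fresnel integrals live. -/
lemma continuousAt_halfGauss (k : ℕ) {b : ℂ} (hb : b ≠ 0) (hre : 0 ≤ b.re) :
    ContinuousAt (halfGauss k) b := by
  unfold halfGauss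
  split_ifs with h
  · refine ContinuousAt.div_const ?_ _
    refine ContinuousAt.cpow (continuousAt_const.div continuousAt_id hb) continuousAt_const ?_
    rw [Complex.mem_slitPlane_iff]
    have hn : 0 < normSq b := normSq_pos.mpr hb
    by_cases h0 : b.im = 0
    · left
      have : 0 < b.re := lt_of_le_of_ne hre fun h => hb (Complex.ext h.symm h0)
      simp only [Complex.div_re, ofReal_re, ofReal_im, zero_mul, zero_div, add_zero]
      positivity
    · right
      simp only [Complex.div_im, ofReal_re, ofReal_im, zero_mul, zero_div, zero_sub]
      have := Real.pi_pos.ne'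
      simp [h0, hn.ne']
  · exact (continuousAt_const.mul continuousAt_id).inv₀ (by simpa using hb)

/-- Two integrations by parts in an oscillatory integral. -/
lemma norm_integral_mul_exp_le {q q' q'' : ℝ → ℂ} (h1 : ∀ s, HasDerivAt q (q' s) s)
    (h2 : ∀ s, HasDerivAt q' (q'' s) s) (h3 : Continuous q'') {a b : ℝ} (hab : a ≤ b)
    (ha : q a = 0) (hb : q b = 0) (ha' : q' a = 0) (hb' : q' b = 0) {M : ℝ}
    (hM : ∀ s, ‖q'' s‖ ≤ M) {μ : ℝ} (hμ : μ ≠ 0) :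
    ‖∫ s in a..b, q s * cexp (I * μ * s)‖ ≤ M * (b - a) / μ ^ 2 := by
  have hμ' : (I * μ : ℂ) ≠ 0 := by simp [hμ]
  have hv : ∀ s : ℝ, HasDerivAt (fun s : ℝ => cexp (I * μ * s) / (I * μ)) (cexp (I * μ * s)) s := by
    intro s
    have h : HasDerivAt (fun s : ℝ => I * μ * (s : ℂ)) (I * μ) s := by
      simpa using (hasDerivAt_id s).ofReal_comp.const_mul (I * μ : ℂ)
    have := h.cexp.div_const (I * μ)
    rwa [mul_div_assoc, div_self hμ', mul_one] at this
  have hce : Continuous fun s : ℝ => cexp (I * μ * s) := by fun_prop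
  have hq'c : Continuous q' := continuous_iff_continuousAt.2 fun s => (h2 s).continuousAt
  -- Each integration by parts gains a factor `1/(iμ)`, and the vanishing of `q` and `q'` at both
  -- ends removes the boundary terms.
  have key : ∀ p p' : ℝ → ℂ, (∀ s, HasDerivAt p (p' s) s) → Continuous p' → p a = 0 → p b = 0 →
      ∫ s in a..b, p s * cexp (I * μ * s) = -(∫ s in a..b, p' s * cexp (I * μ * s)) / (I * μ) := by
    intro p p' hp hp' hpa hpb
    rw [intervalIntegral.integral_mul_deriv_eq_deriv_mul (fun s _ => hp s) (fun s _ => hv s)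
      (hp'.intervalIntegrable _ _) (hce.intervalIntegrable _ _), hpa, hpb]
    simp_rw [mul_div_assoc']
    rw [intervalIntegral.integral_div]
    ring
  rw [key q q' h1 hq'c ha hb, key q' q'' h2 h3 ha' hb', neg_div, norm_neg, norm_div, norm_div, norm_neg]
  have hn : ‖(I * μ : ℂ)‖ = |μ| := by simp
  rw [hn, div_div, abs_mul_abs_self, ← pow_two]
  gcongr
  calc _ ≤ M * |b - a| := by
        refine intervalIntegral.norm_integral_le_of_norm_le_const fun s _ => ?_
        have : ‖cexp (I * μ * s)‖ = 1 := by
          rw [show (I * μ * s : ℂ) = ((μ * s : ℝ) : ℂ) * I by push_cast; ring]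
          exact Complex.norm_exp_ofReal_mul_I _
        rw [norm_mul, this, mul_one]
        exact hM s
    _ = _ := by rw [abs_of_nonneg (sub_nonneg.2 hab)]

/-- This is the majorant for the rescaled angular integrals: decay `t^{-2}` in a phase `t` of size
`β²` becomes `β^{-4}`, which absorbs the extra factor `β` of dimension three. -/
lemma integrable_pow_mul_inv {k : ℕ} (hk : k = 0 ∨ k = 1) {c : ℝ} (hc : 0 < c) :
    Integrable (fun β : ℝ => |β| ^ k * (1 + c * β ^ 4)⁻¹) := by
  have hint := integrable_inv_one_add_sq.const_mul (1 + c⁻¹ : ℝ)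
  refine hint.mono' (by
    refine Continuous.aestronglyMeasurable ?_
    have : ∀ x : ℝ, 1 + c * x ^ 4 ≠ 0 := fun x => by positivity
    fun_prop (disch := assumption)) (ae_of_all _ fun β => ?_)
  rw [Real.norm_of_nonneg (by positivity), ← div_eq_mul_inv, ← div_eq_mul_inv,
    div_le_div_iff₀ (by positivity) (by positivity)]
  have hcc : c * c⁻¹ = 1 := mul_inv_cancel₀ hc.ne'
  have hci : 0 < c⁻¹ := inv_pos.2 hc
  have hb4 : β ^ 4 = |β| ^ 4 := by rw [← abs_pow, abs_of_nonneg (by positivity)]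
  have hb2 : β ^ 2 = |β| ^ 2 := (sq_abs β).symm
  rw [hb4, hb2]
  have h0 : 0 ≤ |β| := abs_nonneg β
  generalize |β| = x at h0
  have e : (1 + c⁻¹) * (1 + c * x ^ 4) = 1 + c⁻¹ + c * x ^ 4 + x ^ 4 := by
    linear_combination x ^ 4 * hcc
  rw [e]
  have hcx : 0 ≤ c * x ^ 4 := by positivity
  rcases hk with rfl | rfl
  · have h : c⁻¹ - 2 * x ^ 2 + c * x ^ 4 = c⁻¹ * (1 - c * x ^ 2) ^ 2 := by
      linear_combination (2 * x ^ 2 - c * x ^ 4) * hcc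
    have : 0 ≤ c⁻¹ * (1 - c * x ^ 2) ^ 2 := by positivity
    nlinarith [sq_nonneg x, sq_nonneg (x ^ 2)]
  · have h : 1 - x - x ^ 3 + x ^ 4 = (1 - x) ^ 2 * (1 + x + x ^ 2) := by ring
    have : 0 ≤ (1 - x) ^ 2 * (1 + x + x ^ 2) := by positivity
    nlinarith

/-- The Fresnel type integral `∫_0^∞ β^k ∫ q(s) e^{iκsβ²/2} ds dβ`. -/
lemma integral_pow_mul_osc {k : ℕ} (hk : k = 0 ∨ k = 1) {q : ℝ → ℂ} (hq : Continuous q)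
    {κ R C : ℝ} (hκ : 0 < κ) (hR : 1 ≤ R)
    (hC : ∀ t : ℝ, 0 ≤ t → ‖∫ s in (1 : ℝ)..R, q s * cexp (I * (κ * t : ℝ) * s)‖ ≤ C * (1 + t ^ 2)⁻¹) :
    ∫ β : ℝ in Set.Ioi 0, (β : ℂ) ^ k *
      (∫ s in (1 : ℝ)..R, q s * cexp (I * (κ * (β ^ 2 / 2) : ℝ) * s)) =
    ∫ s in (1 : ℝ)..R, q s * halfGauss k (-(I * κ * s / 2)) := by
  set G : ℝ → ℂ := fun β => ∫ s in (1 : ℝ)..R, q s * cexp (I * (κ * (β ^ 2 / 2) : ℝ) * s) with hG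
  have hGc : Continuous G := by
    refine intervalIntegral.continuous_parametric_intervalIntegral_of_continuous' ?_ _ _
    fun_prop
  -- The double integral does not converge absolutely, so a factor `e^{-εβ²}` is inserted. As `ε →
  -- 0` it is removed from the iterated integral by the assumed decay of the inner integral.
  have hlim1 : Tendsto (fun ε : ℝ => ∫ β : ℝ in Set.Ioi 0,
      (β : ℂ) ^ k * (cexp (-(ε : ℂ) * (β : ℂ) ^ 2) * G β)) (𝓝[>] 0)
      (𝓝 (∫ β : ℝ in Set.Ioi 0, (β : ℂ) ^ k * G β)) := by
    refine tendsto_integral_filter_of_dominated_convergence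
      (fun β => C * (|β| ^ k * (1 + (1 / 4) * β ^ 4)⁻¹)) ?_ ?_ ?_ ?_
    · exact Eventually.of_forall fun ε => Continuous.aestronglyMeasurable (by fun_prop)
    · filter_upwards [self_mem_nhdsWithin] with ε hε
      refine ae_of_all _ fun β => ?_
      have h1 : ‖cexp (-(ε : ℂ) * (β : ℂ) ^ 2)‖ ≤ 1 := by
        rw [show -(ε : ℂ) * (β : ℂ) ^ 2 = ((-(ε * β ^ 2) : ℝ) : ℂ) by push_cast; ring,
          ← Complex.ofReal_exp, Complex.norm_real, Real.norm_of_nonneg (Real.exp_pos _).le]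
        have hε' : 0 < ε := hε
        exact Real.exp_le_one_iff.2 (by nlinarith [sq_nonneg β])
      have h2 := hC (β ^ 2 / 2) (by positivity)
      have h3 : (β ^ 2 / 2) ^ 2 = 1 / 4 * β ^ 4 := by ring
      rw [h3] at h2
      rw [norm_mul, norm_mul, norm_pow, Complex.norm_real, Real.norm_eq_abs]
      calc |β| ^ k * (‖cexp (-(ε : ℂ) * (β : ℂ) ^ 2)‖ * ‖G β‖)
          ≤ |β| ^ k * (1 * (C * (1 + 1 / 4 * β ^ 4)⁻¹)) := by gcongr
        _ = _ := by ring
    · exact ((integrable_pow_mul_inv hk (by norm_num)).const_mul C).integrableOn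
    · refine ae_of_all _ fun β => ?_
      have : Continuous fun ε : ℝ => (β : ℂ) ^ k * (cexp (-(ε : ℂ) * (β : ℂ) ^ 2) * G β) := by
        fun_prop
      have h := this.tendsto 0
      simp only [ofReal_zero, neg_zero, zero_mul, Complex.exp_zero, one_mul] at h
      exact h.mono_left nhdsWithin_le_nhds
  -- On the other side the limit is the passage of `b = ε - iκs/2` to the imaginary axis. Since `s ≥
  -- 1`, `b` stays away from 0.
  have hlim2 : Tendsto (fun ε : ℝ => ∫ s in (1 : ℝ)..R, q s * halfGauss k (ε - I * κ * s / 2))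
      (𝓝[>] 0) (𝓝 (∫ s in (1 : ℝ)..R, q s * halfGauss k (-(I * κ * s / 2)))) := by
    have hcont : ContinuousOn (fun p : ℝ × ℝ => q p.2 * halfGauss k (p.1 - I * κ * p.2 / 2))
        (Set.Icc 0 1 ×ˢ Set.Icc 1 R) := by
      intro p hp
      refine ContinuousAt.continuousWithinAt ?_
      refine (hq.comp continuous_snd).continuousAt.mul ?_
      have hb : ((p.1 : ℂ) - I * κ * p.2 / 2) ≠ 0 := by
        intro h
        have := congrArg Complex.im h
        simp at this
        rcases this with h | h
        · exact hκ.ne' h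
        · have := hp.2.1; linarith
      have hre : 0 ≤ ((p.1 : ℂ) - I * κ * p.2 / 2).re := by
        simpa using hp.1.1
      exact ContinuousAt.comp (f := fun p : ℝ × ℝ => ((p.1 : ℂ) - I * κ * p.2 / 2))
        (continuousAt_halfGauss k hb hre) (by fun_prop)
    obtain ⟨M, hM⟩ := (isCompact_Icc.prod isCompact_Icc).exists_bound_of_continuousOn hcont
    have hsub : ∀ s ∈ Set.uIoc 1 R, s ∈ Set.Icc 1 R := fun s hs => by
      rw [Set.uIoc_of_le hR] at hs; exact ⟨hs.1.le, hs.2⟩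
    have hev : ∀ᶠ ε : ℝ in 𝓝[>] 0, ε ∈ Set.Icc (0 : ℝ) 1 := by
      filter_upwards [Ioc_mem_nhdsGT (zero_lt_one' ℝ)] with ε hε using ⟨hε.1.le, hε.2⟩
    refine intervalIntegral.tendsto_integral_filter_of_dominated_convergence (fun _ => M) ?_ ?_
      intervalIntegrable_const ?_
    · filter_upwards [hev] with ε hε
      refine ContinuousOn.aestronglyMeasurable ?_ measurableSet_uIoc
      exact hcont.comp (f := fun s : ℝ => (ε, s)) (by fun_prop) fun s hs => ⟨hε, hsub s hs⟩
    · filter_upwards [hev] with ε hε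
      exact ae_of_all _ fun s hs => hM (ε, s) ⟨hε, hsub s hs⟩
    · refine ae_of_all _ fun s hs => ?_
      have h := (hcont (0, s) ⟨by simp, hsub s hs⟩).comp (f := fun ε : ℝ => (ε, s))
        (s := Set.Icc 0 1) (x := 0) (by fun_prop) fun ε hε => ⟨hε, hsub s hs⟩
      have h' := h.tendsto
      simp only [Function.comp_def, ofReal_zero, zero_sub] at h'
      refine h'.mono_left ?_
      exact le_inf (nhdsWithin_le_nhds) (by
        rw [le_principal_iff]; exact hev)
  refine tendsto_nhds_unique hlim1 (hlim2.congr' ?_)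
  filter_upwards [self_mem_nhdsWithin] with ε hε
  have hε' : 0 < ε := hε
  have hb : ∀ s : ℝ, 0 < ((ε : ℂ) - I * κ * s / 2).re := fun s => by simpa using hε'
  simp_rw [← fun s : ℝ => integral_pow_mul_gauss hk (hb s)]
  rw [intervalIntegral.integral_of_le hR]
  simp_rw [hG, intervalIntegral.integral_of_le hR, ← integral_const_mul]
  rw [integral_integral_swap]
  · refine setIntegral_congr_fun measurableSet_Ioi fun β _ => ?_
    refine setIntegral_congr_fun measurableSet_Ioc fun s _ => ?_
    have : cexp (-(ε - I * κ * s / 2) * (β : ℂ) ^ 2) =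
        cexp (-(ε : ℂ) * (β : ℂ) ^ 2) * cexp (I * (κ * (β ^ 2 / 2) : ℝ) * s) := by
      rw [← Complex.exp_add]; congr 1; push_cast; ring
    simp only [this]
    ring
  · have hg1 : Integrable (fun β : ℝ => |β| ^ k * Real.exp (-ε * β ^ 2))
        (volume.restrict (Set.Ioi 0)) := by
      rcases hk with rfl | rfl
      · simpa [IntegrableOn] using (integrable_exp_neg_mul_sq hε').integrableOn (s := Set.Ioi 0)
      · have := (integrable_mul_exp_neg_mul_sq hε').norm.integrableOn (s := Set.Ioi 0)
        refine this.congr (ae_of_all _ fun β => ?_)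
        simp
    have hg2 : Integrable (fun s : ℝ => ‖q s‖) (volume.restrict (Set.Ioc 1 R)) :=
      (hq.norm.continuousOn.integrableOn_Icc (a := 1) (b := R)).mono_set Set.Ioc_subset_Icc_self
    refine (hg2.mul_prod hg1).mono' ?_ ?_
    · exact Continuous.aestronglyMeasurable (by simp only [Function.uncurry_def]; fun_prop)
    · refine ae_of_all _ fun p => ?_
      simp only [Function.uncurry_def]
      rw [norm_mul, norm_mul, norm_pow, Complex.norm_real, Real.norm_eq_abs]
      refine le_of_eq ?_
      congr 2
      rw [Complex.norm_exp]
      congr 1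
      rw [show ((p.2 : ℂ)) ^ 2 = ((p.2 ^ 2 : ℝ) : ℂ) by push_cast; ring]
      simp [Complex.mul_re, -ofReal_pow]

end

noncomputable section

/-! ### Spherical coordinates around an axis -/

lemma integrableOn_of_bounded_support {α : Type*} [MeasurableSpace α] {μ : Measure α} {f : α → ℂ}
    (hf : AEStronglyMeasurable f μ) {s t : Set α} (ht : MeasurableSet t) (hμ : μ t ≠ ⊤) {M : ℝ}
    (hM : ∀ x ∈ t, ‖f x‖ ≤ M) (h0 : ∀ x ∈ s, x ∉ t → f x = 0) (hs : MeasurableSet s) :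
    IntegrableOn f s μ := by
  have h1 : IntegrableOn f t μ := Measure.integrableOn_of_bounded hμ hf
    ((ae_restrict_iff' ht).2 (ae_of_all _ hM))
  have h2 : IntegrableOn f (s ∩ t) μ := h1.mono_set Set.inter_subset_right
  exact h2.of_forall_sdiff_eq_zero hs fun x hx => h0 x hx.1 fun hxt => hx.2 ⟨hx.1, hxt⟩

lemma integrableOn_polar {F : ℝ × ℝ → ℂ} (hF : Measurable F) {M R : ℝ} (hM : ∀ p, ‖F p‖ ≤ M)
    (hR : 0 ≤ R) (h0 : ∀ p : ℝ × ℝ, R ^ 2 < p.1 ^ 2 + p.2 ^ 2 → F p = 0) :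
    IntegrableOn (fun q : ℝ × ℝ => q.2 • F (q.2 * Real.cos q.1, q.2 * Real.sin q.1))
      (Set.Ioo (-Real.pi) Real.pi ×ˢ Set.Ioi 0) (volume.prod volume) := by
  refine integrableOn_of_bounded_support (t := Set.Icc (-Real.pi) Real.pi ×ˢ Set.Icc 0 R)
    (M := R * M) ?_ (measurableSet_Icc.prod measurableSet_Icc) ?_ ?_ ?_
    (measurableSet_Ioo.prod measurableSet_Ioi)
  · refine (Measurable.aestronglyMeasurable ?_)
    exact measurable_snd.smul (hF.comp (by fun_prop))
  · rw [Measure.prod_prod]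
    exact ENNReal.mul_ne_top (by simp) (by simp)
  · rintro ⟨α, s⟩ ⟨_, hs⟩
    rw [norm_smul, Real.norm_of_nonneg hs.1]
    exact mul_le_mul hs.2 (hM _) (norm_nonneg _) hR
  · rintro ⟨α, s⟩ ⟨hα, hs⟩ hn
    have hsR : R < s := by
      by_contra h
      exact hn ⟨⟨hα.1.le, hα.2.le⟩, ⟨(Set.mem_Ioi.1 hs).le, not_lt.1 h⟩⟩
    have : F (s * Real.cos α, s * Real.sin α) = 0 := by
      apply h0
      have : (s * Real.cos α) ^ 2 + (s * Real.sin α) ^ 2 = s ^ 2 := by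
        linear_combination s ^ 2 * Real.cos_sq_add_sin_sq α
      simp only [this]
      exact pow_lt_pow_left₀ hsR hR two_ne_zero
    simp only [this, smul_zero]

lemma integral_polar {F : ℝ × ℝ → ℂ} (hF : Measurable F) {M R : ℝ} (hM : ∀ p, ‖F p‖ ≤ M)
    (hR : 0 ≤ R) (h0 : ∀ p : ℝ × ℝ, R ^ 2 < p.1 ^ 2 + p.2 ^ 2 → F p = 0) :
    ∫ p, F p = ∫ α in Set.Ioo (-Real.pi) Real.pi, ∫ s in Set.Ioi (0 : ℝ),
      s • F (s * Real.cos α, s * Real.sin α) := by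
  rw [← integral_comp_polarCoord_symm, polarCoord_target, Measure.volume_eq_prod,
    ← setIntegral_prod_swap, setIntegral_prod]
  · rfl
  · exact integrableOn_polar hF hM hR h0

/-- The unit vector at angle `α` from the axis `θ` towards `e`. -/
def axisVec {d : ℕ} (θ e : EuclRd d) (α : ℝ) : EuclRd d := Real.cos α • θ + Real.sin α • e

lemma norm_axisVec {d : ℕ} {θ e : EuclRd d} (hθ : ‖θ‖ = 1) (he : ‖e‖ = 1)
    (h : inner ℝ θ e = 0) (α : ℝ) : ‖axisVec θ e α‖ = 1 := by
  have : ‖axisVec θ e α‖ ^ 2 = 1 := by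
    rw [axisVec, norm_add_sq_real, inner_smul_left, inner_smul_right, h, norm_smul, norm_smul,
      hθ, he]
    simp
  nlinarith [norm_nonneg (axisVec θ e α)]

lemma inner_axisVec {d : ℕ} {θ e : EuclRd d} (hθ : ‖θ‖ = 1)
    (h : inner ℝ θ e = 0) (α : ℝ) : inner ℝ (axisVec θ e α) θ = Real.cos α := by
  rw [axisVec, inner_add_left, inner_smul_left, inner_smul_left, real_inner_self_eq_norm_sq, hθ,
    real_inner_comm, h]
  simp

lemma exists_orthonormalBasis_first {n : ℕ} (θ : EuclRd (n + 1)) (hθ : ‖θ‖ = 1) :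
    ∃ b : OrthonormalBasis (Fin (n + 1)) ℝ (EuclRd (n + 1)), b 0 = θ := by
  have ho : Orthonormal ℝ (({0} : Set (Fin (n + 1))).domRestrict fun _ => θ) := by
    constructor
    · intro i; simpa using hθ
    · intro i j hij
      exact absurd (Subsingleton.elim i j) hij
  obtain ⟨b, hb⟩ := ho.exists_orthonormalBasis_extension_of_card_eq (by simp)
  exact ⟨b, hb 0 rfl⟩

lemma integral_eq_integral_coord {n : ℕ} (b : OrthonormalBasis (Fin n) ℝ (EuclRd n))
    (f : EuclRd n → ℂ) : ∫ y, f y = ∫ x : Fin n → ℝ, f (∑ i, x i • b i) := by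
  have h1 := b.measurePreserving_repr_symm.integral_comp
    b.repr.symm.toHomeomorph.measurableEmbedding f
  have h2 := (EuclideanSpace.volume_preserving_symm_measurableEquiv_toLp (Fin n)).symm.integral_comp'
    (fun y => f (b.repr.symm y))
  rw [← h1, ← h2]
  congr 1
  ext x
  congr 1
  rw [← b.sum_repr (b.repr.symm _)]
  simp

lemma norm_sq_sum_smul {n : ℕ} (b : OrthonormalBasis (Fin n) ℝ (EuclRd n)) (x : Fin n → ℝ) :
    ‖∑ i, x i • b i‖ ^ 2 = ∑ i, x i ^ 2 := by
  rw [← b.sum_sq_norm_inner_right]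
  refine Finset.sum_congr rfl fun i _ => ?_
  rw [b.orthonormal.inner_right_fintype]
  simp

lemma exists_bound_of_hasCompactSupport {d : ℕ} {f : EuclRd d → ℂ} (hf : Continuous f)
    (hc : HasCompactSupport f) : ∃ M R : ℝ, 0 ≤ R ∧ (∀ y, ‖f y‖ ≤ M) ∧
      ∀ y, R < ‖y‖ → f y = 0 := by
  obtain ⟨M, hM⟩ := hf.bounded_above_of_compact_support hc
  obtain ⟨R, hR⟩ := hc.isBounded.exists_norm_le
  refine ⟨M, max R 0, le_max_right _ _, hM, fun y hy => ?_⟩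
  by_contra h
  exact absurd (hR y (subset_tsupport f h)) (not_le.2 ((le_max_left _ _).trans_lt hy))

lemma setIntegral_Ioo_neg_pi {H : ℝ → ℂ} (hH : IntegrableOn H (Set.Ioo (-Real.pi) Real.pi)) :
    ∫ α in Set.Ioo (-Real.pi) Real.pi, H α =
      (∫ α in Set.Ioo 0 Real.pi, H α) + ∫ α in Set.Ioo 0 Real.pi, H (-α) := by
  have hpi := Real.pi_pos
  simp_rw [← integral_Ioc_eq_integral_Ioo]
  rw [← intervalIntegral.integral_of_le (by linarith), ← intervalIntegral.integral_of_le hpi.le,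
    ← intervalIntegral.integral_of_le hpi.le, intervalIntegral.integral_comp_neg, neg_zero, add_comm]
  have hI : IntegrableOn H (Set.Ioc (-Real.pi) Real.pi) := by
    rwa [integrableOn_Ioc_iff_integrableOn_Ioo]
  rw [intervalIntegral.integral_add_adjacent_intervals]
  · rw [intervalIntegrable_iff_integrableOn_Ioc_of_le (by linarith)]
    exact hI.mono_set (Set.Ioc_subset_Ioc_right hpi.le)
  · rw [intervalIntegrable_iff_integrableOn_Ioc_of_le hpi.le]
    exact hI.mono_set (Set.Ioc_subset_Ioc_left (by linarith))

/-- The total mass of the sphere of dimension `d - 2`, for `d = 2, 3`. -/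
def equatorMass (d : ℕ) : ℝ := if d = 2 then 2 else 2 * Real.pi

/-- The circle is split into two half circles at the axis, so that the angle from the axis runs over
`(0, π)` as in dimension three and one asymptotic analysis serves both dimensions. -/
lemma integral_spherical_two (θ : EuclRd 2) (hθ : ‖θ‖ = 1) :
    ∃ e : EuclRd 2, ‖e‖ = 1 ∧ inner ℝ θ e = 0 ∧ ∀ f : EuclRd 2 → ℂ, Continuous f →
      HasCompactSupport f → ∫ y, f y =
        (∫ α in Set.Ioo 0 Real.pi, ∫ s in Set.Ioi (0 : ℝ), s • f (s • axisVec θ e α)) +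
        ∫ α in Set.Ioo 0 Real.pi, ∫ s in Set.Ioi (0 : ℝ), s • f (s • axisVec θ (-e) α) := by
  obtain ⟨b, rfl⟩ := exists_orthonormalBasis_first θ hθ
  refine ⟨b 1, b.orthonormal.1 1, b.orthonormal.2 (by simp), fun f hf hc => ?_⟩
  obtain ⟨M, R, hR, hM, h0⟩ := exists_bound_of_hasCompactSupport hf hc
  set F : ℝ × ℝ → ℂ := fun p => f (p.1 • b 0 + p.2 • b 1) with hF
  have hFm : Measurable F := (hf.comp (by fun_prop)).measurable
  have hF0 : ∀ p : ℝ × ℝ, R ^ 2 < p.1 ^ 2 + p.2 ^ 2 → F p = 0 := fun p hp => by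
    refine h0 _ ?_
    have h := norm_sq_sum_smul b ![p.1, p.2]
    rw [Fin.sum_univ_two, Fin.sum_univ_two] at h
    simp only [Matrix.cons_val_zero, Matrix.cons_val_one] at h
    rw [← h] at hp
    exact lt_of_pow_lt_pow_left₀ 2 (norm_nonneg _) hp
  have hp := integral_polar hFm (fun p => hM _) hR hF0
  have hint := (integrableOn_polar hFm (fun p => hM _) hR hF0)
  rw [IntegrableOn, ← Measure.prod_restrict] at hint
  rw [integral_eq_integral_coord b f,
    show (fun x : Fin 2 → ℝ => f (∑ i, x i • b i)) = fun x => F (MeasurableEquiv.finTwoArrow x) by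
      ext x; simp [hF],
    (volume_preserving_finTwoArrow ℝ).integral_comp' F, hp,
    setIntegral_Ioo_neg_pi hint.integral_prod_left]
  simp only [hF, axisVec, smul_add, smul_smul, Real.cos_neg, Real.sin_neg, smul_neg,
    mul_neg, neg_smul]

/-- Polar coordinates are used twice: in the plane orthogonal to the axis, then in the half-plane
spanned by the axis and the resulting radius. The Jacobians `q` and `s`, with `q = s sin α`,
multiply to `s² sin α`. -/
lemma integral_spherical_three (θ : EuclRd 3) (hθ : ‖θ‖ = 1) :
    ∃ e₁ e₂ : EuclRd 3, ‖e₁‖ = 1 ∧ ‖e₂‖ = 1 ∧ inner ℝ e₁ e₂ = 0 ∧ inner ℝ θ e₁ = 0 ∧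
      inner ℝ θ e₂ = 0 ∧ ∀ f : EuclRd 3 → ℂ, Continuous f →
      HasCompactSupport f → ∫ y, f y = ∫ β in Set.Ioo (-Real.pi) Real.pi,
        ∫ α in Set.Ioo 0 Real.pi, Real.sin α •
          ∫ s in Set.Ioi (0 : ℝ), s ^ 2 • f (s • axisVec θ (axisVec e₁ e₂ β) α) := by
  obtain ⟨b, rfl⟩ := exists_orthonormalBasis_first θ hθ
  refine ⟨b 1, b 2, b.orthonormal.1 1, b.orthonormal.1 2, b.orthonormal.2 (by decide),
    b.orthonormal.2 (by decide), b.orthonormal.2 (by decide), fun f hf hc => ?_⟩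
  obtain ⟨M, R, hR, hM, h0⟩ := exists_bound_of_hasCompactSupport hf hc
  set F : ℝ × ℝ × ℝ → ℂ := fun p => f (p.1 • b 0 + p.2.1 • b 1 + p.2.2 • b 2) with hF
  have hFc : Continuous F := hf.comp (by fun_prop)
  have hF0 : ∀ p : ℝ × ℝ × ℝ, R ^ 2 < p.1 ^ 2 + p.2.1 ^ 2 + p.2.2 ^ 2 → F p = 0 := fun p hp => by
    refine h0 _ ?_
    have h := norm_sq_sum_smul b ![p.1, p.2.1, p.2.2]
    rw [Fin.sum_univ_three, Fin.sum_univ_three] at h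
    simp only [Matrix.cons_val] at h
    rw [← h] at hp
    exact lt_of_pow_lt_pow_left₀ 2 (norm_nonneg _) hp
  have hFle : ∀ p, ‖F p‖ ≤ M := fun p => hM _
  have hFint : Integrable F (volume.prod volume) := by
    rw [← integrableOn_univ]
    refine integrableOn_of_bounded_support (t := Set.Icc (-R) R ×ˢ Set.Icc (-R) R ×ˢ Set.Icc (-R) R)
      (M := M) hFc.aestronglyMeasurable
      (measurableSet_Icc.prod (measurableSet_Icc.prod measurableSet_Icc)) ?_ (fun p _ => hFle p) ?_
      MeasurableSet.univ
    · rw [Measure.prod_prod, Measure.volume_eq_prod, Measure.prod_prod]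
      exact ENNReal.mul_ne_top (by simp) (ENNReal.mul_ne_top (by simp) (by simp))
    · intro p _ hp
      apply hF0
      by_contra h
      push Not at h
      refine hp ⟨abs_le.1 (abs_le_of_sq_le_sq ?_ hR), abs_le.1 (abs_le_of_sq_le_sq ?_ hR),
        abs_le.1 (abs_le_of_sq_le_sq ?_ hR)⟩ <;>
      nlinarith [sq_nonneg p.1, sq_nonneg p.2.1, sq_nonneg p.2.2]
  have h1 : ∫ y, f y = ∫ x, ∫ q : ℝ × ℝ, F (x, q) := by
    have e1 := (volume_preserving_piFinSuccAbove (fun _ : Fin 3 => ℝ) 0)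
    have e2 : MeasurePreserving (fun p : ℝ × (Fin 2 → ℝ) => (p.1, MeasurableEquiv.finTwoArrow p.2))
        volume volume :=
      (MeasurePreserving.id volume).prod (volume_preserving_finTwoArrow ℝ)
    rw [integral_eq_integral_coord b f,
      show (fun x : Fin 3 → ℝ => f (∑ i, x i • b i)) = fun x =>
        (fun p : ℝ × (Fin 2 → ℝ) => F (p.1, MeasurableEquiv.finTwoArrow p.2))
          (MeasurableEquiv.piFinSuccAbove (fun _ : Fin 3 => ℝ) 0 x) by
        ext x; simp [hF, Fin.sum_univ_three, Fin.tail],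
      e1.integral_comp' (fun p : ℝ × (Fin 2 → ℝ) => F (p.1, MeasurableEquiv.finTwoArrow p.2))]
    rw [e2.integral_comp ((MeasurableEquiv.refl ℝ).prodCongr
      MeasurableEquiv.finTwoArrow).measurableEmbedding F, Measure.volume_eq_prod,
      integral_prod _ hFint]
  -- The half-plane integral is extended by zero to the whole plane, so that the planar polar
  -- formula can be applied a second time.
  set G : ℝ → ℝ × ℝ → ℂ := fun β p => (Set.Ioi (0 : ℝ)).indicator
    (fun q => q • F (p.1, q * Real.cos β, q * Real.sin β)) p.2 with hG
  have hsq : ∀ q β : ℝ, (q * Real.cos β) ^ 2 + (q * Real.sin β) ^ 2 = q ^ 2 := fun q β => by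
    linear_combination q ^ 2 * Real.cos_sq_add_sin_sq β
  have hGu : Measurable (fun t : (ℝ × ℝ) × ℝ => G t.2 t.1) := by
    have : (fun t : (ℝ × ℝ) × ℝ => G t.2 t.1) =
        Set.indicator {t : (ℝ × ℝ) × ℝ | 0 < t.1.2}
          (fun t => t.1.2 • F (t.1.1, t.1.2 * Real.cos t.2, t.1.2 * Real.sin t.2)) := by
      ext t; simp [hG, Set.indicator_apply]
    rw [this]
    refine Measurable.indicator ?_ (measurableSet_lt measurable_const (by fun_prop))
    have h1 : Continuous fun t : (ℝ × ℝ) × ℝ =>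
        (t.1.1, t.1.2 * Real.cos t.2, t.1.2 * Real.sin t.2) := by fun_prop
    have h2 : Continuous fun t : (ℝ × ℝ) × ℝ => t.1.2 := by fun_prop
    exact (h2.smul (hFc.comp h1)).measurable
  have hG0 : ∀ β (p : ℝ × ℝ), R ^ 2 < p.1 ^ 2 + p.2 ^ 2 → G β p = 0 := fun β p hp => by
    simp only [hG, Set.indicator_apply]
    split_ifs with h
    · rw [hF0, smul_zero]
      simp only
      rw [add_assoc, hsq]; exact hp
    · rfl
  have hM0 : 0 ≤ M := (norm_nonneg _).trans (hM 0)
  have hGle : ∀ β p, ‖G β p‖ ≤ R * M := fun β p => by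
    by_cases hp : R ^ 2 < p.1 ^ 2 + p.2 ^ 2
    · rw [hG0 β p hp, norm_zero]; positivity
    · simp only [hG, Set.indicator_apply]
      split_ifs with h
      · rw [norm_smul, Real.norm_of_nonneg (Set.mem_Ioi.1 h).le]
        refine mul_le_mul ?_ (hFle _) (norm_nonneg _) hR
        refine abs_le_of_sq_le_sq' ?_ hR |>.2
        nlinarith [sq_nonneg p.1]
      · rw [norm_zero]; positivity
  have h2 : ∀ x, ∫ q : ℝ × ℝ, F (x, q) = ∫ β in Set.Ioo (-Real.pi) Real.pi, ∫ q : ℝ, G β (x, q) := by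
    intro x
    rw [integral_polar (F := fun q => F (x, q)) (R := R)
      (hFc.comp (by fun_prop)).measurable (fun q => hFle _) hR
      (fun q hq => hF0 _ (by nlinarith [sq_nonneg x]))]
    refine setIntegral_congr_fun measurableSet_Ioo fun β _ => ?_
    rw [← integral_indicator measurableSet_Ioi]
  have h3 : ∫ x, (∫ β in Set.Ioo (-Real.pi) Real.pi, ∫ q : ℝ, G β (x, q)) =
      ∫ β in Set.Ioo (-Real.pi) Real.pi, ∫ p : ℝ × ℝ, G β p := by
    have hint : Integrable (fun t : (ℝ × ℝ) × ℝ => G t.1.2 (t.1.1, t.2))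
        ((volume.prod (volume.restrict (Set.Ioo (-Real.pi) Real.pi))).prod volume) := by
      rw [← integrableOn_univ]
      refine integrableOn_of_bounded_support (t := (Set.Icc (-R) R ×ˢ Set.univ) ×ˢ Set.Icc (-R) R)
        (M := R * M) (Measurable.aestronglyMeasurable ?_)
        ((measurableSet_Icc.prod MeasurableSet.univ).prod measurableSet_Icc) ?_
        (fun p _ => hGle _ _) ?_ MeasurableSet.univ
      · exact hGu.comp (by fun_prop : Measurable fun t : (ℝ × ℝ) × ℝ => ((t.1.1, t.2), t.1.2))
      · rw [Measure.prod_prod, Measure.prod_prod]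
        exact ENNReal.mul_ne_top (ENNReal.mul_ne_top (by simp) (by simp)) (by simp)
      · intro p _ hp
        apply hG0
        by_contra h
        push Not at h
        refine hp ⟨⟨abs_le.1 (abs_le_of_sq_le_sq ?_ hR), trivial⟩,
          abs_le.1 (abs_le_of_sq_le_sq ?_ hR)⟩ <;>
        nlinarith [sq_nonneg p.1.1, sq_nonneg p.2]
    have hsw := integral_integral_swap (f := fun x β => ∫ q : ℝ, G β (x, q)) hint.integral_prod_left
    rw [hsw]
    refine setIntegral_congr_fun measurableSet_Ioo fun β _ => ?_
    have hGβ : Integrable (G β) (volume.prod volume) := by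
      rw [← integrableOn_univ]
      refine integrableOn_of_bounded_support (t := Set.Icc (-R) R ×ˢ Set.Icc (-R) R)
        (M := R * M) (Measurable.aestronglyMeasurable ?_)
        (measurableSet_Icc.prod measurableSet_Icc) ?_
        (fun p _ => hGle _ _) ?_ MeasurableSet.univ
      · exact hGu.comp (by fun_prop : Measurable fun p : ℝ × ℝ => (p, β))
      · rw [Measure.prod_prod]
        exact ENNReal.mul_ne_top (by simp) (by simp)
      · intro p _ hp
        apply hG0
        by_contra h
        push Not at h
        refine hp ⟨abs_le.1 (abs_le_of_sq_le_sq ?_ hR), abs_le.1 (abs_le_of_sq_le_sq ?_ hR)⟩ <;>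
        nlinarith [sq_nonneg p.1, sq_nonneg p.2]
    rw [Measure.volume_eq_prod, integral_prod _ hGβ]
  rw [h1]
  simp_rw [h2]
  rw [h3]
  refine setIntegral_congr_fun measurableSet_Ioo fun β _ => ?_
  have hGβ : Measurable (G β) := hGu.comp (by fun_prop : Measurable fun p : ℝ × ℝ => (p, β))
  have hint := integrableOn_polar hGβ (hGle β) hR (hG0 β)
  rw [IntegrableOn, ← Measure.prod_restrict] at hint
  rw [integral_polar hGβ (hGle β) hR (hG0 β), setIntegral_Ioo_neg_pi hint.integral_prod_left]
  -- Negative angles correspond to a negative second coordinate, where `G` was set to zero.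
  have hz : ∫ α in Set.Ioo 0 Real.pi, ∫ s in Set.Ioi (0 : ℝ),
      s • G β (s * Real.cos (-α), s * Real.sin (-α)) = 0 := by
    refine setIntegral_eq_zero_of_forall_eq_zero fun α hα => ?_
    refine setIntegral_eq_zero_of_forall_eq_zero fun s hs => ?_
    have hsin := Real.sin_pos_of_pos_of_lt_pi hα.1 hα.2
    have : ¬ (0 < s * Real.sin (-α)) := by
      rw [Real.sin_neg]; have := mul_pos (Set.mem_Ioi.1 hs) hsin; nlinarith
    simp only [hG, Set.indicator_apply, Set.mem_Ioi, this, if_false, smul_zero]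
  rw [hz, add_zero]
  refine setIntegral_congr_fun measurableSet_Ioo fun α hα => ?_
  simp only
  rw [← integral_smul]
  refine setIntegral_congr_fun measurableSet_Ioi fun s hs => ?_
  have hsin := Real.sin_pos_of_pos_of_lt_pi hα.1 hα.2
  have hpos : 0 < s * Real.sin α := mul_pos hs hsin
  simp only [hG, hF, Set.indicator_apply, Set.mem_Ioi, hpos, if_true, axisVec, smul_add, smul_smul]
  rw [show s * (s * Real.sin α) = Real.sin α * s ^ 2 by ring, add_assoc, mul_assoc, mul_assoc]

end

noncomputable section

/-! ### The leading term -/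

variable {d : ℕ}

/-- The radial oscillatory integral `∫ W(sω) e^{iκλs} ds`. -/
def osc (κ R : ℝ) (W : TestFn d) (ω : EuclRd d) (t : ℝ) : ℂ :=
  ∫ s in (1 : ℝ)..R, W (s • ω) * cexp (I * (κ * t : ℝ) * s)

lemma continuous_osc (κ R : ℝ) (W : TestFn d) :
    Continuous fun p : EuclRd d × ℝ => osc κ R W p.1 p.2 := by
  refine intervalIntegral.continuous_parametric_intervalIntegral_of_continuous' ?_ _ _
  have h1 : Continuous fun q : (EuclRd d × ℝ) × ℝ => W (q.2 • q.1.1) :=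
    W.continuous.comp (by fun_prop)
  simp only [Function.uncurry_def]
  fun_prop

lemma hasDerivAt_testFn_ray (W : TestFn d) (ω : EuclRd d) (s : ℝ) :
    HasDerivAt (fun s : ℝ => W (s • ω)) ((∂_{ω} W) (s • ω)) s := by
  have hd : HasFDerivAt W (fderiv ℝ W (s • ω)) (s • ω) :=
    (W.contDiff.differentiable (by simp) _).hasFDerivAt
  have hl : HasDerivAt (fun t : ℝ => t • ω) ω s := by
    simpa using (hasDerivAt_id s).smul_const ω
  exact hd.comp_hasDerivAt s hl

lemma TestFn.exists_norm_le (W : TestFn d) : ∃ M, 0 ≤ M ∧ ∀ y, ‖W y‖ ≤ M := by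
  obtain ⟨M, hM⟩ := W.continuous.bounded_above_of_compact_support W.hasCompactSupport
  exact ⟨M, (norm_nonneg _).trans (hM 0), hM⟩

lemma lineDerivOp_apply_eq_sum (ω y : EuclRd d) (φ : TestFn d) :
    (∂_{ω} φ) y =
      ∑ i, ((ω i : ℝ) : ℂ) * (∂_{(EuclideanSpace.single i (1 : ℝ) : EuclRd d)} φ) y := by
  rw [lineDerivOp_eq_sum, TestFn.sum_apply]
  rfl

lemma lineDerivOp_two_apply_eq_sum (ω y : EuclRd d) (φ : TestFn d) :
    (∂_{ω} (∂_{ω} φ)) y = ∑ i, ∑ j, ((ω i : ℝ) : ℂ) * (((ω j : ℝ) : ℂ) *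
      (∂_{(EuclideanSpace.single j (1 : ℝ) : EuclRd d)}
        (∂_{(EuclideanSpace.single i (1 : ℝ) : EuclRd d)} φ)) y) := by
  rw [lineDerivOp_apply_eq_sum]
  refine Finset.sum_congr rfl fun i _ => ?_
  rw [lineDerivOp_comm, lineDerivOp_apply_eq_sum, Finset.mul_sum]

/-- Expansion of `ω` in coordinates makes the bound uniform over directions, as the domination of
the angular integrals requires. -/
lemma TestFn.exists_norm_lineDerivOp_two_le (W : TestFn d) :
    ∃ M, 0 ≤ M ∧ ∀ ω y : EuclRd d, ‖(∂_{ω} (∂_{ω} W)) y‖ ≤ M * ‖ω‖ ^ 2 := by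
  choose M hM0 hM using fun i j : Fin d =>
    TestFn.exists_norm_le (∂_{(EuclideanSpace.single j (1 : ℝ) : EuclRd d)}
      (∂_{(EuclideanSpace.single i (1 : ℝ) : EuclRd d)} W))
  refine ⟨∑ i, ∑ j, M i j, Finset.sum_nonneg fun i _ => Finset.sum_nonneg fun j _ => hM0 i j,
    fun ω y => ?_⟩
  have hc : ∀ i, ‖((ω i : ℝ) : ℂ)‖ ≤ ‖ω‖ := fun i => by
    rw [Complex.norm_real]; exact PiLp.norm_apply_le ω i
  rw [lineDerivOp_two_apply_eq_sum, Finset.sum_mul]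
  refine norm_sum_le_of_le _ fun i _ => ?_
  rw [Finset.sum_mul]
  refine norm_sum_le_of_le _ fun j _ => ?_
  rw [norm_mul, norm_mul]
  calc _ ≤ ‖ω‖ * (‖ω‖ * M i j) := by
        gcongr
        · exact hc i
        · exact hc j
        · exact hM i j y
    _ = _ := by ring

lemma lineDerivOp_eq_zero_of_notMem (W : TestFn d) (ω : EuclRd d) {y : EuclRd d}
    (hy : y ∉ tsupport W) : (∂_{ω} W) y = 0 := by
  rw [lineDerivOp_apply]
  have : y ∉ tsupport (fderiv ℝ W) := fun h => hy (tsupport_fderiv_subset ℝ h)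
  rw [image_eq_zero_of_notMem_tsupport this]
  rfl

/-- The trivial estimate controls small `t` and two integrations by parts along the ray control
large `t`. There are no boundary terms, because `W` vanishes near radii `1` and `R`. -/
lemma exists_norm_osc_le {κ R : ℝ} (hκ : 0 < κ) (hR : 1 ≤ R) (W : TestFn d)
    (hW : ∀ y ∈ tsupport W, 1 < ‖y‖ ∧ ‖y‖ < R) :
    ∃ C, 0 ≤ C ∧ ∀ ω : EuclRd d, ‖ω‖ = 1 → ∀ t : ℝ, 0 ≤ t →
      ‖osc κ R W ω t‖ ≤ C * (1 + t ^ 2)⁻¹ := by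
  obtain ⟨M, hM0, hM⟩ := TestFn.exists_norm_le W
  obtain ⟨M₂, hM₂0, hM₂⟩ := TestFn.exists_norm_lineDerivOp_two_le W
  have hR' : 0 ≤ R - 1 := sub_nonneg.2 hR
  refine ⟨M * (R - 1) + M₂ * (R - 1) / κ ^ 2, by positivity, fun ω hω t ht => ?_⟩
  rw [← div_eq_mul_inv, le_div_iff₀ (by positivity), mul_add, mul_one]
  have hn : ∀ s : ℝ, 0 ≤ s → ‖s • ω‖ = s := fun s hs => by
    rw [norm_smul, hω, mul_one, Real.norm_of_nonneg hs]
  have e1 : (1 : ℝ) • ω ∉ tsupport W := fun h => by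
    have := (hW _ h).1; rw [hn 1 zero_le_one] at this; exact lt_irrefl _ this
  have e2 : R • ω ∉ tsupport W := fun h => by
    have := (hW _ h).2; rw [hn R (by linarith)] at this; exact lt_irrefl _ this
  refine add_le_add ?_ ?_
  · calc _ ≤ M * |R - 1| := by
          refine intervalIntegral.norm_integral_le_of_norm_le_const fun s _ => ?_
          have : ‖cexp (I * (κ * t : ℝ) * s)‖ = 1 := by
            rw [show (I * (κ * t : ℝ) * s : ℂ) = ((κ * t * s : ℝ) : ℂ) * I by push_cast; ring]
            exact Complex.norm_exp_ofReal_mul_I _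
          rw [norm_mul, this, mul_one]
          exact hM _
      _ = _ := by rw [abs_of_nonneg hR']
  · rcases ht.eq_or_lt with rfl | ht
    · simp only [ne_eq, OfNat.ofNat_ne_zero, not_false_eq_true, zero_pow, mul_zero]; positivity
    have hμ : κ * t ≠ 0 := by positivity
    have hc2 : Continuous fun s : ℝ => (∂_{ω} (∂_{ω} W)) (s • ω) :=
      (∂_{ω} (∂_{ω} W)).continuous.comp (by fun_prop)
    have := norm_integral_mul_exp_le (hasDerivAt_testFn_ray W ω)
      (hasDerivAt_testFn_ray (∂_{ω} W) ω) hc2 hR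
      (image_eq_zero_of_notMem_tsupport e1) (image_eq_zero_of_notMem_tsupport e2)
      (lineDerivOp_eq_zero_of_notMem W ω e1) (lineDerivOp_eq_zero_of_notMem W ω e2)
      (M := M₂) (fun s => by simpa [hω] using hM₂ ω (s • ω)) hμ
    rw [osc]
    calc _ ≤ M₂ * (R - 1) / (κ * t) ^ 2 * t ^ 2 := by gcongr
      _ = _ := by field_simp

/-- The integral over angles from the axis, rescaled. -/
lemma angular_rescale {k : ℕ} (Φ : ℝ → ℂ) {r : ℝ} (hr : 0 < r) :
    (r : ℂ) ^ (k + 1) * ∫ α in Set.Ioo 0 Real.pi, (Real.sin α : ℂ) ^ k * Φ α =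
    ∫ β in Set.Ioi (0 : ℝ), (Set.Iio (Real.pi * r)).indicator
      (fun β => ((r * Real.sin (r⁻¹ * β) : ℝ) : ℂ) ^ k * Φ (r⁻¹ * β)) β := by
  set G : ℝ → ℂ := (Set.Iio Real.pi).indicator (fun α => (Real.sin α : ℂ) ^ k * Φ α) with hG
  have h1 : ∫ α in Set.Ioo 0 Real.pi, (Real.sin α : ℂ) ^ k * Φ α = ∫ α in Set.Ioi (0 : ℝ), G α := by
    rw [hG, setIntegral_indicator measurableSet_Iio]
    rfl
  have h2 := integral_comp_mul_left_Ioi G 0 (inv_pos.2 hr)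
  rw [inv_inv, mul_zero] at h2
  rw [h1]
  have h3 : (r : ℂ) ^ (k + 1) * ∫ α in Set.Ioi (0 : ℝ), G α =
      (r : ℂ) ^ k * (r • ∫ α in Set.Ioi (0 : ℝ), G α) := by
    rw [Complex.real_smul]; ring
  rw [h3, ← h2, ← integral_const_mul]
  refine setIntegral_congr_fun measurableSet_Ioi fun β _ => ?_
  have : r⁻¹ * β < Real.pi ↔ β < Real.pi * r := by
    rw [inv_mul_lt_iff₀ hr, mul_comm]
  simp only [hG, Set.indicator_apply, Set.mem_Iio, this]
  split_ifs
  · push_cast; ring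
  · simp

section Angular

variable {k : ℕ} {κ R : ℝ} {W : TestFn d} {h : EuclRd d → ℂ} {C H : ℝ}

/-- The contribution of one half great circle to the leading term. -/
def circleTerm (k : ℕ) (κ R : ℝ) (W : TestFn d) (h : EuclRd d → ℂ) (θ e : EuclRd d) (r : ℝ) : ℂ :=
  (r : ℂ) ^ (k + 1) * ∫ α in Set.Ioo 0 Real.pi, (Real.sin α : ℂ) ^ k *
    (h (axisVec θ e α) * osc κ R W (axisVec θ e α) (r ^ 2 * (1 - Real.cos α)))

/-- With `α = β/r`, the inequality `1 - cos α ≥ 2α²/π²` on `[0, π]` bounds the rescaled phase below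
by `2β²/π²`, and `sin α ≤ α` bounds the density. Hence the majorant does not depend on `r`. -/
lemma angular_integrand_bound (hC0 : 0 ≤ C) (hC : ∀ ω : EuclRd d, ‖ω‖ = 1 → ∀ t : ℝ, 0 ≤ t →
      ‖osc κ R W ω t‖ ≤ C * (1 + t ^ 2)⁻¹)
    (hH0 : 0 ≤ H) (hH : ∀ ω, ‖ω‖ = 1 → ‖h ω‖ ≤ H) {θ e : EuclRd d} (hθ : ‖θ‖ = 1) (he : ‖e‖ = 1)
    (hθe : inner ℝ θ e = 0) {r : ℝ} (hr : 0 < r) {β : ℝ} (hβ : 0 < β) :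
    ‖(Set.Iio (Real.pi * r)).indicator
      (fun β => ((r * Real.sin (r⁻¹ * β) : ℝ) : ℂ) ^ k * (h (axisVec θ e (r⁻¹ * β)) *
        osc κ R W (axisVec θ e (r⁻¹ * β)) (r ^ 2 * (1 - Real.cos (r⁻¹ * β))))) β‖ ≤
    H * C * (|β| ^ k * (1 + 4 / Real.pi ^ 4 * β ^ 4)⁻¹) := by
  rw [Set.indicator_apply]
  split_ifs with hlt
  · have hα : 0 < r⁻¹ * β := by positivity
    have hαpi : r⁻¹ * β < Real.pi := by rw [inv_mul_lt_iff₀ hr, mul_comm]; exact hlt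
    have hω := norm_axisVec hθ he hθe (r⁻¹ * β)
    have hcos : 2 / Real.pi ^ 2 * β ^ 2 ≤ r ^ 2 * (1 - Real.cos (r⁻¹ * β)) := by
      have := Real.cos_le_one_sub_mul_cos_sq (x := r⁻¹ * β) (by
        rw [abs_of_pos hα]; exact hαpi.le)
      calc 2 / Real.pi ^ 2 * β ^ 2 = r ^ 2 * (2 / Real.pi ^ 2 * (r⁻¹ * β) ^ 2) := by field_simp
        _ ≤ _ := by gcongr; linarith
    have h0 : 0 ≤ 2 / Real.pi ^ 2 * β ^ 2 := by positivity
    have hosc : ‖osc κ R W (axisVec θ e (r⁻¹ * β)) (r ^ 2 * (1 - Real.cos (r⁻¹ * β)))‖ ≤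
        C * (1 + 4 / Real.pi ^ 4 * β ^ 4)⁻¹ := by
      refine (hC _ hω _ (h0.trans hcos)).trans ?_
      gcongr
      calc 4 / Real.pi ^ 4 * β ^ 4 = (2 / Real.pi ^ 2 * β ^ 2) ^ 2 := by ring
        _ ≤ _ := by gcongr
    have hsin0 : 0 ≤ Real.sin (r⁻¹ * β) := (Real.sin_pos_of_pos_of_lt_pi hα hαpi).le
    have hsin : ‖((r * Real.sin (r⁻¹ * β) : ℝ) : ℂ)‖ ≤ |β| := by
      rw [Complex.norm_real, Real.norm_of_nonneg (by positivity), abs_of_pos hβ]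
      calc _ ≤ r * (r⁻¹ * β) := by gcongr; exact Real.sin_le hα.le
        _ = β := by field_simp
    rw [norm_mul, norm_mul, norm_pow]
    calc _ ≤ |β| ^ k * (H * (C * (1 + 4 / Real.pi ^ 4 * β ^ 4)⁻¹)) := by
          gcongr
          exact hH _ hω
      _ = _ := by ring
  · rw [norm_zero]
    positivity

lemma norm_circleTerm_le (hk : k = 0 ∨ k = 1)
    (hC0 : 0 ≤ C) (hC : ∀ ω : EuclRd d, ‖ω‖ = 1 → ∀ t : ℝ, 0 ≤ t →
      ‖osc κ R W ω t‖ ≤ C * (1 + t ^ 2)⁻¹)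
    (hH0 : 0 ≤ H) (hH : ∀ ω, ‖ω‖ = 1 → ‖h ω‖ ≤ H) {θ e : EuclRd d} (hθ : ‖θ‖ = 1) (he : ‖e‖ = 1)
    (hθe : inner ℝ θ e = 0) {r : ℝ} (hr : 0 < r) :
    ‖circleTerm k κ R W h θ e r‖ ≤
      ∫ β in Set.Ioi (0 : ℝ), H * C * (|β| ^ k * (1 + 4 / Real.pi ^ 4 * β ^ 4)⁻¹) := by
  rw [circleTerm, angular_rescale (fun α => h (axisVec θ e α) *
    osc κ R W (axisVec θ e α) (r ^ 2 * (1 - Real.cos α))) hr]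
  refine norm_integral_le_of_norm_le ?_ ?_
  · exact ((integrable_pow_mul_inv hk (by positivity)).const_mul _).integrableOn
  · exact (ae_restrict_iff' measurableSet_Ioi).2 (ae_of_all _ fun β hβ =>
      angular_integrand_bound hC0 hC hH0 hH hθ he hθe hr hβ)

lemma continuous_axisVec : Continuous fun p : (EuclRd d × EuclRd d) × ℝ =>
    axisVec p.1.1 p.1.2 p.2 := by
  unfold axisVec; fun_prop

lemma continuous_comp_axisVec (hh : ContinuousOn h {0}ᶜ) {θ e : EuclRd d} (hθ : ‖θ‖ = 1)
    (he : ‖e‖ = 1) (hθe : inner ℝ θ e = 0) : Continuous fun α => h (axisVec θ e α) := by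
  refine hh.comp_continuous (continuous_axisVec.comp (f := fun α => ((θ, e), α)) (by fun_prop))
    fun α => ?_
  rw [Set.mem_compl_singleton_iff, ← norm_ne_zero_iff, norm_axisVec hθ he hθe]
  exact one_ne_zero

/-- In the variable `β = rα` the amplitude concentrates at the axis, `r sin(β/r) → β` and `r²(1 -
cos(β/r)) → β²/2`. Stationary phase is then dominated convergence, with no expansion of the
amplitude. -/
lemma tendsto_circleTerm (hk : k = 0 ∨ k = 1)
    (hC0 : 0 ≤ C) (hC : ∀ ω : EuclRd d, ‖ω‖ = 1 → ∀ t : ℝ, 0 ≤ t →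
      ‖osc κ R W ω t‖ ≤ C * (1 + t ^ 2)⁻¹)
    (hH0 : 0 ≤ H) (hH : ∀ ω, ‖ω‖ = 1 → ‖h ω‖ ≤ H) (hh : ContinuousOn h {0}ᶜ)
    {θ e : EuclRd d} (hθ : ‖θ‖ = 1) (he : ‖e‖ = 1) (hθe : inner ℝ θ e = 0) :
    Tendsto (circleTerm k κ R W h θ e) atTop
      (𝓝 (∫ β in Set.Ioi (0 : ℝ), (β : ℂ) ^ k * (h θ * osc κ R W θ (β ^ 2 / 2)))) := by
  have hhc := continuous_comp_axisVec hh hθ he hθe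
  have hωc : Continuous (axisVec θ e) :=
    continuous_axisVec.comp (f := fun α => ((θ, e), α)) (by fun_prop)
  have hev : ∀ᶠ r : ℝ in atTop, 0 < r := eventually_gt_atTop 0
  refine Tendsto.congr' (f₁ := fun r => ∫ β in Set.Ioi (0 : ℝ), (Set.Iio (Real.pi * r)).indicator
      (fun β => ((r * Real.sin (r⁻¹ * β) : ℝ) : ℂ) ^ k * (h (axisVec θ e (r⁻¹ * β)) *
        osc κ R W (axisVec θ e (r⁻¹ * β)) (r ^ 2 * (1 - Real.cos (r⁻¹ * β))))) β) ?_ ?_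
  · filter_upwards [hev] with r hr
    rw [circleTerm, angular_rescale (fun α => h (axisVec θ e α) *
      osc κ R W (axisVec θ e α) (r ^ 2 * (1 - Real.cos α))) hr]
  refine tendsto_integral_filter_of_dominated_convergence
    (fun β => H * C * (|β| ^ k * (1 + 4 / Real.pi ^ 4 * β ^ 4)⁻¹)) ?_ ?_ ?_ ?_
  · refine Eventually.of_forall fun r => AEStronglyMeasurable.indicator ?_ measurableSet_Iio
    refine Continuous.aestronglyMeasurable ?_
    have h1 : Continuous fun β : ℝ => h (axisVec θ e (r⁻¹ * β)) := hhc.comp (by fun_prop)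
    have h4 : Continuous fun β : ℝ => axisVec θ e (r⁻¹ * β) := hωc.comp (by fun_prop)
    have h5 : Continuous fun β : ℝ => r ^ 2 * (1 - Real.cos (r⁻¹ * β)) := by fun_prop
    have h2 : Continuous fun β : ℝ => osc κ R W (axisVec θ e (r⁻¹ * β))
        (r ^ 2 * (1 - Real.cos (r⁻¹ * β))) :=
      Continuous.comp (g := fun p : EuclRd d × ℝ => osc κ R W p.1 p.2)
        (f := fun β : ℝ => (axisVec θ e (r⁻¹ * β), r ^ 2 * (1 - Real.cos (r⁻¹ * β))))
        (continuous_osc κ R W) (h4.prodMk h5)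
    have h3 : Continuous fun β : ℝ => ((r * Real.sin (r⁻¹ * β) : ℝ) : ℂ) ^ k := by fun_prop
    exact h3.mul (h1.mul h2)
  · filter_upwards [hev] with r hr
    exact (ae_restrict_iff' measurableSet_Ioi).2 (ae_of_all _ fun β hβ =>
      angular_integrand_bound hC0 hC hH0 hH hθ he hθe hr hβ)
  · exact ((integrable_pow_mul_inv hk (by positivity)).const_mul _).integrableOn
  · refine (ae_restrict_iff' measurableSet_Ioi).2 (ae_of_all _ fun β hβ => ?_)
    have hβ' : 0 < β := hβ
    have hα : Tendsto (fun r : ℝ => r⁻¹ * β) atTop (𝓝 0) := by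
      simpa using tendsto_inv_atTop_zero.mul_const β
    have h0 : axisVec θ e 0 = θ := by simp [axisVec]
    have hω : Tendsto (fun r : ℝ => axisVec θ e (r⁻¹ * β)) atTop (𝓝 θ) := by
      have := (hωc.tendsto 0).comp hα
      rwa [h0] at this
    have hhlim : Tendsto (fun r : ℝ => h (axisVec θ e (r⁻¹ * β))) atTop (𝓝 (h θ)) := by
      have := (hhc.tendsto 0).comp hα
      rwa [h0] at this
    have hαne : Tendsto (fun r : ℝ => r⁻¹ * β) atTop (𝓝[≠] 0) := by
      refine tendsto_nhdsWithin_iff.2 ⟨hα, ?_⟩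
      filter_upwards [hev] with r hr
      have : r⁻¹ * β ≠ 0 := by positivity
      exact this
    have hsin1 : Tendsto (fun r : ℝ => r * Real.sin (r⁻¹ * β)) atTop (𝓝 β) := by
      have hd := (Real.hasDerivAt_sin 0).tendsto_slope
      simp only [Real.cos_zero] at hd
      have := (hd.comp hαne).const_mul β
      rw [mul_one] at this
      refine this.congr' ?_
      filter_upwards [hev] with r hr
      simp only [Function.comp_apply, slope_def_field, Real.sin_zero, sub_zero]
      field_simp
    -- The identity `1 - cos x = 2 sin²(x/2)` reduces this to the slope of the sine at zero.
    have hcos1 : Tendsto (fun r : ℝ => r ^ 2 * (1 - Real.cos (r⁻¹ * β))) atTop (𝓝 (β ^ 2 / 2)) := by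
      have hhalf : Tendsto (fun r : ℝ => r * Real.sin (r⁻¹ * (β / 2))) atTop (𝓝 (β / 2)) := by
        have hα' : Tendsto (fun r : ℝ => r⁻¹ * (β / 2)) atTop (𝓝[≠] 0) := by
          refine tendsto_nhdsWithin_iff.2 ⟨by
            simpa using tendsto_inv_atTop_zero.mul_const (β / 2), ?_⟩
          filter_upwards [hev] with r hr
          have : r⁻¹ * (β / 2) ≠ 0 := by positivity
          exact this
        have hd := (Real.hasDerivAt_sin 0).tendsto_slope
        simp only [Real.cos_zero] at hd
        have := (hd.comp hα').const_mul (β / 2)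
        rw [mul_one] at this
        refine this.congr' ?_
        filter_upwards [hev] with r hr
        simp only [Function.comp_apply, slope_def_field, Real.sin_zero, sub_zero]
        field_simp
      have := (hhalf.pow 2).const_mul 2
      rw [show 2 * (β / 2) ^ 2 = β ^ 2 / 2 by ring] at this
      refine this.congr fun r => ?_
      have := Real.cos_two_mul_eq_one_sub (r⁻¹ * (β / 2))
      rw [show 2 * (r⁻¹ * (β / 2)) = r⁻¹ * β by ring] at this
      rw [this]; ring
    have hosc := ((continuous_osc κ R W).tendsto (θ, β ^ 2 / 2)).comp (hω.prodMk_nhds hcos1)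
    have hsin2 : Tendsto (fun r : ℝ => ((r * Real.sin (r⁻¹ * β) : ℝ) : ℂ) ^ k) atTop
        (𝓝 ((β : ℂ) ^ k)) := ((Complex.continuous_ofReal.tendsto β).comp hsin1).pow k
    refine (hsin2.mul (hhlim.mul hosc)).congr' ?_
    filter_upwards [hev, eventually_gt_atTop (β / Real.pi)] with r hr hr2
    rw [Set.indicator_of_mem]
    · rfl
    · rw [Set.mem_Iio]
      rwa [div_lt_iff₀ Real.pi_pos, mul_comm] at hr2

end Angular

end

/-! ### Stationary phase along a ray in dimensions two and three. -/

noncomputable section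

variable {d : ℕ}

lemma continuous_mul_testFn {g : EuclRd d → ℂ} (hg : ContinuousOn g {0}ᶜ) (w : TestFn d)
    (hw : (0 : EuclRd d) ∉ tsupport w) : Continuous fun y => g y * w y := by
  rw [continuous_iff_continuousAt]
  intro y
  by_cases hy : y = 0
  · have hev : ∀ᶠ z in 𝓝 y, z ∉ tsupport w := by
      rw [hy]; exact (isClosed_tsupport w).isOpen_compl.mem_nhds hw
    have : (fun y => g y * w y) =ᶠ[𝓝 y] fun _ => 0 := by
      filter_upwards [hev] with z hz
      rw [image_eq_zero_of_notMem_tsupport hz, mul_zero]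
    exact this.continuousAt
  · exact (hg.continuousAt (isOpen_compl_singleton.mem_nhds hy)).mul w.continuous.continuousAt

/-- The test function `|y|^p w(y)`, for `w` vanishing near the origin. -/
def radialMul (p : ℝ) (w : TestFn d) (hw : (0 : EuclRd d) ∉ tsupport w) : TestFn d :=
  mkTest (fun y => ((‖y‖ ^ p : ℝ) : ℂ) * w y) (by
    rw [contDiff_iff_contDiffAt]
    intro y
    by_cases hy : y = 0
    · have hev : ∀ᶠ z in 𝓝 y, z ∉ tsupport w := by
        rw [hy]; exact (isClosed_tsupport w).isOpen_compl.mem_nhds hw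
      have : (fun y => ((‖y‖ ^ p : ℝ) : ℂ) * w y) =ᶠ[𝓝 y] fun _ => 0 := by
        filter_upwards [hev] with z hz
        rw [image_eq_zero_of_notMem_tsupport hz, mul_zero]
      exact contDiffAt_const.congr_of_eventuallyEq this
    · have h1 : ContDiffAt ℝ (⊤ : ℕ∞) (fun y : EuclRd d => ‖y‖ ^ p) y :=
        (contDiffAt_id.norm ℝ hy).rpow_const_of_ne (norm_ne_zero_iff.2 hy)
      have h2 : ContDiffAt ℝ (⊤ : ℕ∞) (fun y : EuclRd d => ((‖y‖ ^ p : ℝ) : ℂ)) y :=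
        ofRealCLM.contDiff.contDiffAt.comp y h1
      exact h2.mul w.contDiff.contDiffAt) w.hasCompactSupport.mul_left

@[simp] lemma radialMul_apply (p : ℝ) (w : TestFn d) (hw : (0 : EuclRd d) ∉ tsupport w)
    (y : EuclRd d) : radialMul p w hw y = ((‖y‖ ^ p : ℝ) : ℂ) * w y := rfl

lemma tsupport_radialMul_subset (p : ℝ) (w : TestFn d) (hw : (0 : EuclRd d) ∉ tsupport w) :
    tsupport (radialMul p w hw) ⊆ tsupport w :=
  tsupport_mul_subset_right (f := fun y : EuclRd d => ((‖y‖ ^ p : ℝ) : ℂ))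

/-- The constant of the Fresnel integral. -/
def fresnelConst (d : ℕ) : ℂ :=
  if d = 2 then cexp (I * Real.pi / 4) * (Real.sqrt (2 * Real.pi) : ℂ) / 2 else I

/-- The Gaussian moment is homogeneous of degree `-(d-1)/2` in `s`, so the radial weight cancels and
the leading term becomes an unweighted integral of `w` along the ray. -/
lemma halfGauss_neg_I_mul (hd : d = 2 ∨ d = 3) {κ s : ℝ} (hκ : 0 < κ) (hs : 0 < s) :
    ((s ^ (((d : ℝ) - 1) / 2) : ℝ) : ℂ) * halfGauss (d - 2) (-(I * κ * s / 2)) =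
      fresnelConst d * ((κ ^ (-(((d : ℝ) - 1) / 2)) : ℝ) : ℂ) := by
  have hI := Complex.I_mul_I
  have hκ' : (κ : ℂ) ≠ 0 := by exact_mod_cast hκ.ne'
  have hs' : (s : ℂ) ≠ 0 := by exact_mod_cast hs.ne'
  rcases hd with rfl | rfl
  · have e1 : (Real.pi : ℂ) / (-(I * κ * s / 2)) = ((2 * Real.pi / (κ * s) : ℝ) : ℂ) * I := by
      push_cast
      field_simp
      linear_combination -hI
    have e2 : ((2 : ℕ) : ℝ) - 1 = 1 := by norm_num
    have e3 : I ^ (1 / 2 : ℂ) = cexp (I * Real.pi / 4) := by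
      rw [Complex.cpow_def_of_ne_zero I_ne_zero, Complex.log_I]
      congr 1; ring
    have e4 : (((2 * Real.pi / (κ * s) : ℝ) : ℂ)) ^ (1 / 2 : ℂ) =
        ((Real.sqrt (2 * Real.pi) * κ ^ (-(1 / 2) : ℝ) * s ^ (-(1 / 2) : ℝ) : ℝ) : ℂ) := by
      rw [show (1 / 2 : ℂ) = ((1 / 2 : ℝ) : ℂ) by push_cast; rfl,
        ← Complex.ofReal_cpow (by positivity)]
      congr 1
      rw [Real.div_rpow (by positivity) (by positivity), Real.mul_rpow hκ.le hs.le,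
        Real.rpow_neg hκ.le, Real.rpow_neg hs.le, ← Real.sqrt_eq_rpow (2 * Real.pi)]
      field_simp
    have e5 : (s ^ (1 / 2 : ℝ)) * s ^ (-(1 / 2) : ℝ) = 1 := by
      rw [← Real.rpow_add hs]; norm_num
    rw [e2]
    simp only [halfGauss, fresnelConst, if_true, Nat.sub_self]
    have e6 : (((2 * Real.pi / (κ * s) : ℝ) : ℂ) * I) ^ (1 / 2 : ℂ) =
        (((2 * Real.pi / (κ * s) : ℝ) : ℂ)) ^ (1 / 2 : ℂ) * I ^ (1 / 2 : ℂ) := by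
      have hx : 0 < 2 * Real.pi / (κ * s) := by positivity
      have hx' : ((2 * Real.pi / (κ * s) : ℝ) : ℂ) ≠ 0 := by exact_mod_cast hx.ne'
      rw [Complex.cpow_def_of_ne_zero (mul_ne_zero hx' I_ne_zero),
        Complex.log_ofReal_mul hx I_ne_zero, Complex.cpow_def_of_ne_zero hx',
        Complex.cpow_def_of_ne_zero I_ne_zero, ← Complex.exp_add, Complex.ofReal_log hx.le]
      congr 1; ring
    have e5' : ((s ^ (1 / 2 : ℝ) : ℝ) : ℂ) * ((s ^ (-(1 / 2) : ℝ) : ℝ) : ℂ) = 1 := by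
      exact_mod_cast e5
    rw [e1, e6, e4, e3]
    push_cast
    linear_combination (cexp (I * Real.pi / 4) * ((Real.sqrt (2 * Real.pi) : ℝ) : ℂ) / 2 *
      ((κ ^ (-(1 / 2) : ℝ) : ℝ) : ℂ)) * e5'
  · have e2 : (((3 : ℕ) : ℝ) - 1) / 2 = 1 := by norm_num
    rw [e2, Real.rpow_one, Real.rpow_neg_one]
    simp only [halfGauss, fresnelConst]
    norm_num
    field_simp

lemma ray_integral_eq_osc (κ R : ℝ) (hR : 1 ≤ R) (W : TestFn d)
    (hW : ∀ y ∈ tsupport W, 1 < ‖y‖ ∧ ‖y‖ < R) {ω : EuclRd d} (hω : ‖ω‖ = 1) (t : ℝ) :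
    ∫ s in Set.Ioi (0 : ℝ), W (s • ω) * cexp (I * (κ * t : ℝ) * s) = osc κ R W ω t := by
  rw [osc, intervalIntegral.integral_of_le hR]
  refine (setIntegral_eq_of_subset_of_forall_sdiff_eq_zero measurableSet_Ioi
    (fun s hs => zero_lt_one.trans hs.1) fun s hs => ?_)
  have : W (s • ω) = 0 := by
    refine image_eq_zero_of_notMem_tsupport fun h => hs.2 ?_
    have := hW _ h
    rw [norm_smul, hω, mul_one, Real.norm_of_nonneg (Set.mem_Ioi.1 hs.1).le] at this
    exact ⟨this.1, this.2.le⟩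
  rw [this, zero_mul]

/-- The leading term of an oscillatory integral with the phase `|y| - y·θ`. -/
theorem tendsto_leadingTerm (hd : d = 2 ∨ d = 3) {κ R : ℝ} (hκ : 0 < κ) (hR : 1 ≤ R)
    {θ : EuclRd d} (hθ : ‖θ‖ = 1) {h : EuclRd d → ℂ} (hh : ContinuousOn h {0}ᶜ)
    (hhom : ∀ (s : ℝ) (y : EuclRd d), 0 < s → h (s • y) = h y) (w : TestFn d)
    (hw : ∀ y ∈ tsupport w, 1 < ‖y‖ ∧ ‖y‖ < R) :
    Tendsto (fun r : ℝ => (r : ℂ) ^ (d - 1) * ∫ y, h y * ((‖y‖ ^ (-(((d : ℝ) - 1) / 2)) : ℝ) : ℂ) *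
        cexp (I * (κ * (r ^ 2 * (‖y‖ - inner ℝ y θ)) : ℝ)) * w y) atTop
      (𝓝 (equatorMass d * (fresnelConst d * ((κ ^ (-(((d : ℝ) - 1) / 2)) : ℝ) : ℂ) * h θ *
        ∫ s in (1 : ℝ)..R, w (s • θ)))) := by
  have hw0 : (0 : EuclRd d) ∉ tsupport w := fun h0 => by
    have := (hw _ h0).1; rw [norm_zero] at this; linarith
  -- The Jacobian `s^{d-1}` times the amplitude `s^{-(d-1)/2}` leaves `s^{(d-1)/2}`, which is
  -- absorbed into the test function.
  set W := radialMul (((d : ℝ) - 1) / 2) w hw0 with hWdef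
  have hW : ∀ y ∈ tsupport W, 1 < ‖y‖ ∧ ‖y‖ < R := fun y hy =>
    hw y (tsupport_radialMul_subset _ _ _ hy)
  obtain ⟨C, hC0, hC⟩ := exists_norm_osc_le hκ hR W hW
  obtain ⟨H, hH⟩ := (isCompact_sphere (0 : EuclRd d) 1).exists_bound_of_continuousOn
    (hh.mono fun y hy => by
      rw [mem_sphere_zero_iff_norm] at hy
      rw [Set.mem_compl_singleton_iff, ← norm_ne_zero_iff, hy]; exact one_ne_zero)
  have hH' : ∀ ω : EuclRd d, ‖ω‖ = 1 → ‖h ω‖ ≤ H := fun ω hω =>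
    hH ω (mem_sphere_zero_iff_norm.2 hω)
  have hH0 : 0 ≤ H := (norm_nonneg _).trans (hH' θ hθ)
  set f : ℝ → EuclRd d → ℂ := fun r y => h y * ((‖y‖ ^ (-(((d : ℝ) - 1) / 2)) : ℝ) : ℂ) *
    cexp (I * (κ * (r ^ 2 * (‖y‖ - inner ℝ y θ)) : ℝ)) * w y with hf
  have hfc : ∀ r, Continuous (f r) := fun r => by
    refine continuous_mul_testFn ?_ w hw0
    refine (hh.mul ?_).mul ?_
    · refine Complex.continuous_ofReal.comp_continuousOn ?_
      exact continuousOn_id.norm.rpow_const fun y hy => Or.inl (norm_ne_zero_iff.2 hy)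
    · exact Continuous.continuousOn (by fun_prop)
  have hfs : ∀ r, HasCompactSupport (f r) := fun r => w.hasCompactSupport.mul_left
  have hfω : ∀ (r : ℝ) (e : EuclRd d), ‖e‖ = 1 → inner ℝ θ e = 0 → ∀ α : ℝ,
      ∫ s in Set.Ioi (0 : ℝ), s ^ (d - 1) • f r (s • axisVec θ e α) =
      h (axisVec θ e α) * osc κ R W (axisVec θ e α) (r ^ 2 * (1 - Real.cos α)) := by
    intro r e he hθe α
    have hω := norm_axisVec hθ he hθe α
    rw [← ray_integral_eq_osc κ R hR W hW hω, ← integral_const_mul]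
    refine setIntegral_congr_fun measurableSet_Ioi fun s hs => ?_
    have hs' : 0 < s := hs
    have hns : ‖s • axisVec θ e α‖ = s := by
      rw [norm_smul, hω, mul_one, Real.norm_of_nonneg hs'.le]
    simp only [hf, hWdef, radialMul_apply, hns, hhom s _ hs', inner_smul_left,
      inner_axisVec hθ hθe, Complex.real_smul]
    have hp : (((s ^ (d - 1) : ℝ)) : ℂ) * ((s ^ (-(((d : ℝ) - 1) / 2)) : ℝ) : ℂ) =
        ((s ^ (((d : ℝ) - 1) / 2) : ℝ) : ℂ) := by
      rw [← Complex.ofReal_mul]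
      congr 1
      rw [← Real.rpow_natCast, ← Real.rpow_add hs']
      congr 1
      rw [Nat.cast_sub (by omega)]
      push_cast; ring
    have he1 : cexp (I * (κ * (r ^ 2 * (s - (starRingEnd ℝ) s * Real.cos α)) : ℝ)) =
        cexp (I * (κ * (r ^ 2 * (1 - Real.cos α)) : ℝ) * s) := by
      congr 1
      simp only [conj_trivial]
      push_cast; ring
    rw [he1]
    linear_combination (h (axisVec θ e α) * w (s • axisVec θ e α) *
      cexp (I * (κ * (r ^ 2 * (1 - Real.cos α)) : ℝ) * s)) * hp
  have hk : d - 2 = 0 ∨ d - 2 = 1 := by omega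
  have hlim : ∫ β in Set.Ioi (0 : ℝ), (β : ℂ) ^ (d - 2) * (h θ * osc κ R W θ (β ^ 2 / 2)) =
      fresnelConst d * ((κ ^ (-(((d : ℝ) - 1) / 2)) : ℝ) : ℂ) * h θ *
        ∫ s in (1 : ℝ)..R, w (s • θ) := by
    have hq : Continuous fun s : ℝ => W (s • θ) := W.continuous.comp (by fun_prop)
    have h1 := integral_pow_mul_osc hk hq hκ hR (hC θ hθ)
    have h2 : ∀ β : ℝ, (β : ℂ) ^ (d - 2) * (h θ * osc κ R W θ (β ^ 2 / 2)) =
        h θ * ((β : ℂ) ^ (d - 2) *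
          ∫ s in (1 : ℝ)..R, W (s • θ) * cexp (I * (κ * (β ^ 2 / 2) : ℝ) * s)) := fun β => by
      rw [osc]; ring
    simp_rw [h2]
    rw [integral_const_mul, h1, ← intervalIntegral.integral_const_mul,
      ← intervalIntegral.integral_const_mul]
    refine intervalIntegral.integral_congr fun s hs => ?_
    rw [Set.uIcc_of_le hR] at hs
    have hs' : 0 < s := lt_of_lt_of_le one_pos hs.1
    have hns : ‖s • θ‖ = s := by
      rw [norm_smul, hθ, mul_one, Real.norm_of_nonneg hs'.le]
    simp only [hWdef, radialMul_apply, hns]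
    have := halfGauss_neg_I_mul hd hκ hs'
    linear_combination (h θ * w (s • θ)) * this
  rw [← hlim]
  have hct : ∀ e : EuclRd d, ‖e‖ = 1 → inner ℝ θ e = 0 →
      Tendsto (circleTerm (d - 2) κ R W h θ e) atTop
      (𝓝 (∫ β in Set.Ioi (0 : ℝ), (β : ℂ) ^ (d - 2) * (h θ * osc κ R W θ (β ^ 2 / 2)))) :=
    fun e he hθe => tendsto_circleTerm hk hC0 hC hH0 hH' hh hθ he hθe
  set L := ∫ β in Set.Ioi (0 : ℝ), (β : ℂ) ^ (d - 2) * (h θ * osc κ R W θ (β ^ 2 / 2)) with hL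
  rcases hd with rfl | rfl
  · obtain ⟨e, he, hθe, hpol⟩ := integral_spherical_two θ hθ
    have he' : ‖-e‖ = 1 := by rwa [norm_neg]
    have hθe' : inner ℝ θ (-e) = 0 := by rw [inner_neg_right, hθe, neg_zero]
    have hsum := (hct e he hθe).add (hct (-e) he' hθe')
    have hm : ((equatorMass 2 : ℝ) : ℂ) * L = L + L := by simp [equatorMass]; ring
    rw [hm]
    refine hsum.congr fun r => ?_
    rw [hpol (f r) (hfc r) (hfs r)]
    have e1 := hfω r e he hθe
    have e2 := hfω r (-e) he' hθe'
    simp only [Nat.reduceSub, pow_one] at e1 e2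
    simp only [circleTerm, e1, e2, Nat.sub_self, zero_add, pow_zero, one_mul, Nat.reduceSub]
    ring
  · obtain ⟨e₁, e₂, he₁, he₂, h12, h1, h2, hpol⟩ := integral_spherical_three θ hθ
    have hee : ∀ β, ‖axisVec e₁ e₂ β‖ = 1 := norm_axisVec he₁ he₂ h12
    have hθee : ∀ β, inner ℝ θ (axisVec e₁ e₂ β) = 0 := fun β => by
      rw [axisVec, inner_add_right, inner_smul_right, inner_smul_right, h1, h2]; simp
    have hrepr : ∀ r : ℝ, (r : ℂ) ^ (3 - 1) * ∫ y, f r y =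
        ∫ β in Set.Ioo (-Real.pi) Real.pi, circleTerm (3 - 2) κ R W h θ (axisVec e₁ e₂ β) r := by
      intro r
      rw [hpol (f r) (hfc r) (hfs r), ← integral_const_mul]
      refine setIntegral_congr_fun measurableSet_Ioo fun β _ => ?_
      have e1 := hfω r _ (hee β) (hθee β)
      simp only [Nat.reduceSub] at e1
      simp_rw [circleTerm, e1, Complex.real_smul, Nat.reduceSub, pow_one]
    have hm : ((equatorMass 3 : ℝ) : ℂ) * L = ∫ _β in Set.Ioo (-Real.pi) Real.pi, L := by
      rw [setIntegral_const, Measure.real, Real.volume_Ioo, ENNReal.toReal_ofReal (by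
        linarith [Real.pi_pos]), Complex.real_smul]
      rw [show Real.pi - -Real.pi = 2 * Real.pi by ring]; simp [equatorMass]
    rw [hm]
    refine Tendsto.congr (fun r => (hrepr r).symm) ?_
    -- The bound for a half circle uses only that its transverse vector is a unit vector orthogonal
    -- to `θ`, so it is uniform in the azimuth.
    refine tendsto_integral_filter_of_dominated_convergence
      (fun _ => ∫ β in Set.Ioi (0 : ℝ), H * C * (|β| ^ (3 - 2) * (1 + 4 / Real.pi ^ 4 * β ^ 4)⁻¹))
      ?_ ?_ (integrable_const _) ?_
    · refine Eventually.of_forall fun r => Continuous.aestronglyMeasurable ?_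
      unfold circleTerm
      refine continuous_const.mul ?_
      simp_rw [← integral_Ioc_eq_integral_Ioo, ← intervalIntegral.integral_of_le Real.pi_pos.le]
      refine intervalIntegral.continuous_parametric_intervalIntegral_of_continuous' ?_ _ _
      have hv : Continuous fun p : ℝ × ℝ => axisVec θ (axisVec e₁ e₂ p.1) p.2 := by
        unfold axisVec; fun_prop
      have hhv : Continuous fun p : ℝ × ℝ => h (axisVec θ (axisVec e₁ e₂ p.1) p.2) :=
        hh.comp_continuous hv fun p => by
          rw [Set.mem_compl_singleton_iff, ← norm_ne_zero_iff, norm_axisVec hθ (hee _) (hθee _)]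
          exact one_ne_zero
      have hc5 : Continuous fun p : ℝ × ℝ => r ^ 2 * (1 - Real.cos p.2) := by fun_prop
      have hov : Continuous fun p : ℝ × ℝ => osc κ R W (axisVec θ (axisVec e₁ e₂ p.1) p.2)
          (r ^ 2 * (1 - Real.cos p.2)) :=
        Continuous.comp (g := fun p : EuclRd 3 × ℝ => osc κ R W p.1 p.2)
          (f := fun p : ℝ × ℝ => (axisVec θ (axisVec e₁ e₂ p.1) p.2, r ^ 2 * (1 - Real.cos p.2)))
          (continuous_osc κ R W) (hv.prodMk hc5)
      have hsv : Continuous fun p : ℝ × ℝ => (Real.sin p.2 : ℂ) ^ (3 - 2) := by fun_prop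
      exact hsv.mul (hhv.mul hov)
    · filter_upwards [eventually_gt_atTop 0] with r hr
      exact ae_of_all _ fun β => norm_circleTerm_le hk hC0 hC hH0 hH' hθ (hee β) (hθee β) hr
    · exact ae_of_all _ fun β => hct _ (hee β) (hθee β)

end

noncomputable section

variable {d : ℕ}

/-! ### Dilated cutoffs -/

/-- The dilated test function `χ(·/r)`. -/
def scaleTest (r : ℝ) (hr : r ≠ 0) (χ : TestFn d) : TestFn d :=
  mkTest (fun y => χ (r⁻¹ • y)) (χ.contDiff.comp (contDiff_const_smul _))
    (χ.hasCompactSupport.comp_smul (inv_ne_zero hr))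

@[simp] lemma scaleTest_apply (r : ℝ) (hr : r ≠ 0) (χ : TestFn d) (y : EuclRd d) :
    scaleTest r hr χ y = χ (r⁻¹ • y) := rfl

lemma lineDerivOp_scaleTest (r : ℝ) (hr : r ≠ 0) (v : EuclRd d) (χ : TestFn d) :
    ∂_{v} (scaleTest r hr χ) = ((r⁻¹ : ℝ) : ℂ) • scaleTest r hr (∂_{v} χ) := by
  ext y
  rw [lineDerivOp_apply]
  change fderiv ℝ (fun y => χ (r⁻¹ • y)) y v = ((r⁻¹ : ℝ) : ℂ) * (fderiv ℝ χ (r⁻¹ • y) v)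
  rw [fderiv_comp_smul]
  simp

lemma scaleTest_sum (r : ℝ) (hr : r ≠ 0) {ι : Type*} (s : Finset ι) (χ : ι → TestFn d) :
    scaleTest r hr (∑ i ∈ s, χ i) = ∑ i ∈ s, scaleTest r hr (χ i) := by
  ext y; simp

lemma lapTest_scaleTest (r : ℝ) (hr : r ≠ 0) (χ : TestFn d) :
    lapTest (scaleTest r hr χ) = (((r⁻¹ : ℝ) : ℂ) ^ 2) • scaleTest r hr (lapTest χ) := by
  simp only [lapTest_apply_sum, lineDerivOp_scaleTest, lineDerivOp_smul', smul_smul, scaleTest_sum,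
    Finset.smul_sum, sq]

lemma lineDerivOp_smul_vec (c : ℝ) (v : EuclRd d) (φ : TestFn d) :
    ∂_{c • v} φ = (c : ℂ) • ∂_{v} φ := by
  ext y
  rw [lineDerivOp_apply]
  change _ = (c : ℂ) * fderiv ℝ φ y v
  simp

/-- The biharmonic operator on a modulated test function. -/
lemma lapTest_lapTest_waveTest (ξ : EuclRd d) (ψ : TestFn d) :
    lapTest (lapTest (waveTest ξ ψ)) - ((‖ξ‖ : ℂ) ^ 4) • waveTest ξ ψ = waveTest ξ
      ((4 * I * (‖ξ‖ : ℂ) ^ 2) • ∂_{ξ} ψ + ((-2 * (‖ξ‖ : ℂ) ^ 2) • lapTest ψ +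
        (-4 : ℂ) • ∂_{ξ} (∂_{ξ} ψ)) + (-4 * I) • ∂_{ξ} (lapTest ψ) + lapTest (lapTest ψ)) := by
  rw [lapTest_waveTest, lapTest_waveTest, ← map_smul, ← map_sub]
  congr 1
  simp only [lapTest_sub, lapTest_smul, lineDerivOp_sub', lineDerivOp_smul', smul_sub, smul_smul,
    ← lineDerivOp_lapTest_comm]
  have hI : (2 * I) * (2 * I) = -4 := by linear_combination 4 * Complex.I_mul_I
  rw [hI]
  module

/-- Since `|κθ|⁴ = κ⁴`, the terms without a derivative on the cutoff cancel, and each derivative of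
the cutoff costs one factor `1/r`. The single first-order term carries the far field. -/
lemma biharmonic_waveTest_scaleTest {κ : ℝ} (hκ : 0 < κ) {θ : EuclRd d} (hθ : ‖θ‖ = 1)
    (r : ℝ) (hr : r ≠ 0) (η : TestFn d) (y : EuclRd d) :
    (lapTest (lapTest (waveTest (κ • θ) (scaleTest r hr η))) -
      ((κ : ℂ) ^ 4) • waveTest (κ • θ) (scaleTest r hr η)) (r • y) =
    planeWave (κ • θ) (r • y) *
      (((r⁻¹ : ℝ) : ℂ) * (4 * I * κ ^ 3 * (∂_{θ} η) y) +
      ((r⁻¹ : ℝ) : ℂ) ^ 2 * (-2 * κ ^ 2 * lapTest η y - 4 * κ ^ 2 * (∂_{θ} (∂_{θ} η)) y) +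
      ((r⁻¹ : ℝ) : ℂ) ^ 3 * (-4 * I * κ * (∂_{θ} (lapTest η)) y) +
      ((r⁻¹ : ℝ) : ℂ) ^ 4 * lapTest (lapTest η) y) := by
  have hn : ‖κ • θ‖ = κ := by rw [norm_smul, hθ, mul_one, Real.norm_of_nonneg hκ.le]
  have h := lapTest_lapTest_waveTest (κ • θ) (scaleTest r hr η)
  rw [hn] at h
  rw [h]
  simp only [lineDerivOp_smul_vec, lineDerivOp_scaleTest, lapTest_scaleTest, lineDerivOp_smul',
    lapTest_smul, smul_smul]
  have e : r⁻¹ • r • y = y := by rw [smul_smul, inv_mul_cancel₀ hr, one_smul]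
  simp [e]
  ring

/-! ### Averages over directions -/

/-- Expanding the square and exchanging integrals gives, for each pair of parameters, the Fourier
transform of a function on `K` at a multiple of `l(γ(p) - γ(p'))`. Off the diagonal, a null set,
injectivity makes this frequency tend to infinity and the Riemann–Lebesgue lemma applies. -/
lemma tendsto_setIntegral_sq_norm_osc {h : ℝ × EuclRd d → ℂ} (hh : Continuous h)
    {γ : ℝ → EuclRd d} (hγ : Continuous γ) {a b : ℝ} (hinj : Set.InjOn γ (Set.Icc a b))
    {K : Set (EuclRd d)} (hK : IsCompact K) :
    Tendsto (fun l : ℝ => ∫ z in K, ‖∫ p in Set.Icc a b,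
      h (p, z) * cexp (-(I * (l * inner ℝ z (γ p) : ℝ)))‖ ^ 2) atTop (𝓝 0) := by
  set μ : Measure ℝ := volume.restrict (Set.Icc a b) with hμ
  have : IsFiniteMeasure μ := ⟨by simp [hμ]⟩
  set ν : Measure (EuclRd d) := volume.restrict K with hν
  have : IsFiniteMeasure ν := ⟨by simpa [hν] using hK.measure_lt_top⟩
  have hIK : IsCompact (Set.Icc a b ×ˢ K) := isCompact_Icc.prod hK
  obtain ⟨M, hM⟩ := hIK.exists_bound_of_continuousOn hh.continuousOn
  set f : ℝ → ℝ → EuclRd d → ℂ := fun l p z =>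
    h (p, z) * cexp (-(I * (l * inner ℝ z (γ p) : ℝ))) with hf
  have hfn : ∀ l p z, ‖f l p z‖ = ‖h (p, z)‖ := fun l p z => by
    rw [hf, norm_mul, Complex.norm_exp]; simp
  have hfc : ∀ l, Continuous fun q : ℝ × EuclRd d => f l q.1 q.2 := fun l => by
    simp only [hf]; fun_prop
  set g : ℝ → (ℝ × ℝ) → EuclRd d → ℂ := fun l q z => f l q.1 z * conj (f l q.2 z) with hg
  have hgc : ∀ l, Continuous fun q : EuclRd d × (ℝ × ℝ) => g l q.2 q.1 := fun l => by
    simp only [hg]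
    exact ((hfc l).comp (f := fun q : EuclRd d × (ℝ × ℝ) => (q.2.1, q.1)) (by fun_prop)).mul
      (Complex.continuous_conj.comp
        ((hfc l).comp (f := fun q : EuclRd d × (ℝ × ℝ) => (q.2.2, q.1)) (by fun_prop)))
  have hprod : μ.prod μ = (volume : Measure (ℝ × ℝ)).restrict (Set.Icc a b ×ˢ Set.Icc a b) := by
    rw [hμ, Measure.prod_restrict]; rfl
  have hgi : ∀ l, Integrable (fun q : EuclRd d × (ℝ × ℝ) => g l q.2 q.1) (ν.prod (μ.prod μ)) := by
    intro l
    rw [hprod, hν, Measure.prod_restrict]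
    exact (hgc l).continuousOn.integrableOn_compact (hK.prod (isCompact_Icc.prod isCompact_Icc))
  have key : ∀ l, ((∫ z, ‖∫ p, f l p z ∂μ‖ ^ 2 ∂ν : ℝ) : ℂ) = ∫ q, ∫ z, g l q z ∂ν ∂(μ.prod μ) := by
    intro l
    rw [← integral_integral_swap (hgi l), ← integral_complex_ofReal]
    refine integral_congr_ae (ae_of_all _ fun z => ?_)
    have h1 : ((‖∫ p, f l p z ∂μ‖ ^ 2 : ℝ) : ℂ) = (∫ p, f l p z ∂μ) * conj (∫ p, f l p z ∂μ) := by
      rw [Complex.mul_conj, Complex.normSq_eq_norm_sq]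
    simp only [h1, hg]
    rw [← integral_conj, ← integral_prod_mul]
  have hlim : Tendsto (fun l => ∫ q, ∫ z, g l q z ∂ν ∂(μ.prod μ)) atTop (𝓝 0) := by
    rw [show (0 : ℂ) = ∫ _q : ℝ × ℝ, (0 : ℂ) ∂(μ.prod μ) by simp]
    refine tendsto_integral_filter_of_dominated_convergence (fun _ => M * M * ν.real Set.univ)
      (Eventually.of_forall fun l => ?_) (Eventually.of_forall fun l => ?_) (integrable_const _) ?_
    · exact (hgi l).integral_prod_right.aestronglyMeasurable
    · rw [hprod]
      refine (ae_restrict_iff' (measurableSet_Icc.prod measurableSet_Icc)).2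
        (ae_of_all _ fun q hq => ?_)
      refine norm_integral_le_of_norm_le_const ?_
      refine (ae_restrict_iff' hK.measurableSet).2 (ae_of_all _ fun z hz => ?_)
      have h1 := hM (q.1, z) ⟨hq.1, hz⟩
      have h2 := hM (q.2, z) ⟨hq.2, hz⟩
      simp only [hg, norm_mul, RCLike.norm_conj, hfn]
      exact mul_le_mul h1 h2 (norm_nonneg _) ((norm_nonneg _).trans h1)
    · have hdiag : ∀ᵐ q : ℝ × ℝ ∂(μ.prod μ), q.1 ≠ q.2 := by
        have hm : MeasurableSet {q : ℝ × ℝ | q.1 ≠ q.2} :=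
          (measurableSet_eq_fun measurable_fst measurable_snd).compl
        rw [Measure.ae_prod_iff_ae_ae hm]
        refine ae_of_all _ fun p => ?_
        have : {p' : ℝ | p ≠ p'} = {p}ᶜ := by ext; simp [eq_comm]
        rw [ae_iff]
        simp only [ne_eq, not_not]
        exact measure_mono_null (t := {p}) (fun x hx => hx.symm) (by simp [hμ])
      have hmem : ∀ᵐ q : ℝ × ℝ ∂(μ.prod μ), q ∈ Set.Icc a b ×ˢ Set.Icc a b := by
        rw [hprod]; exact ae_restrict_mem (measurableSet_Icc.prod measurableSet_Icc)
      filter_upwards [hdiag, hmem] with q hq hq'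
      have hne : γ q.1 - γ q.2 ≠ 0 := sub_ne_zero.2 fun h => hq (hinj hq'.1 hq'.2 h)
      have hRL := tendsto_integral_exp_inner_smul_cocompact
        (f := K.indicator fun z => h (q.1, z) * conj (h (q.2, z)))
      -- The factor `(2π)⁻¹` compensates for the `2π` in the Fourier character.
      have hw : Tendsto (fun l : ℝ => (l * (2 * Real.pi)⁻¹) • (γ q.1 - γ q.2)) atTop
          (cocompact (EuclRd d)) := by
        rw [← Metric.cobounded_eq_cocompact, ← tendsto_norm_atTop_iff_cobounded]
        simp_rw [norm_smul]
        refine Tendsto.atTop_mul_const (norm_pos_iff.2 hne) ?_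
        exact tendsto_norm_atTop_atTop.comp
          (tendsto_id.atTop_mul_const (by positivity))
      refine (hRL.comp hw).congr fun l => ?_
      rw [Function.comp_apply, hν, ← integral_indicator hK.measurableSet]
      refine integral_congr_ae (ae_of_all _ fun z => ?_)
      by_cases hz : z ∈ K
      · simp only [Set.indicator_of_mem hz, hg, hf, map_mul, ← Complex.exp_conj]
        rw [Circle.smul_def, Real.fourierChar_apply, smul_eq_mul]
        have : cexp (2 * Real.pi * (-(inner ℝ z ((l * (2 * Real.pi)⁻¹) • (γ q.1 - γ q.2))) : ℝ) * I) =
            cexp (-(I * (l * inner ℝ z (γ q.1) : ℝ))) *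
            cexp (conj (-(I * (l * inner ℝ z (γ q.2) : ℝ)))) := by
          rw [← Complex.exp_add]
          congr 1
          rw [inner_smul_right, inner_sub_right]
          have : (Real.pi : ℂ) ≠ 0 := by exact_mod_cast Real.pi_ne_zero
          simp only [map_neg, map_mul, conj_I, conj_ofReal]
          push_cast
          field_simp
          ring
        push_cast at this ⊢
        rw [this]
        ring
      · simp [Set.indicator_of_notMem hz]
  have := (Complex.continuous_re.tendsto _).comp hlim
  simp only [Complex.zero_re] at this
  refine this.congr fun l => ?_
  rw [Function.comp_apply, ← key, Complex.ofReal_re]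

end

/-! ### Bounded amplitudes averaged over directions, and functions on the sphere. -/

noncomputable section

variable {d : ℕ}

/-- After Fubini, the amplitude multiplies an oscillation already averaged over `p`, which tends to
zero in `L²(K)` and hence in `L¹(K)`. A bound on the amplitudes is then enough; they need not
converge or be smooth. -/
lemma tendsto_setIntegral_bounded_mul_osc {h : ℝ × EuclRd d → ℂ} (hh : Continuous h)
    {γ : ℝ → EuclRd d} (hγ : Continuous γ) {a b : ℝ} (hinj : Set.InjOn γ (Set.Icc a b))
    {K : Set (EuclRd d)} (hK : IsCompact K) {V : ℕ → EuclRd d → ℂ} {M : ℝ}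
    (hV : ∀ᶠ n in atTop, ContinuousOn (V n) K ∧ ∀ z ∈ K, ‖V n z‖ ≤ M)
    {l : ℕ → ℝ} (hl : Tendsto l atTop atTop) :
    Tendsto (fun n => ∫ p in Set.Icc a b, ∫ z in K,
      V n z * (h (p, z) * cexp (-(I * (l n * inner ℝ z (γ p) : ℝ))))) atTop (𝓝 0) := by
  set f : ℕ → ℝ → EuclRd d → ℂ := fun n p z =>
    h (p, z) * cexp (-(I * (l n * inner ℝ z (γ p) : ℝ))) with hf
  have hfc : ∀ n, Continuous fun q : ℝ × EuclRd d => f n q.1 q.2 := fun l => by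
    simp only [hf]; fun_prop
  set G : ℕ → EuclRd d → ℂ := fun n z => ∫ p in Set.Icc a b, f n p z with hG
  have hM0 : ∀ᶠ n in atTop, ∀ z ∈ K, ‖V n z‖ ≤ |M| := by
    filter_upwards [hV] with n hn z hz using (hn.2 z hz).trans (le_abs_self M)
  have hGc : ∀ n, ContinuousOn (G n) K := fun n => by
    refine Continuous.continuousOn ?_
    by_cases hab : a ≤ b
    · simp only [hG]
      simp_rw [integral_Icc_eq_integral_Ioc, ← intervalIntegral.integral_of_le hab]
      exact intervalIntegral.continuous_parametric_intervalIntegral_of_continuous'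
        (f := fun z p => f n p z)
        ((hfc n).comp (f := fun q : EuclRd d × ℝ => (q.2, q.1)) (by fun_prop)) _ _
    · simp only [hG, Set.Icc_eq_empty hab, Measure.restrict_empty, integral_zero_measure]
      exact continuous_const
  have h2 := (tendsto_setIntegral_sq_norm_osc hh hγ hinj hK).comp hl
  rw [tendsto_zero_iff_norm_tendsto_zero]
  have hvol : 0 ≤ (volume : Measure (EuclRd d)).real K := measureReal_nonneg
  have hup : Tendsto (fun n => |M| * ∫ z in K, ‖G n z‖) atTop (𝓝 0) := by
    have hI : Tendsto (fun n => ∫ z in K, ‖G n z‖) atTop (𝓝 0) := by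
      rw [Metric.tendsto_atTop]
      intro ε hε
      -- From `‖G‖ ≤ δ + δ⁻¹‖G‖²`, this `δ` makes the constant part at most `ε/2`; the `L²`
      -- convergence handles the rest.
      set δ := ε / (2 * ((volume : Measure (EuclRd d)).real K + 1)) with hδ
      have hδ0 : 0 < δ := by positivity
      obtain ⟨N, hN⟩ := Metric.tendsto_atTop.1 h2 (δ * (ε / 2)) (by positivity)
      refine ⟨N, fun n hn => ?_⟩
      have h3 := hN n hn
      rw [Real.dist_eq, sub_zero] at h3 ⊢
      rw [abs_of_nonneg (integral_nonneg fun _ => norm_nonneg _)]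
      have h3' := (le_abs_self _).trans_lt h3
      simp only [Function.comp_apply] at h3'
      have i1 : IntegrableOn (fun z => ‖G n z‖) K := (hGc n).norm.integrableOn_compact hK
      have i2 : IntegrableOn (fun z => ‖G n z‖ ^ 2) K :=
        ((hGc n).norm.pow 2).integrableOn_compact hK
      calc ∫ z in K, ‖G n z‖ ≤ ∫ z in K, (δ + δ⁻¹ * ‖G n z‖ ^ 2) := by
            refine setIntegral_mono i1 ?_ fun z => ?_
            · exact ((continuousOn_const).add
                (((hGc n).norm.pow 2).const_smul δ⁻¹)).integrableOn_compact hK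
            · have : 0 ≤ (δ - ‖G n z‖) ^ 2 := sq_nonneg _
              change ‖G n z‖ ≤ δ + δ⁻¹ * ‖G n z‖ ^ 2
              have h5 : δ + δ⁻¹ * ‖G n z‖ ^ 2 = (δ ^ 2 + ‖G n z‖ ^ 2) / δ := by
                field_simp
              rw [h5, le_div_iff₀ hδ0]
              nlinarith [norm_nonneg (G n z)]
        _ = volume.real K * δ + δ⁻¹ * ∫ z in K, ‖G n z‖ ^ 2 := by
            rw [integral_add _ (i2.const_mul _), setIntegral_const, integral_const_mul, smul_eq_mul]
            exact continuousOn_const.integrableOn_compact hK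
        _ < ε := by
            have h6 : δ⁻¹ * ∫ z in K, ‖G n z‖ ^ 2 < ε / 2 := by
              rw [inv_mul_lt_iff₀ hδ0]; exact h3'
            have h7 : volume.real K * δ ≤ ε / 2 := by
              rw [hδ, mul_div_assoc', div_le_div_iff₀ (by positivity) two_pos]
              nlinarith
            linarith
    simpa using hI.const_mul |M|
  refine squeeze_zero' (Eventually.of_forall fun n => norm_nonneg _) ?_ hup
  filter_upwards [hV, hM0] with n hn hM
  have hswap : ∫ p in Set.Icc a b, ∫ z in K, V n z * f n p z = ∫ z in K, V n z * G n z := by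
    rw [integral_integral_swap]
    · simp_rw [integral_const_mul]; rfl
    · rw [Measure.prod_restrict]
      refine ContinuousOn.integrableOn_compact (isCompact_Icc.prod hK) ?_
      exact (hn.1.comp continuous_snd.continuousOn fun q (hq : q ∈ Set.Icc a b ×ˢ K) => hq.2).mul (hfc n).continuousOn
  rw [hswap, ← integral_const_mul]
  refine norm_integral_le_of_norm_le (((hGc n).norm.const_smul |M|).integrableOn_compact hK) ?_
  refine (ae_restrict_iff' hK.measurableSet).2 (ae_of_all _ fun z hz => ?_)
  rw [norm_mul]
  exact mul_le_mul_of_nonneg_right (hM z hz) (norm_nonneg _)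

/-- A continuous function which is the pointwise limit of oscillatory integrals with bounded
amplitudes vanishes. -/
lemma eq_zero_of_tendsto_sum_osc {ι : Type*} [Fintype ι] {h : ι → ℝ × EuclRd d → ℂ}
    (hh : ∀ j, Continuous (h j)) {γ : ℝ → EuclRd d} (hγ : Continuous γ)
    (hinj : Set.InjOn γ (Set.Icc (-1) 1))
    {K : Set (EuclRd d)} (hK : IsCompact K) {V : ι → ℕ → EuclRd d → ℂ} {M : ℝ}
    (hV : ∀ j, ∀ᶠ n in atTop, ContinuousOn (V j n) K ∧ ∀ z ∈ K, ‖V j n z‖ ≤ M)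
    {l : ℕ → ℝ} (hl : Tendsto l atTop atTop) {T : ℝ → ℂ} (hT : Continuous T)
    (hlim : ∀ p, Tendsto (fun n => ∑ j, ∫ z in K,
      V j n z * (h j (p, z) * cexp (-(I * (l n * inner ℝ z (γ p) : ℝ))))) atTop (𝓝 (T p))) :
    T 0 = 0 := by
  set S : ι → ℕ → ℝ → ℂ := fun j n p => ∫ z in K,
      V j n z * (h j (p, z) * cexp (-(I * (l n * inner ℝ z (γ p) : ℝ)))) with hS
  have hfc : ∀ j n, Continuous fun q : ℝ × EuclRd d =>
      h j q * cexp (-(I * (l n * inner ℝ q.2 (γ q.1) : ℝ))) := fun j n => by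
    have := hh j
    fun_prop
  -- The average over a subinterval is computed twice: dominated convergence gives the integral of
  -- `T`, and the oscillatory estimate gives zero.
  have hzero : ∀ a b : ℝ, -1 ≤ a → b ≤ 1 → ∫ p in Set.Icc a b, T p = 0 := by
    intro a b ha hb
    have hIK : IsCompact (Set.Icc a b ×ˢ K) := isCompact_Icc.prod hK
    choose H hH using fun j => hIK.exists_bound_of_continuousOn (hh j).continuousOn
    have hsi : ∀ j, ∀ᶠ n in atTop, IntegrableOn (S j n) (Set.Icc a b) := fun j => by
      filter_upwards [hV j] with n hn
      refine Integrable.integral_prod_left (f := fun q : ℝ × EuclRd d =>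
        V j n q.2 * (h j q * cexp (-(I * (l n * inner ℝ q.2 (γ q.1) : ℝ))))) ?_
      rw [Measure.prod_restrict]
      refine ContinuousOn.integrableOn_compact (isCompact_Icc.prod hK) ?_
      exact (hn.1.comp continuous_snd.continuousOn fun q (hq : q ∈ Set.Icc a b ×ˢ K) => hq.2).mul (hfc j n).continuousOn
    have h1 : Tendsto (fun n => ∫ p in Set.Icc a b, ∑ j, S j n p) atTop
        (𝓝 (∫ p in Set.Icc a b, T p)) := by
      refine tendsto_integral_filter_of_dominated_convergence
        (fun _ => ∑ j, |M| * |H j| * volume.real K) ?_ ?_ ?_ (ae_of_all _ hlim)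
      · filter_upwards [eventually_all.2 hsi] with n hn
        exact (integrable_finsetSum _ fun j _ => hn j).aestronglyMeasurable
      · filter_upwards [eventually_all.2 hV] with n hn
        refine (ae_restrict_iff' measurableSet_Icc).2 (ae_of_all _ fun p hp => ?_)
        refine (norm_sum_le _ _).trans (Finset.sum_le_sum fun j _ => ?_)
        refine norm_setIntegral_le_of_norm_le_const hK.measure_lt_top fun z hz => ?_
        have h2 : ‖cexp (-(I * (l n * inner ℝ z (γ p) : ℝ)))‖ = 1 := by
          rw [Complex.norm_exp]; simp
        rw [norm_mul, norm_mul, h2, mul_one]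
        exact mul_le_mul (((hn j).2 z hz).trans (le_abs_self _))
          ((hH j (p, z) ⟨hp, hz⟩).trans (le_abs_self _)) (norm_nonneg _) (abs_nonneg _)
      · exact integrable_const _
    have h2 : Tendsto (fun n => ∑ j, ∫ p in Set.Icc a b, S j n p) atTop (𝓝 (∑ _j : ι, 0)) :=
      tendsto_finsetSum _ fun j _ => tendsto_setIntegral_bounded_mul_osc (hh j) hγ
        (hinj.mono (Set.Icc_subset_Icc ha hb)) hK (hV j) hl
    rw [Finset.sum_const_zero] at h2
    refine tendsto_nhds_unique h1 (h2.congr' ?_)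
    filter_upwards [eventually_all.2 hsi] with n hn
    rw [integral_finsetSum _ fun j _ => hn j]
  -- The primitive of `T` vanishes near 0, so its derivative `T 0` is zero by continuity.
  have hev : (fun x : ℝ => ∫ p in (0 : ℝ)..x, T p) =ᶠ[𝓝 0] fun _ => 0 := by
    filter_upwards [Ioo_mem_nhds (by norm_num : (-1 : ℝ) < 0) (by norm_num : (0 : ℝ) < 1)] with x hx
    rcases le_total 0 x with h0 | h0
    · rw [intervalIntegral.integral_of_le h0, ← integral_Icc_eq_integral_Ioc]
      exact hzero 0 x (by norm_num) hx.2.le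
    · rw [intervalIntegral.integral_of_ge h0, ← integral_Icc_eq_integral_Ioc,
        hzero x 0 hx.1.le (by norm_num), neg_zero]
  have hder := hev.deriv_eq
  rw [Continuous.deriv_integral T hT 0 0] at hder
  simpa using hder

/-- The extension of a function on the sphere to a function of degree zero. -/
def sphereExt (g : UnitSph d → ℂ) (z : EuclRd d) : ℂ :=
  if h : z = 0 then 0 else g ⟨‖z‖⁻¹ • z, by
    rw [mem_sphere_zero_iff_norm, norm_smul, norm_inv, norm_norm,
      inv_mul_cancel₀ (norm_ne_zero_iff.2 h)]⟩

lemma sphereExt_of_ne {g : UnitSph d → ℂ} {z : EuclRd d} (h : z ≠ 0) :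
    sphereExt g z = g ⟨‖z‖⁻¹ • z, by
      rw [mem_sphere_zero_iff_norm, norm_smul, norm_inv, norm_norm,
        inv_mul_cancel₀ (norm_ne_zero_iff.2 h)]⟩ := dif_neg h

lemma sphereExt_sphere (g : UnitSph d → ℂ) (θ : UnitSph d) : sphereExt g θ = g θ := by
  have hn : ‖(θ : EuclRd d)‖ = 1 := mem_sphere_zero_iff_norm.1 θ.2
  have h0 : (θ : EuclRd d) ≠ 0 := by rw [← norm_ne_zero_iff, hn]; exact one_ne_zero
  rw [sphereExt_of_ne h0]
  congr 1
  ext1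
  simp [hn]

lemma sphereExt_smul (g : UnitSph d → ℂ) (s : ℝ) (z : EuclRd d) (hs : 0 < s) :
    sphereExt g (s • z) = sphereExt g z := by
  by_cases hz : z = 0
  · simp [hz]
  · rw [sphereExt_of_ne hz, sphereExt_of_ne (smul_ne_zero hs.ne' hz)]
    congr 1
    ext1
    simp only [norm_smul, Real.norm_of_nonneg hs.le, smul_smul, mul_inv]
    congr 1
    field_simp

lemma continuousOn_sphereExt {g : UnitSph d → ℂ} (hg : Continuous g) :
    ContinuousOn (sphereExt g) {0}ᶜ := by
  rw [continuousOn_iff_continuous_domRestrict]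
  have h : ({0}ᶜ : Set (EuclRd d)).domRestrict (sphereExt g) = fun z : ({0}ᶜ : Set (EuclRd d)) => g ⟨‖(z : EuclRd d)‖⁻¹ • z, by
      rw [mem_sphere_zero_iff_norm, norm_smul, norm_inv, norm_norm,
        inv_mul_cancel₀ (norm_ne_zero_iff.2 z.2)]⟩ := by
    ext z
    exact sphereExt_of_ne z.2
  rw [h]
  refine hg.comp (Continuous.subtype_mk ?_ _)
  exact (continuous_subtype_val.norm.inv₀ fun z => norm_ne_zero_iff.2 z.2).smul
    continuous_subtype_val

/-- A far-field pattern is continuous. -/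
lemma IsFarFieldPattern.continuous {κ : ℝ} {u : DistrRd d} {g : UnitSph d → ℂ}
    (h : IsFarFieldPattern κ u g) : Continuous g := by
  obtain ⟨R, U, hU, C, hC⟩ := h
  set G : ℝ → UnitSph d → ℂ := fun r θ =>
    cexp (-(I * κ * r)) * ((r ^ (((d : ℝ) - 1) / 2) : ℝ) : ℂ) * U (r • (θ : EuclRd d)) with hG
  have hlim : TendstoUniformly G g atTop := by
    rw [Metric.tendstoUniformly_iff]
    intro ε hε
    have h1 : Tendsto (fun r : ℝ => C / r) atTop (𝓝 0) := tendsto_const_nhds.div_atTop tendsto_id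
    filter_upwards [h1.eventually_lt_const hε, eventually_gt_atTop R, eventually_ge_atTop 1]
      with r h2 h3 h4 θ
    rw [dist_comm, dist_eq_norm]
    exact (hC r θ h3 h4).trans_lt h2
  refine hlim.continuous (Filter.Eventually.frequently ?_)
  filter_upwards [eventually_gt_atTop R, eventually_gt_atTop 0] with r hr h0
  refine continuous_const.mul (hU.1.continuousOn.comp_continuous (by fun_prop) fun θ => ?_)
  rw [Set.mem_ofPred_eq, norm_smul, mem_sphere_zero_iff_norm.1 θ.2, mul_one,
    Real.norm_of_nonneg h0.le]
  exact hr

end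

noncomputable section

variable {d : ℕ}

/-! ### The far-field pattern as a functional of the source -/

/-- The closed annulus with radii `2` and `3`. -/
def annulus (d : ℕ) : Set (EuclRd d) := {y | 2 ≤ ‖y‖ ∧ ‖y‖ ≤ 3}

lemma isCompact_annulus (d : ℕ) : IsCompact (annulus d) := by
  refine (isCompact_closedBall (0 : EuclRd d) 3).of_isClosed_subset ?_ fun y hy => ?_
  · exact (isClosed_le continuous_const continuous_norm).inter
      (isClosed_le continuous_norm continuous_const)
  · exact mem_closedBall_zero_iff.2 hy.2

lemma lineDerivOp_eq_zero_of_notMem_annulus {φ : TestFn d} {c : ℂ}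
    (h2 : ∀ y, ‖y‖ < 2 → φ y = c) (h3 : ∀ y, 3 < ‖y‖ → φ y = 0) (v : EuclRd d) {y : EuclRd d}
    (hy : y ∉ annulus d) : (∂_{v} φ) y = 0 := by
  have hcases : ‖y‖ < 2 ∨ 3 < ‖y‖ := by
    by_contra hcon
    push Not at hcon
    exact hy hcon
  have hev : ∃ c' : ℂ, φ =ᶠ[𝓝 y] fun _ => c' := by
    rcases hcases with h | h
    · exact ⟨c, by
        filter_upwards [(isOpen_lt continuous_norm continuous_const).mem_nhds h] with z hz
          using h2 z hz⟩
    · exact ⟨0, by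
        filter_upwards [(isOpen_lt continuous_const continuous_norm).mem_nhds h] with z hz
          using h3 z hz⟩
  obtain ⟨c', hc'⟩ := hev
  rw [lineDerivOp_apply, hc'.fderiv_eq]
  simp

lemma lapTest_eq_zero_of_notMem_annulus {φ : TestFn d} {c : ℂ}
    (h2 : ∀ y, ‖y‖ < 2 → φ y = c) (h3 : ∀ y, 3 < ‖y‖ → φ y = 0) {y : EuclRd d}
    (hy : y ∉ annulus d) : lapTest φ y = 0 := by
  rw [lapTest_apply_sum, TestFn.sum_apply]
  refine Finset.sum_eq_zero fun i _ => ?_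
  refine lineDerivOp_eq_zero_of_notMem_annulus (c := 0) (fun z hz => ?_) (fun z hz => ?_) _ hy
  · exact lineDerivOp_eq_zero_of_notMem_annulus h2 h3 _ fun h => absurd h.1 (not_le.2 hz)
  · exact lineDerivOp_eq_zero_of_notMem_annulus h2 h3 _ fun h => absurd h.2 (not_le.2 hz)

/-- Here `d ≤ 3` enters: the far-field error, of relative size `1/ρ` against a growth `ρ^{(d-1)/2}`,
stays bounded, with equality for `d = 3`. -/
lemma rpow_sub_one_le_one (hd : d = 2 ∨ d = 3) {ρ : ℝ} (hρ : 1 ≤ ρ) :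
    ρ ^ (((d : ℝ) - 1) / 2) * ρ⁻¹ ≤ 1 := by
  rw [← Real.rpow_neg_one, ← Real.rpow_add (by linarith)]
  refine Real.rpow_le_one_of_one_le_of_nonpos hρ ?_
  rcases hd with rfl | rfl <;> norm_num

lemma pow_eq_rpow_mul_rpow {ρ : ℝ} (hρ : 0 < ρ) (hd1 : 1 ≤ d) :
    ρ ^ (d - 1) = ρ ^ (((d : ℝ) - 1) / 2) * ρ ^ (((d : ℝ) - 1) / 2) := by
  rw [← Real.rpow_natCast, ← Real.rpow_add hρ, Nat.cast_sub hd1]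
  congr 1
  push_cast; ring

lemma sqrt_pow_eq_rpow {ρ : ℝ} (hρ : 0 < ρ) (hd1 : 1 ≤ d) :
    Real.sqrt ρ ^ (d - 1) = ρ ^ (((d : ℝ) - 1) / 2) := by
  rw [Real.sqrt_eq_rpow, ← Real.rpow_natCast, ← Real.rpow_mul hρ.le, Nat.cast_sub hd1]
  congr 1
  push_cast; ring

/-- The far field expansion on dilated annuli. -/
lemma far_field_bounds (hd : d = 2 ∨ d = 3) {κ R C : ℝ} {U : EuclRd d → ℂ} {g : UnitSph d → ℂ}
    (hC : ∀ (r : ℝ) (θ : UnitSph d), R < r → 1 ≤ r →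
      ‖cexp (-(I * κ * r)) * ((r ^ (((d : ℝ) - 1) / 2) : ℝ) : ℂ) * U (r • (θ : EuclRd d)) - g θ‖
        ≤ C / r) (hC0 : 0 ≤ C) {G : ℝ} (hG : ∀ θ, ‖g θ‖ ≤ G) {ρ : ℝ} (hρ : 1 ≤ ρ) (hR : R < ρ)
    {z : EuclRd d} (hz : z ∈ annulus d) :
    ‖(ρ : ℂ) ^ (d - 1) * U (ρ • z) - (Real.sqrt ρ : ℂ) ^ (d - 1) * (sphereExt g z *
      ((‖z‖ ^ (-(((d : ℝ) - 1) / 2)) : ℝ) : ℂ) * cexp (I * (κ * (ρ * ‖z‖) : ℝ)))‖ ≤ C ∧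
    (ρ : ℝ) ^ (d - 1) * ρ⁻¹ * ‖U (ρ • z)‖ ≤ G + C := by
  have hd1 : 1 ≤ d := by omega
  have hρ0 : 0 < ρ := by linarith
  set q : ℝ := ((d : ℝ) - 1) / 2 with hq
  have hq0 : 0 ≤ q := by rw [hq]; rcases hd with rfl | rfl <;> norm_num
  have hz2 := hz.1
  have hzn : 0 < ‖z‖ := by linarith
  have hz0 : z ≠ 0 := norm_pos_iff.1 hzn
  set s : ℝ := ρ * ‖z‖ with hs
  have hs2 : 2 * ρ ≤ s := by rw [hs]; nlinarith
  have hs0 : 0 < s := by positivity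
  set ω : UnitSph d := ⟨‖z‖⁻¹ • z, by
    rw [mem_sphere_zero_iff_norm, norm_smul, norm_inv, norm_norm,
      inv_mul_cancel₀ hzn.ne']⟩ with hω
  have hsω : s • (ω : EuclRd d) = ρ • z := by
    simp only [hω, hs, smul_smul]
    congr 1
    field_simp
  have hgz : sphereExt g z = g ω := sphereExt_of_ne hz0
  have h := hC s ω (by linarith) (by linarith)
  rw [hsω] at h
  set E := cexp (-(I * κ * s)) with hE
  have hE' : E * cexp (I * (κ * s : ℝ)) = 1 := by
    rw [hE, ← Complex.exp_add]
    push_cast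
    rw [show -(I * κ * s) + I * (κ * s) = (0 : ℂ) by ring, Complex.exp_zero]
  have hEn : ‖cexp (I * (κ * s : ℝ))‖ = 1 := by
    rw [Complex.norm_exp]; simp
  have hsq : s ^ q * s ^ (-q) = 1 := by rw [← Real.rpow_add hs0]; simp
  have hsq' : ((s ^ q : ℝ) : ℂ) * ((s ^ (-q) : ℝ) : ℂ) = 1 := by exact_mod_cast hsq
  -- The error is measured in the amplitude, so the exact field is the leading term with `g ω`
  -- replaced by `g ω + ε`.
  set ε : ℂ := E * ((s ^ q : ℝ) : ℂ) * U (ρ • z) - g ω with hε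
  have hU : U (ρ • z) = cexp (I * (κ * s : ℝ)) * ((s ^ (-q) : ℝ) : ℂ) * (g ω + ε) := by
    rw [hε]
    linear_combination (-(U (ρ • z)) * ((s ^ q : ℝ) : ℂ) * ((s ^ (-q) : ℝ) : ℂ)) * hE' -
      U (ρ • z) * hsq'
  have hsz : s ^ (-q) = ρ ^ (-q) * ‖z‖ ^ (-q) := Real.mul_rpow hρ0.le hzn.le
  have hρq : ρ ^ (d - 1) * ρ ^ (-q) = ρ ^ q := by
    rw [pow_eq_rpow_mul_rpow hρ0 hd1, mul_assoc, ← Real.rpow_add hρ0]; simp [hq]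
  have hz1 : ‖z‖ ^ (-q) ≤ 1 :=
    Real.rpow_le_one_of_one_le_of_nonpos (by linarith) (by linarith)
  have hzp : 0 < ‖z‖ ^ (-q) := Real.rpow_pos_of_pos hzn _
  have hρp : 0 < ρ ^ q := Real.rpow_pos_of_pos hρ0 _
  have hεC : ‖ε‖ ≤ C * ρ⁻¹ := h.trans (by
    rw [div_eq_mul_inv]
    exact mul_le_mul_of_nonneg_left (inv_anti₀ hρ0 (by linarith)) hC0)
  have h1 := rpow_sub_one_le_one hd hρ
  rw [← hq] at h1
  have hρq' : (ρ : ℂ) ^ (d - 1) * ((s ^ (-q) : ℝ) : ℂ) =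
      ((ρ ^ q : ℝ) : ℂ) * ((‖z‖ ^ (-q) : ℝ) : ℂ) := by
    rw [hsz, ← hρq]; push_cast; ring
  constructor
  · have e1 : (ρ : ℂ) ^ (d - 1) * U (ρ • z) - (Real.sqrt ρ : ℂ) ^ (d - 1) * (sphereExt g z *
        ((‖z‖ ^ (-q) : ℝ) : ℂ) * cexp (I * (κ * s : ℝ))) =
        ((ρ ^ q : ℝ) : ℂ) * ((‖z‖ ^ (-q) : ℝ) : ℂ) * cexp (I * (κ * s : ℝ)) * ε := by
      have e2 : (Real.sqrt ρ : ℂ) ^ (d - 1) = ((ρ ^ q : ℝ) : ℂ) := by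
        rw [← Complex.ofReal_pow, sqrt_pow_eq_rpow hρ0 hd1]
      rw [hU, e2, hgz]
      linear_combination (cexp (I * (κ * s : ℝ)) * (g ω + ε)) * hρq'
    rw [e1, norm_mul, norm_mul, norm_mul, hEn, mul_one, Complex.norm_real, Complex.norm_real,
      Real.norm_of_nonneg hρp.le, Real.norm_of_nonneg hzp.le]
    calc ρ ^ q * ‖z‖ ^ (-q) * ‖ε‖ ≤ ρ ^ q * 1 * (C * ρ⁻¹) := by gcongr
      _ = C * (ρ ^ q * ρ⁻¹) := by ring
      _ ≤ C := by nlinarith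
  · have e3 : ρ ^ (d - 1) * ‖U (ρ • z)‖ = ρ ^ q * ‖z‖ ^ (-q) * ‖g ω + ε‖ := by
      rw [hU, norm_mul, norm_mul, hEn, one_mul, Complex.norm_real,
        Real.norm_of_nonneg (Real.rpow_pos_of_pos hs0 _).le, hsz, ← hρq]
      ring
    have hge : ‖g ω + ε‖ ≤ G + C := (norm_add_le _ _).trans (add_le_add (hG ω) (hεC.trans (by
      have : ρ⁻¹ ≤ 1 := inv_le_one_of_one_le₀ hρ
      nlinarith)))
    calc ρ ^ (d - 1) * ρ⁻¹ * ‖U (ρ • z)‖ = ρ⁻¹ * (ρ ^ (d - 1) * ‖U (ρ • z)‖) := by ring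
      _ = (ρ ^ q * ρ⁻¹) * (‖z‖ ^ (-q) * ‖g ω + ε‖) := by rw [e3]; ring
      _ ≤ 1 * (1 * (G + C)) := by gcongr
      _ = G + C := by ring

/-- Along every ray the cutoff drops from 1 to 0, so the integral that remains after stationary
phase depends neither on the direction nor on the shape of the cutoff. -/
lemma integral_lineDerivOp_ray {η : TestFn d} (h2 : ∀ y, ‖y‖ ≤ 2 → η y = 1)
    (h3 : ∀ y, 3 < ‖y‖ → η y = 0) {ω : EuclRd d} (hω : ‖ω‖ = 1) :
    ∫ s in (1 : ℝ)..4, (∂_{ω} η) (s • ω) = -1 := by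
  have h := intervalIntegral.integral_eq_sub_of_hasDerivAt (a := 1) (b := 4)
    (f := fun s : ℝ => η (s • ω)) (f' := fun s => (∂_{ω} η) (s • ω))
    (fun s _ => hasDerivAt_testFn_ray η ω s)
    (Continuous.intervalIntegrable ((∂_{ω} η).continuous.comp (by fun_prop)) _ _)
  rw [h, h3 ((4 : ℝ) • ω) (by rw [norm_smul, hω]; norm_num),
    h2 ((1 : ℝ) • ω) (by rw [norm_smul, hω]; norm_num)]
  norm_num

/-- The Fresnel constant and the mass of the equator combine to the inverse of the constant of the
outgoing fundamental solution, which is how `C_d` appears. -/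
lemma radConst_mul_equatorMass (hd : d = 2 ∨ d = 3) :
    radConst d / 2 * (-4 * I * (equatorMass d * fresnelConst d)) = 1 := by
  have hpi : (Real.pi : ℂ) ≠ 0 := by exact_mod_cast Real.pi_ne_zero
  rcases hd with rfl | rfl
  · have h1 : cexp (I * Real.pi / 4) * cexp (I * Real.pi / 4) = I := by
      rw [← Complex.exp_add, show I * Real.pi / 4 + I * Real.pi / 4 = Real.pi / 2 * I by ring,
        Complex.exp_pi_div_two_mul_I]
    have h2 : Real.sqrt (8 * Real.pi) = 2 * Real.sqrt (2 * Real.pi) := by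
      rw [show 8 * Real.pi = 2 ^ 2 * (2 * Real.pi) by ring, Real.sqrt_mul (by norm_num),
        Real.sqrt_sq (by norm_num)]
    have h3 : (Real.sqrt (2 * Real.pi) : ℂ) ≠ 0 := by
      exact_mod_cast (Real.sqrt_pos.2 (by positivity)).ne'
    have h4 : (equatorMass 2 : ℂ) = 2 := by simp [equatorMass]
    simp only [radConst, fresnelConst, if_true, h4, h2]
    push_cast
    field_simp
    linear_combination (-4 * I) * h1 - 4 * Complex.I_mul_I
  · have h4 : (equatorMass 3 : ℂ) = 2 * Real.pi := by simp [equatorMass]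
    simp only [radConst, fresnelConst, h4]
    norm_num
    field_simp
    linear_combination -Complex.I_mul_I

end

/-! ### The source tested against a modulated dilated cutoff. -/

noncomputable section

variable {d : ℕ}

lemma continuous_lineDerivOp_uncurry (φ : TestFn d) :
    Continuous fun q : EuclRd d × EuclRd d => (∂_{q.1} φ) q.2 := by
  have h : (fun q : EuclRd d × EuclRd d => (∂_{q.1} φ) q.2) = fun q => ∑ i, ((q.1 i : ℝ) : ℂ) *
      (∂_{(EuclideanSpace.single i (1 : ℝ) : EuclRd d)} φ) q.2 :=
    funext fun q => lineDerivOp_apply_eq_sum q.1 q.2 φ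
  rw [h]
  refine continuous_finsetSum _ fun i _ => ?_
  exact (by fun_prop : Continuous fun q : EuclRd d × EuclRd d => ((q.1 i : ℝ) : ℂ)).mul
    ((∂_{(EuclideanSpace.single i (1 : ℝ) : EuclRd d)} φ).continuous.comp continuous_snd)

lemma continuous_lineDerivOp_two_uncurry (φ : TestFn d) :
    Continuous fun q : EuclRd d × EuclRd d => (∂_{q.1} (∂_{q.1} φ)) q.2 := by
  rw [funext fun q : EuclRd d × EuclRd d => lineDerivOp_two_apply_eq_sum q.1 q.2 φ]
  refine continuous_finsetSum _ fun i _ => continuous_finsetSum _ fun j _ => ?_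
  have h : ∀ i, Continuous fun q : EuclRd d × EuclRd d => ((q.1 i : ℝ) : ℂ) :=
    fun i => by fun_prop
  exact (h i).mul ((h j).mul ((∂_{(EuclideanSpace.single j (1 : ℝ) : EuclRd d)}
    (∂_{(EuclideanSpace.single i (1 : ℝ) : EuclRd d)} φ)).continuous.comp continuous_snd))

/-- The coefficients, by powers of the dilation, of the biharmonic Helmholtz operator acting on
a modulated dilated cutoff. -/
def cutoffCoeff (κ : ℝ) (η : TestFn d) (j : Fin 4) (q : EuclRd d × EuclRd d) : ℂ :=
  match j with
  | 0 => 4 * I * κ ^ 3 * (∂_{q.1} η) q.2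
  | 1 => -2 * κ ^ 2 * lapTest η q.2 - 4 * κ ^ 2 * (∂_{q.1} (∂_{q.1} η)) q.2
  | 2 => -4 * I * κ * (∂_{q.1} (lapTest η)) q.2
  | 3 => lapTest (lapTest η) q.2

lemma continuous_cutoffCoeff (κ : ℝ) (η : TestFn d) (j : Fin 4) :
    Continuous (cutoffCoeff κ η j) := by
  have h1 := (lapTest η).continuous
  have h2 := (lapTest (lapTest η)).continuous
  have h3 := continuous_lineDerivOp_uncurry η
  have h4 := continuous_lineDerivOp_uncurry (lapTest η)
  have h5 := continuous_lineDerivOp_two_uncurry η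
  fin_cases j
  · exact continuous_const.mul h3
  · exact (continuous_const.mul (h1.comp continuous_snd)).sub (continuous_const.mul h5)
  · exact continuous_const.mul h4
  · exact h2.comp continuous_snd

lemma cutoffCoeff_eq_zero (κ : ℝ) {η : TestFn d} (h2 : ∀ y, ‖y‖ ≤ 2 → η y = 1)
    (h3 : ∀ y, 3 < ‖y‖ → η y = 0) (j : Fin 4) (v : EuclRd d) {y : EuclRd d}
    (hy : y ∉ annulus d) : cutoffCoeff κ η j (v, y) = 0 := by
  have h2' : ∀ y, ‖y‖ < 2 → η y = 1 := fun y hy => h2 y hy.le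
  have hin : ∀ z : EuclRd d, ‖z‖ < 2 → z ∉ annulus d := fun z hz h => absurd h.1 (not_le.2 hz)
  have hout : ∀ z : EuclRd d, 3 < ‖z‖ → z ∉ annulus d := fun z hz h => absurd h.2 (not_le.2 hz)
  have l0 : ∀ z : EuclRd d, z ∉ annulus d → lapTest η z = 0 := fun z hz =>
    lapTest_eq_zero_of_notMem_annulus h2' h3 hz
  have l1 : ∀ z : EuclRd d, z ∉ annulus d → (∂_{v} η) z = 0 := fun z hz =>
    lineDerivOp_eq_zero_of_notMem_annulus h2' h3 v hz
  have l2 : lapTest (lapTest η) y = 0 := lapTest_eq_zero_of_notMem_annulus (c := 0)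
    (fun z hz => l0 z (hin z hz)) (fun z hz => l0 z (hout z hz)) hy
  have l3 : (∂_{v} (lapTest η)) y = 0 := lineDerivOp_eq_zero_of_notMem_annulus (c := 0)
    (fun z hz => l0 z (hin z hz)) (fun z hz => l0 z (hout z hz)) v hy
  have l4 : (∂_{v} (∂_{v} η)) y = 0 := lineDerivOp_eq_zero_of_notMem_annulus (c := 0)
    (fun z hz => l1 z (hin z hz)) (fun z hz => l1 z (hout z hz)) v hy
  fin_cases j
  · change 4 * I * κ ^ 3 * (∂_{v} η) y = 0
    rw [l1 y hy, mul_zero]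
  · change -2 * κ ^ 2 * lapTest η y - 4 * κ ^ 2 * (∂_{v} (∂_{v} η)) y = 0
    rw [l0 y hy, l4, mul_zero, mul_zero, sub_zero]
  · change -4 * I * κ * (∂_{v} (lapTest η)) y = 0
    rw [l3, mul_zero]
  · exact l2

/-- The source tested against a modulated dilated cutoff, in terms of the exterior field. -/
lemma source_eq_integral_annulus {κ : ℝ} (hκ : 0 < κ) {F u : DistrRd d}
    (hu : ∀ φ : TestFn d, u (lapTest (lapTest φ)) - (κ : ℂ) ^ 4 * u φ = F φ) {R : ℝ}
    {U : EuclRd d → ℂ} (hU : IsSmoothOutside u R U) {η : TestFn d}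
    (h2 : ∀ y, ‖y‖ ≤ 2 → η y = 1) (h3 : ∀ y, 3 < ‖y‖ → η y = 0) {ρ : ℝ} (hρ : 0 < ρ) (hR : R < ρ)
    {θ : EuclRd d} (hθ : ‖θ‖ = 1) :
    F (waveTest (κ • θ) (scaleTest ρ hρ.ne' η)) = ∫ z in annulus d, (ρ : ℂ) ^ d * (U (ρ • z) *
      (planeWave (κ • θ) (ρ • z) *
        ∑ j : Fin 4, ((ρ⁻¹ : ℝ) : ℂ) ^ (j.1 + 1) * cutoffCoeff κ η j (θ, z))) := by
  set Pψ : TestFn d := lapTest (lapTest (waveTest (κ • θ) (scaleTest ρ hρ.ne' η))) -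
      ((κ : ℂ) ^ 4) • waveTest (κ • θ) (scaleTest ρ hρ.ne' η) with hP
  have hval : ∀ z, Pψ (ρ • z) = planeWave (κ • θ) (ρ • z) *
      ∑ j : Fin 4, ((ρ⁻¹ : ℝ) : ℂ) ^ (j.1 + 1) * cutoffCoeff κ η j (θ, z) := fun z => by
    rw [hP, biharmonic_waveTest_scaleTest hκ hθ, Fin.sum_univ_four]
    simp only [cutoffCoeff]
    norm_num
  have hz : ∀ z, z ∉ annulus d → Pψ (ρ • z) = 0 := fun z hz => by
    rw [hval, Finset.sum_eq_zero, mul_zero]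
    intro j _
    rw [cutoffCoeff_eq_zero κ h2 h3 j θ hz, mul_zero]
  -- The transformed test function vanishes off the dilated annulus, hence lives in `|x| ≥ 2ρ > R`,
  -- where `u` is the smooth function `U`.
  have hsupp : tsupport Pψ ⊆ {x | R < ‖x‖} := by
    have : tsupport Pψ ⊆ {x : EuclRd d | 2 * ρ ≤ ‖x‖} := by
      refine closure_minimal (fun x hx => ?_) (isClosed_le continuous_const continuous_norm)
      by_contra hcon
      simp only [Set.mem_ofPred_eq, not_le] at hcon
      refine hx ?_
      have := hz (ρ⁻¹ • x) fun h => ?_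
      · rwa [smul_inv_smul₀ hρ.ne'] at this
      · have h1 := h.1
        rw [norm_smul, norm_inv, Real.norm_of_nonneg hρ.le, le_inv_mul_iff₀ hρ] at h1
        linarith
    intro x hx
    have := this hx
    simp only [Set.mem_ofPred_eq] at this ⊢
    linarith
  have h4 := hU.2 Pψ hsupp
  have h5 : u Pψ = F (waveTest (κ • θ) (scaleTest ρ hρ.ne' η)) := by
    rw [hP, map_sub, map_smul, smul_eq_mul, hu]
  -- The substitution `x = ρz` moves the integral to a fixed annulus and produces the factor `ρ^d`.
  have h6 := Measure.integral_comp_smul (volume : Measure (EuclRd d)) (fun x => U x * Pψ x) ρ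
  rw [finrank_euclideanSpace_fin, abs_of_nonneg (by positivity), ← h4, h5] at h6
  have h7 : F (waveTest (κ • θ) (scaleTest ρ hρ.ne' η)) =
      (ρ : ℂ) ^ d * ∫ z, U (ρ • z) * Pψ (ρ • z) := by
    rw [h6, Complex.real_smul]
    have : (ρ : ℂ) ≠ 0 := by exact_mod_cast hρ.ne'
    push_cast
    field_simp
  rw [h7, ← integral_const_mul, ← setIntegral_eq_integral_of_forall_compl_eq_zero (s := annulus d)]
  · simp_rw [hval]
  · intro z hz'
    rw [hz z hz', mul_zero, mul_zero]

end

/-! ### The far-field pattern as a Fourier transform of the source. -/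

noncomputable section

variable {d : ℕ}

/-- The amplitudes of the exterior field on dilated annuli, after removal of the leading term. -/
def fieldAmplitude (κ : ℝ) (U : EuclRd d → ℂ) (g : UnitSph d → ℂ) (ρ : ℝ) (j : Fin 4)
    (z : EuclRd d) : ℂ :=
  if j = 0 then (ρ : ℂ) ^ (d - 1) * U (ρ • z) - (Real.sqrt ρ : ℂ) ^ (d - 1) * (sphereExt g z *
    ((‖z‖ ^ (-(((d : ℝ) - 1) / 2)) : ℝ) : ℂ) * cexp (I * (κ * (ρ * ‖z‖) : ℝ)))
  else (ρ : ℂ) ^ d * ((ρ⁻¹ : ℝ) : ℂ) ^ (j.1 + 1) * U (ρ • z)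

lemma notMem_annulus_zero : (0 : EuclRd d) ∉ annulus d := fun h => by
  have := h.1; rw [norm_zero] at this; linarith

lemma annulus_subset_compl_zero : annulus d ⊆ {0}ᶜ := fun z hz h => by
  rw [Set.mem_singleton_iff.1 h] at hz
  exact notMem_annulus_zero hz

lemma continuousOn_leading {g : UnitSph d → ℂ} (hg : Continuous g) (κ ρ : ℝ) :
    ContinuousOn (fun z : EuclRd d => sphereExt g z *
      ((‖z‖ ^ (-(((d : ℝ) - 1) / 2)) : ℝ) : ℂ) * cexp (I * (κ * (ρ * ‖z‖) : ℝ))) (annulus d) := by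
  refine (((continuousOn_sphereExt hg).mono annulus_subset_compl_zero).mul ?_).mul
    (Continuous.continuousOn (by fun_prop))
  refine Complex.continuous_ofReal.comp_continuousOn ?_
  exact continuousOn_id.norm.rpow_const fun y hy =>
    Or.inl (norm_ne_zero_iff.2 (annulus_subset_compl_zero hy))

lemma continuousOn_fieldAmplitude {u : DistrRd d} {R : ℝ} {U : EuclRd d → ℂ}
    (hU : IsSmoothOutside u R U) {g : UnitSph d → ℂ} (hg : Continuous g) (κ : ℝ) {ρ : ℝ}
    (hρ : 0 < ρ) (hR : R < ρ) (j : Fin 4) :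
    ContinuousOn (fieldAmplitude κ U g ρ j) (annulus d) := by
  have h1 : ContinuousOn (fun z => U (ρ • z)) (annulus d) := by
    refine hU.1.continuousOn.comp (Continuous.continuousOn (by fun_prop)) fun z hz => ?_
    rw [Set.mem_ofPred_eq, norm_smul, Real.norm_of_nonneg hρ.le]
    nlinarith [hz.1]
  have h2 := continuousOn_leading hg κ ρ
  unfold fieldAmplitude
  split_ifs
  · exact (continuousOn_const.mul h1).sub (continuousOn_const.mul h2)
  · exact continuousOn_const.mul h1

/-- For `j = 0` the leading term has been subtracted, which gains `1/ρ`. For `j ≥ 1` the additional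
derivative on the cutoff supplies the same gain. In both cases only boundedness results. -/
lemma norm_fieldAmplitude_le (hd : d = 2 ∨ d = 3) {κ R C : ℝ} {U : EuclRd d → ℂ}
    {g : UnitSph d → ℂ}
    (hC : ∀ (r : ℝ) (θ : UnitSph d), R < r → 1 ≤ r →
      ‖cexp (-(I * κ * r)) * ((r ^ (((d : ℝ) - 1) / 2) : ℝ) : ℂ) * U (r • (θ : EuclRd d)) - g θ‖
        ≤ C / r) (hC0 : 0 ≤ C) {G : ℝ} (hG : ∀ θ, ‖g θ‖ ≤ G) {ρ : ℝ} (hρ : 1 ≤ ρ) (hR : R < ρ)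
    (j : Fin 4) {z : EuclRd d} (hz : z ∈ annulus d) : ‖fieldAmplitude κ U g ρ j z‖ ≤ |G| + C := by
  obtain ⟨h1, h2⟩ := far_field_bounds hd hC hC0 hG hρ hR hz
  have hρ0 : 0 < ρ := by linarith
  unfold fieldAmplitude
  split_ifs with hj
  · exact h1.trans (by linarith [abs_nonneg G])
  · refine le_trans ?_ (h2.trans (by linarith [le_abs_self G]))
    have h3 : ‖(ρ : ℂ) ^ d * ((ρ⁻¹ : ℝ) : ℂ) ^ (j.1 + 1)‖ = ρ ^ (d - 1) * ρ⁻¹ ^ j.1 := by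
      rw [norm_mul, norm_pow, norm_pow, Complex.norm_real, Complex.norm_real,
        Real.norm_of_nonneg hρ0.le, Real.norm_of_nonneg (by positivity)]
      obtain ⟨k, rfl⟩ : ∃ k, d = k + 1 := ⟨d - 1, by omega⟩
      rw [Nat.add_sub_cancel, pow_succ, pow_succ]
      field_simp
    rw [norm_mul, h3]
    refine mul_le_mul_of_nonneg_right (mul_le_mul_of_nonneg_left ?_ (by positivity))
      (norm_nonneg _)
    have h4 : ρ⁻¹ ≤ 1 := inv_le_one_of_one_le₀ hρ
    have h5 : 1 ≤ j.1 := Nat.one_le_iff_ne_zero.2 fun h => hj (Fin.ext h)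
    calc ρ⁻¹ ^ j.1 ≤ ρ⁻¹ ^ 1 := pow_le_pow_of_le_one (by positivity) h4 h5
      _ = ρ⁻¹ := pow_one _

/-- Splitting of the tested source into the leading term and the remainder. -/
lemma source_eq_leading_add (hd : d = 2 ∨ d = 3) {κ : ℝ} (hκ : 0 < κ) {F u : DistrRd d}
    (hu : ∀ φ : TestFn d, u (lapTest (lapTest φ)) - (κ : ℂ) ^ 4 * u φ = F φ) {R : ℝ}
    {U : EuclRd d → ℂ} (hU : IsSmoothOutside u R U) {g : UnitSph d → ℂ} (hg : Continuous g)
    {η : TestFn d} (h2 : ∀ y, ‖y‖ ≤ 2 → η y = 1) (h3 : ∀ y, 3 < ‖y‖ → η y = 0) {ρ : ℝ}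
    (hρ : 0 < ρ) (hR : R < ρ) {θ : EuclRd d} (hθ : ‖θ‖ = 1) :
    F (waveTest (κ • θ) (scaleTest ρ hρ.ne' η)) =
      4 * I * κ ^ 3 * ((Real.sqrt ρ : ℂ) ^ (d - 1) *
        ∫ y, sphereExt g y * ((‖y‖ ^ (-(((d : ℝ) - 1) / 2)) : ℝ) : ℂ) *
        cexp (I * (κ * (Real.sqrt ρ ^ 2 * (‖y‖ - inner ℝ y θ)) : ℝ)) * (∂_{θ} η) y) +
      ∑ j : Fin 4, ∫ z in annulus d, fieldAmplitude κ U g ρ j z *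
        (cutoffCoeff κ η j (θ, z) * cexp (-(I * (κ * ρ * inner ℝ z θ : ℝ)))) := by
  have hK := isCompact_annulus d
  have hcj : ∀ j : Fin 4, Continuous fun z : EuclRd d => cutoffCoeff κ η j (θ, z) *
      cexp (-(I * (κ * ρ * inner ℝ z θ : ℝ))) := fun j =>
    ((continuous_cutoffCoeff κ η j).comp (f := fun z : EuclRd d => (θ, z)) (by fun_prop)).mul
      (by fun_prop)
  have hint : ∀ j : Fin 4, IntegrableOn (fun z => fieldAmplitude κ U g ρ j z *
      (cutoffCoeff κ η j (θ, z) * cexp (-(I * (κ * ρ * inner ℝ z θ : ℝ))))) (annulus d) :=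
    fun j => ((continuousOn_fieldAmplitude hU hg κ hρ hR j).mul
      (hcj j).continuousOn).integrableOn_compact hK
  have hlead : IntegrableOn (fun z => (Real.sqrt ρ : ℂ) ^ (d - 1) * (sphereExt g z *
      ((‖z‖ ^ (-(((d : ℝ) - 1) / 2)) : ℝ) : ℂ) * cexp (I * (κ * (ρ * ‖z‖) : ℝ))) *
      (cutoffCoeff κ η 0 (θ, z) * cexp (-(I * (κ * ρ * inner ℝ z θ : ℝ))))) (annulus d) :=
    ((continuousOn_const.mul (continuousOn_leading hg κ ρ)).mul
      (hcj 0).continuousOn).integrableOn_compact hK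
  -- The field phase `ρ|z|` and the test phase `-ρ z·θ` add up to the stationary phase, with large
  -- parameter `r = √ρ` in `tendsto_leadingTerm`.
  have hfirst : 4 * I * κ ^ 3 * ((Real.sqrt ρ : ℂ) ^ (d - 1) *
        ∫ y, sphereExt g y * ((‖y‖ ^ (-(((d : ℝ) - 1) / 2)) : ℝ) : ℂ) *
        cexp (I * (κ * (Real.sqrt ρ ^ 2 * (‖y‖ - inner ℝ y θ)) : ℝ)) * (∂_{θ} η) y) =
      ∫ z in annulus d, (Real.sqrt ρ : ℂ) ^ (d - 1) * (sphereExt g z *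
      ((‖z‖ ^ (-(((d : ℝ) - 1) / 2)) : ℝ) : ℂ) * cexp (I * (κ * (ρ * ‖z‖) : ℝ))) *
      (cutoffCoeff κ η 0 (θ, z) * cexp (-(I * (κ * ρ * inner ℝ z θ : ℝ)))) := by
    rw [← integral_const_mul, ← integral_const_mul,
      ← setIntegral_eq_integral_of_forall_compl_eq_zero (s := annulus d)]
    · refine setIntegral_congr_fun hK.measurableSet fun z _ => ?_
      have e : cexp (I * (κ * (Real.sqrt ρ ^ 2 * (‖z‖ - inner ℝ z θ)) : ℝ)) =
          cexp (I * (κ * (ρ * ‖z‖) : ℝ)) * cexp (-(I * (κ * ρ * inner ℝ z θ : ℝ))) := by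
        rw [← Complex.exp_add, Real.sq_sqrt hρ.le]
        congr 1
        push_cast; ring
      simp only [cutoffCoeff]
      rw [e]
      ring
    · intro z hz
      have := cutoffCoeff_eq_zero κ h2 h3 0 θ hz
      simp only [cutoffCoeff] at this
      linear_combination ((Real.sqrt ρ : ℂ) ^ (d - 1) *
        (sphereExt g z * ((‖z‖ ^ (-(((d : ℝ) - 1) / 2)) : ℝ) : ℂ) *
        cexp (I * (κ * (Real.sqrt ρ ^ 2 * (‖z‖ - inner ℝ z θ)) : ℝ)))) * this
  rw [source_eq_integral_annulus hκ hu hU h2 h3 hρ hR hθ, hfirst,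
    ← integral_finsetSum _ fun j _ => hint j,
    ← integral_add hlead (integrable_finsetSum _ fun j _ => hint j)]
  refine setIntegral_congr_fun hK.measurableSet fun z _ => ?_
  have e : planeWave (κ • θ) (ρ • z) = cexp (-(I * (κ * ρ * inner ℝ z θ : ℝ))) := by
    rw [planeWave, inner_smul_left, inner_smul_right]
    congr 3
    simp only [conj_trivial]
    push_cast; ring
  have hρ' : (ρ : ℂ) ≠ 0 := by exact_mod_cast hρ.ne'
  have e2 : (ρ : ℂ) ^ d * ((ρ⁻¹ : ℝ) : ℂ) = (ρ : ℂ) ^ (d - 1) := by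
    obtain ⟨k, rfl⟩ : ∃ k, d = k + 1 := ⟨d - 1, by omega⟩
    rw [Nat.add_sub_cancel, pow_succ]
    push_cast
    field_simp
  simp only [Fin.sum_univ_four, fieldAmplitude, if_true, e, Fin.isValue, one_ne_zero,
    if_false, Fin.reduceEq, Fin.val_zero, zero_add, pow_one]
  linear_combination (U (ρ • z) * cexp (-(I * (κ * ρ * inner ℝ z θ : ℝ))) *
    cutoffCoeff κ η 0 (θ, z)) * e2

/-- The far-field pattern of a solution of the biharmonic wave equation is the Fourier transform
of the source. -/
theorem farField_eq (hd : d = 2 ∨ d = 3) {κ : ℝ} (hκ : 0 < κ) {F u : DistrRd d}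
    (hu : ∀ φ : TestFn d, u (lapTest (lapTest φ)) - (κ : ℂ) ^ 4 * u φ = F φ)
    {g : UnitSph d → ℂ} (hg : IsFarFieldPattern κ u g) {χ η : TestFn d}
    (h2 : ∀ y, ‖y‖ ≤ 2 → η y = 1) (h3 : ∀ y, 3 < ‖y‖ → η y = 0)
    (hF : ∀ᶠ n : ℕ in atTop, ∀ ξ, F (waveTest ξ (scaleTest ((n : ℝ) + 1)
      (Nat.cast_add_one_ne_zero n) η)) = F (waveTest ξ χ)) (θ : UnitSph d) :
    g θ = radConst d / 2 * ((κ ^ (((d : ℝ) - 7) / 2) : ℝ) : ℂ) *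
      F (waveTest (κ • (θ : EuclRd d)) χ) := by
  have hgc := hg.continuous
  obtain ⟨R, U, hU, C, hC⟩ := hg
  have hθ : ‖(θ : EuclRd d)‖ = 1 := mem_sphere_zero_iff_norm.1 θ.2
  obtain ⟨e, he, hθe⟩ : ∃ e : EuclRd d, ‖e‖ = 1 ∧ inner ℝ (θ : EuclRd d) e = 0 := by
    rcases hd with rfl | rfl
    · obtain ⟨e, he, hθe, -⟩ := integral_spherical_two _ hθ
      exact ⟨e, he, hθe⟩
    · obtain ⟨e, -, he, -, -, hθe, -⟩ := integral_spherical_three _ hθ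
      exact ⟨e, he, hθe⟩
  set γ : ℝ → EuclRd d := axisVec (θ : EuclRd d) e with hγ
  have hγn : ∀ p, ‖γ p‖ = 1 := norm_axisVec hθ he hθe
  have hγc : Continuous γ := by rw [hγ]; unfold axisVec; fun_prop
  have hγ0 : γ 0 = θ := by simp [hγ, axisVec]
  -- The inner product with `e` along the arc is `sin p`, which is injective on `[-1, 1]` because `1
  -- < π/2`.
  have hinj : Set.InjOn γ (Set.Icc (-1) 1) := by
    intro p hp p' hp' hpp
    have h1 : ∀ p, inner ℝ (γ p) e = Real.sin p := fun p => by
      rw [hγ, axisVec, inner_add_left, inner_smul_left, inner_smul_left, hθe,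
        real_inner_self_eq_norm_sq, he]
      simp
    have h2 := h1 p
    rw [hpp, h1] at h2
    have hpi := Real.pi_gt_three
    refine (Real.injOn_sin ⟨?_, ?_⟩ ⟨?_, ?_⟩ h2).symm <;>
      linarith [hp.1, hp.2, hp'.1, hp'.2]
  have hw : ∀ v : EuclRd d, ∀ y ∈ tsupport (∂_{v} η : TestFn d), 1 < ‖y‖ ∧ ‖y‖ < 4 := by
    intro v y hy
    have : tsupport (∂_{v} η : TestFn d) ⊆ annulus d := by
      refine closure_minimal (fun x hx => ?_) (isCompact_annulus d).isClosed
      by_contra hcon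
      exact hx (lineDerivOp_eq_zero_of_notMem_annulus (fun y hy => h2 y hy.le) h3 v hcon)
    have := this hy
    constructor <;> linarith [this.1, this.2]
  obtain ⟨G, hG⟩ : ∃ G, ∀ θ, ‖g θ‖ ≤ G := by
    obtain ⟨G, hG⟩ := (isCompact_univ (X := UnitSph d)).exists_bound_of_continuousOn
      hgc.continuousOn
    exact ⟨G, fun θ => hG θ (Set.mem_univ _)⟩
  have hC' : ∀ (r : ℝ) (θ : UnitSph d), R < r → 1 ≤ r →
      ‖cexp (-(I * κ * r)) * ((r ^ (((d : ℝ) - 1) / 2) : ℝ) : ℂ) * U (r • (θ : EuclRd d)) - g θ‖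
        ≤ |C| / r := fun r θ h1 h2 => (hC r θ h1 h2).trans (by gcongr; exact le_abs_self C)
  set c : ℂ := equatorMass d * (fresnelConst d * ((κ ^ (-(((d : ℝ) - 1) / 2)) : ℝ) : ℂ)) with hc
  -- `T` is the defect of the claimed identity along an arc of directions through `θ`; the claim is
  -- `T 0 = 0`.
  set T : ℝ → ℂ := fun p => F (waveTest (κ • γ p) χ) + 4 * I * κ ^ 3 * (c * sphereExt g (γ p))
    with hT
  have hTc : Continuous T := by
    have h1 : Continuous fun p => F (waveTest (κ • γ p) χ) :=
      (F.continuous_waveTest χ).comp (by fun_prop : Continuous fun p => κ • γ p)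
    have h2 : Continuous fun p => sphereExt g (γ p) :=
      (continuousOn_sphereExt hgc).comp_continuous hγc fun p => by
        rw [Set.mem_compl_singleton_iff, ← norm_ne_zero_iff, hγn]; exact one_ne_zero
    exact h1.add (continuous_const.mul (continuous_const.mul h2))
  have hρ1 : ∀ n : ℕ, (1 : ℝ) ≤ (n : ℝ) + 1 := fun n => by
    have : (0 : ℝ) ≤ n := Nat.cast_nonneg n
    linarith
  have hρt : Tendsto (fun n : ℕ => (n : ℝ) + 1) atTop atTop :=
    tendsto_atTop_add_const_right _ _ tendsto_natCast_atTop_atTop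
  have hRev : ∀ᶠ n : ℕ in atTop, R < (n : ℝ) + 1 := hρt.eventually_gt_atTop R
  have hT0 : T 0 = 0 := by
    refine eq_zero_of_tendsto_sum_osc (h := fun j q => cutoffCoeff κ η j (γ q.1, q.2))
      (V := fun j n => fieldAmplitude κ U g ((n : ℝ) + 1) j) (M := |G| + |C|)
      (l := fun n => κ * ((n : ℝ) + 1)) (fun j => ?_) hγc hinj (isCompact_annulus d)
      (fun j => ?_) (hρt.const_mul_atTop hκ) hTc fun p => ?_
    · exact (continuous_cutoffCoeff κ η j).comp
        (f := fun q : ℝ × EuclRd d => (γ q.1, q.2)) (by fun_prop)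
    · filter_upwards [hRev] with n hn
      exact ⟨continuousOn_fieldAmplitude hU hgc κ (by linarith [hρ1 n]) hn j, fun z hz =>
        norm_fieldAmplitude_le hd hC' (abs_nonneg C) hG (hρ1 n) hn j hz⟩
    · have hl := (tendsto_leadingTerm hd hκ (by norm_num : (1 : ℝ) ≤ 4) (hγn p)
        (continuousOn_sphereExt hgc) (sphereExt_smul g) (∂_{γ p} η) (hw _)).comp
        (Real.tendsto_sqrt_atTop.comp hρt)
      rw [integral_lineDerivOp_ray h2 h3 (hγn p)] at hl
      have hl2 := (hl.const_mul (4 * I * κ ^ 3)).const_sub (F (waveTest (κ • γ p) χ))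
      have hTp : F (waveTest (κ • γ p) χ) - 4 * I * κ ^ 3 * (equatorMass d * (fresnelConst d *
          ((κ ^ (-(((d : ℝ) - 1) / 2)) : ℝ) : ℂ) * sphereExt g (γ p) * -1)) = T p := by
        rw [hT, hc]; ring
      rw [hTp] at hl2
      refine hl2.congr' ?_
      filter_upwards [hRev, hF] with n hn hFn
      have hs := source_eq_leading_add hd hκ hu hU hgc h2 h3
        (by linarith [hρ1 n] : 0 < (n : ℝ) + 1) hn (hγn p)
      rw [hFn] at hs
      rw [hs]
      simp only [Function.comp_apply]
      ring
  -- The exponents are those of the first-order coefficient `4iκ³`, of stationary phase and of the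
  -- claimed formula; they sum to zero.
  have hκ1 : κ ^ 3 * κ ^ (-(((d : ℝ) - 1) / 2)) * κ ^ (((d : ℝ) - 7) / 2) = 1 := by
    rw [← Real.rpow_natCast, ← Real.rpow_add hκ, ← Real.rpow_add hκ]
    convert Real.rpow_zero κ using 2
    push_cast; ring
  have hκ2 : (κ : ℂ) ^ 3 * ((κ ^ (-(((d : ℝ) - 1) / 2)) : ℝ) : ℂ) *
      ((κ ^ (((d : ℝ) - 7) / 2) : ℝ) : ℂ) = 1 := by exact_mod_cast hκ1
  have hrad := radConst_mul_equatorMass hd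
  simp only [hT, hγ0, sphereExt_sphere, hc] at hT0
  have : F (waveTest (κ • (θ : EuclRd d)) χ) = -(4 * I * κ ^ 3 * (equatorMass d *
      (fresnelConst d * ((κ ^ (-(((d : ℝ) - 1) / 2)) : ℝ) : ℂ)) * g θ)) := by
    linear_combination hT0
  rw [this]
  linear_combination (-g θ) * hrad - (g θ * (radConst d / 2 *
    (-4 * I * (equatorMass d * fresnelConst d)))) * hκ2

end

noncomputable section

variable {d : ℕ}

/-! ### Microlocally isotropic Gaussian fields -/

@[simp] lemma conjTest_apply (φ : TestFn d) (x : EuclRd d) : conjTest φ x = conj (φ x) := rfl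

lemma conjTest_conjTest (φ : TestFn d) : conjTest (conjTest φ) = φ := by
  ext x; simp

lemma pseudoDiff_eq_zero {D : Opens (EuclRd d)} {σ : EuclRd d → EuclRd d → ℂ}
    (hσ : ∀ ξ, IsTestOn D (fun x => σ x ξ)) (φ : EuclRd d → ℂ) {x : EuclRd d} (hx : x ∉ D) :
    pseudoDiff σ φ x = 0 := by
  have h : ∀ ξ, σ x ξ = 0 := fun ξ => by
    have h1 : x ∉ tsupport (fun x => σ x ξ) := fun h => hx ((hσ ξ).2.2 h)
    exact image_eq_zero_of_notMem_tsupport (f := fun x => σ x ξ) h1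
  simp [pseudoDiff, h]

section Field

variable {Ω : Type*} [MeasurableSpace Ω] {P : Measure Ω} {f : Ω → DistrRd d} {m : ℝ}
  {D : Opens (EuclRd d)} {ac ar : 𝓓(D, ℂ)}

lemma IsCenteredGMIG.covForm_eq (hf : IsCenteredGMIG P f m D ac ar) (φ ψ : TestFn d) :
    covForm P f φ ψ = ∫ ω, conj (f ω (conjTest φ)) * f ω ψ ∂P := by
  simp only [covForm, hf.centered, sub_zero]

lemma IsCenteredGMIG.relForm_eq (hf : IsCenteredGMIG P f m D ac ar) (φ ψ : TestFn d) :
    relForm P f φ ψ = ∫ ω, f ω φ * f ω ψ ∂P := by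
  simp only [relForm, hf.centered, sub_zero]

/-- The covariance operator produces functions vanishing outside `D`, so `f ω ψ` has second moment
zero. The exceptional null set depends on `ψ`. -/
lemma IsCenteredGMIG.ae_eq_zero (hf : IsCenteredGMIG P f m D ac ar) {ψ : TestFn d}
    (hψ : ∀ x ∈ D, ψ x = 0) : ∀ᵐ ω ∂P, f ω ψ = 0 := by
  obtain ⟨σ, hσ, hcov⟩ := hf.covariance
  have h1 : ∫ ω, ‖f ω ψ‖ ^ 2 ∂P = 0 := by
    have h2 := hf.covForm_eq (conjTest ψ) ψ
    rw [hcov, conjTest_conjTest] at h2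
    have h3 : ∫ x, pseudoDiff σ (conjTest ψ) x * ψ x = 0 := by
      rw [← integral_zero (EuclRd d) ℂ]
      congr 1
      ext x
      by_cases hx : x ∈ D
      · rw [hψ x hx, mul_zero]
      · rw [pseudoDiff_eq_zero hσ.2.1 _ hx, zero_mul]
    rw [h3] at h2
    have h4 : ((∫ ω, ‖f ω ψ‖ ^ 2 ∂P : ℝ) : ℂ) = 0 := by
      rw [h2, ← integral_complex_ofReal]
      congr 1
      ext ω
      rw [mul_comm, Complex.mul_conj, Complex.normSq_eq_norm_sq]
    exact_mod_cast h4
  have hint : Integrable (fun ω => ‖f ω ψ‖ ^ 2) P := by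
    simpa using (hf.gaussian ψ).memLp_two.integrable_norm_pow (by norm_num)
  have h2 := (integral_eq_zero_iff_of_nonneg (fun ω => by positivity) hint).1 h1
  filter_upwards [h2] with ω hω
  simpa using hω

/-- Almost surely, the far-field patterns are given by the Fourier transform of the source. -/
theorem exists_cutoff_farField (hd : d = 2 ∨ d = 3) (hD : Bornology.IsBounded (D : Set (EuclRd d)))
    (hf : IsCenteredGMIG P f m D ac ar)
    {u : ℝ → Ω → DistrRd d} {v : Ω → UnitSph d → ℝ → ℂ} (hu : IsBiharmonicField P f u v) :
    ∃ χ : TestFn d, (∀ x ∈ D, χ x = 1) ∧ conjTest χ = χ ∧ ∀ᵐ ω ∂P, ∀ (θ : UnitSph d) (κ : ℝ),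
      0 < κ → v ω θ κ = radConst d / 2 * ((κ ^ (((d : ℝ) - 7) / 2) : ℝ) : ℂ) *
        f ω (waveTest (κ • (θ : EuclRd d)) χ) := by
  let b : ContDiffBump (0 : EuclRd d) := ⟨2, 3, by norm_num, by norm_num⟩
  let η : TestFn d := mkTest (fun x => ((b x : ℝ) : ℂ))
    (ofRealCLM.contDiff.comp b.contDiff)
    (b.hasCompactSupport.comp_left (g := fun x : ℝ => (x : ℂ)) (by simp))
  have hη : ∀ x, η x = ((b x : ℝ) : ℂ) := fun x => rfl
  have h2 : ∀ y, ‖y‖ ≤ 2 → η y = 1 := fun y hy => by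
    rw [hη, b.one_of_mem_closedBall (mem_closedBall_zero_iff.2 hy)]; simp
  have h3 : ∀ y, 3 < ‖y‖ → η y = 0 := fun y hy => by
    rw [hη, b.zero_of_le_dist (by rw [dist_zero_right]; exact hy.le)]; simp
  obtain ⟨r, hr⟩ := hD.subset_closedBall 0
  obtain ⟨N, hN⟩ := exists_nat_ge r
  have hone : ∀ n : ℕ, N ≤ n → ∀ x ∈ D, scaleTest ((n : ℝ) + 1) (Nat.cast_add_one_ne_zero n) η x =
      1 := fun n hn x hx => by
    rw [scaleTest_apply]
    refine h2 _ ?_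
    have h4 : ‖x‖ ≤ r := mem_closedBall_zero_iff.1 (hr hx)
    have h5 : (N : ℝ) ≤ n := by exact_mod_cast hn
    have h6 : (0 : ℝ) ≤ n := Nat.cast_nonneg n
    rw [norm_smul, norm_inv, Real.norm_of_nonneg (by linarith), inv_mul_le_iff₀ (by linarith)]
    linarith
  set χ : TestFn d := scaleTest ((N : ℝ) + 1) (Nat.cast_add_one_ne_zero N) η with hχ
  refine ⟨χ, hone N le_rfl, ?_, ?_⟩
  · ext x; simp [hχ, hη]
  -- All the large cutoffs equal 1 on `D`, so replacing one by another changes the tested source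
  -- only on a null set. Countably many dilations and frequencies allow a common null set, and
  -- continuity in the frequency recovers the rest.
  have hdense : ∀ᵐ ω ∂P, ∀ n : ℕ, N ≤ n → ∀ k : ℕ,
      f ω (waveTest (TopologicalSpace.denseSeq (EuclRd d) k)
        (scaleTest ((n : ℝ) + 1) (Nat.cast_add_one_ne_zero n) η)) =
      f ω (waveTest (TopologicalSpace.denseSeq (EuclRd d) k) χ) := by
    rw [ae_all_iff]
    intro n
    by_cases hn : N ≤ n
    · simp only [hn, forall_const]
      rw [ae_all_iff]
      intro k
      have := hf.ae_eq_zero (ψ := waveTest (TopologicalSpace.denseSeq (EuclRd d) k)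
        (scaleTest ((n : ℝ) + 1) (Nat.cast_add_one_ne_zero n) η) -
        waveTest (TopologicalSpace.denseSeq (EuclRd d) k) χ) fun x hx => by
          have e1 := hone n hn x hx
          have e2 := hone N le_rfl x hx
          rw [← hχ] at e2
          change scaleTest ((n : ℝ) + 1) (Nat.cast_add_one_ne_zero n) η x * _ - χ x * _ = 0
          rw [e1, e2, sub_self]
      filter_upwards [this] with ω hω
      rwa [map_sub, sub_eq_zero] at hω
    · simp [hn]
  filter_upwards [hu, hdense] with ω hω hω' θ κ hκ
  refine farField_eq hd hκ (hω κ hκ).1.1 (hω κ hκ).2 h2 h3 ?_ θ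
  filter_upwards [eventually_ge_atTop N] with n hn
  have := Continuous.ext_on (TopologicalSpace.denseRange_denseSeq (EuclRd d))
    ((f ω).continuous_waveTest (scaleTest ((n : ℝ) + 1) (Nat.cast_add_one_ne_zero n) η))
    ((f ω).continuous_waveTest χ) (by rintro _ ⟨k, rfl⟩; exact hω' n hn k)
  exact fun ξ => congrFun this ξ

end Field

end

noncomputable section

/-! ### Fourth moments of Gaussian families -/

/-- The fourth moment is read off as the fourth derivative at zero of the moment generating function
`e^{vt²/2}`. -/
lemma integral_pow_four_gaussianReal (v : ℝ≥0) : ∫ x, x ^ 4 ∂(gaussianReal 0 v) = 3 * (v : ℝ) ^ 2 := by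
  have h1 := iteratedDeriv_mgf_zero (X := id) (μ := gaussianReal 0 v)
    (by rw [integrableExpSet_id_gaussianReal]; simp) 4
  rw [mgf_id_gaussianReal] at h1
  have hE : ∀ t : ℝ, HasDerivAt (fun t : ℝ => Real.exp (0 * t + v * t ^ 2 / 2))
      (Real.exp (0 * t + v * t ^ 2 / 2) * (v * t)) t := fun t => by
    refine HasDerivAt.exp ?_
    have := ((hasDerivAt_id t).const_mul (0 : ℝ)).add
      (((hasDerivAt_pow 2 t).const_mul (v : ℝ)).div_const 2)
    exact this.congr_deriv (by simp; ring)
  set E : ℝ → ℝ := fun t => Real.exp (0 * t + v * t ^ 2 / 2) with hEd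
  replace hE : ∀ t, HasDerivAt E (E t * (v * t)) t := hE
  have hE0 : E 0 = 1 := by simp [hEd]
  have hp : ∀ (t : ℝ) (n : ℕ), HasDerivAt (fun t : ℝ => t ^ n) (n * t ^ (n - 1)) t :=
    fun t n => hasDerivAt_pow n t
  have d1 : deriv E = fun t => E t * (v * t) := funext fun t => (hE t).deriv
  have d2 : deriv (fun t => E t * (v * t)) = fun t => E t * (v + v ^ 2 * t ^ 2) := funext fun t => by
    have := (hE t).mul ((hasDerivAt_id t).const_mul (v : ℝ))
    refine (this.deriv).trans ?_
    simp; ring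
  have d3 : deriv (fun t => E t * (v + v ^ 2 * t ^ 2)) =
      fun t => E t * (3 * v ^ 2 * t + v ^ 3 * t ^ 3) := funext fun t => by
    have := (hE t).mul (((hp t 2).const_mul ((v : ℝ) ^ 2)).const_add (v : ℝ))
    refine (this.deriv).trans ?_
    simp; ring
  have d4 : deriv (fun t => E t * (3 * v ^ 2 * t + v ^ 3 * t ^ 3)) 0 = 3 * (v : ℝ) ^ 2 := by
    have := (hE 0).mul (((hasDerivAt_id (0 : ℝ)).const_mul (3 * (v : ℝ) ^ 2)).add
      ((hp 0 3).const_mul ((v : ℝ) ^ 3)))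
    refine (this.deriv).trans ?_
    simp [hE0]
  rw [iteratedDeriv_succ, iteratedDeriv_succ, iteratedDeriv_succ, iteratedDeriv_one, d1, d2, d3,
    d4] at h1
  rw [h1]
  rfl

variable {Ω : Type*} [MeasurableSpace Ω] {P : Measure Ω}

lemma ProbabilityTheory.HasGaussianLaw.integral_pow_four {X : Ω → ℝ} (hX : HasGaussianLaw X P)
    (h0 : ∫ ω, X ω ∂P = 0) : ∫ ω, X ω ^ 4 ∂P = 3 * (∫ ω, X ω ^ 2 ∂P) ^ 2 := by
  have h1 := hX.map_eq_gaussianReal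
  rw [h0] at h1
  have h2 : ∫ ω, X ω ^ 4 ∂P = ∫ x, x ^ 4 ∂(P.map X) :=
    (integral_map hX.aemeasurable (f := fun x : ℝ => x ^ 4) (by fun_prop)).symm
  have h3 : Var[X; P] = ∫ ω, X ω ^ 2 ∂P := variance_of_integral_eq_zero hX.aemeasurable h0
  rw [h2, h1, integral_pow_four_gaussianReal, Real.coe_toNNReal _ (variance_nonneg _ _), h3]

/-- Wick's formula for four random variables. -/
def Wick (P : Measure Ω) (A B C D : Ω → ℂ) : Prop :=
  ∫ ω, A ω * B ω * C ω * D ω ∂P = (∫ ω, A ω * B ω ∂P) * (∫ ω, C ω * D ω ∂P) +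
    (∫ ω, A ω * C ω ∂P) * (∫ ω, B ω * D ω ∂P) + (∫ ω, A ω * D ω ∂P) * (∫ ω, B ω * C ω ∂P)

lemma integrable_mul_four {A B C D : Ω → ℂ} (hA : MemLp A 4 P) (hB : MemLp B 4 P)
    (hC : MemLp C 4 P) (hD : MemLp D 4 P) : Integrable (fun ω => A ω * B ω * C ω * D ω) P := by
  have : ENNReal.HolderTriple 4 4 2 := ⟨by
    rw [← ENNReal.toReal_eq_toReal_iff' (by simp) (by simp)]
    simp [ENNReal.toReal_add]
    norm_num⟩
  have h1 : MemLp (fun ω => A ω * B ω) 2 P := hB.mul hA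
  have h2 : MemLp (fun ω => C ω * D ω) 2 P := hD.mul hC
  have h3 := h1.integrable_mul h2
  refine h3.congr (ae_of_all _ fun ω => ?_)
  simp only [Pi.mul_apply]
  ring

/-- Cyclic rotation brings each slot in turn to the first place, so linearity in the first argument
alone extends the formula to complex combinations in all four. -/
lemma Wick.rotate {A B C D : Ω → ℂ} (h : Wick P A B C D) : Wick P B C D A := by
  unfold Wick at *
  have e : ∀ ω, B ω * C ω * D ω * A ω = A ω * B ω * C ω * D ω := fun ω => by ring
  simp_rw [e]
  rw [h]
  simp_rw [mul_comm (B _) (A _), mul_comm (C _) (A _), mul_comm (D _) (A _)]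
  ring

lemma Wick.add_smul [IsFiniteMeasure P] {A A' B C D : Ω → ℂ} (hA : MemLp A 4 P)
    (hA' : MemLp A' 4 P) (hB : MemLp B 4 P) (hC : MemLp C 4 P) (hD : MemLp D 4 P) (z : ℂ)
    (h : Wick P A B C D) (h' : Wick P A' B C D) : Wick P (fun ω => A ω + z * A' ω) B C D := by
  have h2 : ∀ {X Y : Ω → ℂ}, MemLp X 4 P → MemLp Y 4 P → Integrable (fun ω => X ω * Y ω) P :=
    fun hX hY => (hX.mono_exponent (by norm_num : (2 : ENNReal) ≤ 4)).integrable_mul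
      (hY.mono_exponent (by norm_num : (2 : ENNReal) ≤ 4))
  unfold Wick at *
  have e4 : ∫ ω, (A ω + z * A' ω) * B ω * C ω * D ω ∂P = ∫ ω, A ω * B ω * C ω * D ω ∂P +
      z * ∫ ω, A' ω * B ω * C ω * D ω ∂P := by
    rw [← integral_const_mul, ← integral_add (integrable_mul_four hA hB hC hD)
      ((integrable_mul_four hA' hB hC hD).const_mul z)]
    congr 1; ext ω; ring
  have e2 : ∀ {X : Ω → ℂ}, MemLp X 4 P → ∫ ω, (A ω + z * A' ω) * X ω ∂P =
      ∫ ω, A ω * X ω ∂P + z * ∫ ω, A' ω * X ω ∂P := fun hX => by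
    rw [← integral_const_mul, ← integral_add (h2 hA hX) ((h2 hA' hX).const_mul z)]
    congr 1; ext ω; ring
  rw [e4, e2 hB, e2 hC, e2 hD, h, h']
  ring

/-- Wick's formula for a linear family of centered real Gaussian variables. -/
lemma wick_of_linear {V : Type*} [AddCommGroup V] {L : V → Ω → ℝ} (hadd : ∀ a b ω, L (a + b) ω = L a ω + L b ω)
    (hsub : ∀ a b ω, L (a - b) ω = L a ω - L b ω)
    (hL : ∀ a, HasGaussianLaw (L a) P) (h0 : ∀ a, ∫ ω, L a ω ∂P = 0) (a b c e : V) :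
    Wick P (fun ω => (L a ω : ℂ)) (fun ω => (L b ω : ℂ)) (fun ω => (L c ω : ℂ))
      (fun ω => (L e ω : ℂ)) := by
  have := (hL 0).isProbabilityMeasure
  have hmem : ∀ a, MemLp (L a) 4 P := fun a => (hL a).memLp (by norm_num)
  have hmem2 : ∀ a, MemLp (L a) 2 P := fun a => (hL a).memLp (by norm_num)
  have hi2 : ∀ a b, Integrable (fun ω => L a ω * L b ω) P := fun a b =>
    (hmem2 a).integrable_mul (hmem2 b)
  set K : V → V → ℝ := fun a b => ∫ ω, L a ω * L b ω ∂P with hK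
  have hKs : ∀ a b, K a b = K b a := fun a b => by simp only [hK, mul_comm]
  have hKadd : ∀ a b c, K (a + b) c = K a c + K b c := fun a b c => by
    simp only [hK]
    rw [← integral_add (hi2 a c) (hi2 b c)]
    congr 1; ext ω; rw [hadd]; ring
  have hKsub : ∀ a b c, K (a - b) c = K a c - K b c := fun a b c => by
    simp only [hK]
    rw [← integral_sub (hi2 a c) (hi2 b c)]
    congr 1; ext ω; rw [hsub]; ring
  have hKadd' : ∀ a b c, K c (a + b) = K c a + K c b := fun a b c => by
    rw [hKs, hKadd, hKs a, hKs b]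
  have hKsub' : ∀ a b c, K c (a - b) = K c a - K c b := fun a b c => by
    rw [hKs, hKsub, hKs a, hKs b]
  have h4 : ∀ a, ∫ ω, L a ω ^ 4 ∂P = 3 * (K a a) ^ 2 := fun a => by
    rw [(hL a).integral_pow_four (h0 a)]
    simp only [hK, sq]
  have hi4 : ∀ a, Integrable (fun ω => L a ω ^ 4) P := fun a => by
    have := (hmem a).integrable_norm_pow (p := 4) (by norm_num)
    refine this.congr (ae_of_all _ fun ω => ?_)
    simp [Real.norm_eq_abs, Even.pow_abs (by decide : Even 4)]
  have key : ∫ ω, L a ω * L b ω * L c ω * L e ω ∂P =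
      K a b * K c e + K a c * K b e + K a e * K b c := by
    -- Polarization: the signed sum of fourth powers over the eight choices of signs is `8 · 4! =
    -- 192` times the product. Every combination is again a member of the Gaussian family, so joint
    -- Gaussianity is never needed as a separate hypothesis.
    have e1 : ∀ ω, L a ω * L b ω * L c ω * L e ω = (1 / 192) *
        (((L (a + b + c + e) ω ^ 4 + L (a + b - c - e) ω ^ 4) +
        (L (a - b + c - e) ω ^ 4 + L (a - b - c + e) ω ^ 4)) -
        ((L (a + b + c - e) ω ^ 4 + L (a + b - c + e) ω ^ 4) +
        (L (a - b + c + e) ω ^ 4 + L (a - b - c - e) ω ^ 4))) := fun ω => by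
      simp only [hadd, hsub]; ring
    simp_rw [e1]
    rw [integral_const_mul, integral_sub, integral_add, integral_add, integral_add, integral_add,
      integral_add, integral_add]
    · simp only [h4, hKadd, hKsub, hKadd', hKsub']
      rw [hKs b a, hKs c a, hKs c b, hKs e a, hKs e b, hKs e c]
      ring
    all_goals first
      | exact hi4 _
      | exact (hi4 _).add (hi4 _)
      | exact ((hi4 _).add (hi4 _)).add ((hi4 _).add (hi4 _))
  unfold Wick
  have hc : ∀ a b, ∫ ω, (L a ω : ℂ) * (L b ω : ℂ) ∂P = (K a b : ℂ) := fun a b => by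
    simp only [hK, ← integral_complex_ofReal, Complex.ofReal_mul]
  simp only [hc]
  have : ∫ ω, (L a ω : ℂ) * (L b ω : ℂ) * (L c ω : ℂ) * (L e ω : ℂ) ∂P =
      ((∫ ω, L a ω * L b ω * L c ω * L e ω ∂P : ℝ) : ℂ) := by
    simp only [← integral_complex_ofReal, Complex.ofReal_mul]
  rw [this, key]
  push_cast
  ring

/-- Complex combinations of a linear family of centered real Gaussian variables. -/
lemma wick_of_linear_complex {V : Type*} [AddCommGroup V] {L : V → Ω → ℝ}
    (hadd : ∀ a b ω, L (a + b) ω = L a ω + L b ω) (hsub : ∀ a b ω, L (a - b) ω = L a ω - L b ω)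
    (hL : ∀ a, HasGaussianLaw (L a) P) (h0 : ∀ a, ∫ ω, L a ω ∂P = 0) {A B C D : Ω → ℂ}
    (hA : ∃ a a', A = fun ω => (L a ω : ℂ) + I * (L a' ω : ℂ))
    (hB : ∃ a a', B = fun ω => (L a ω : ℂ) + I * (L a' ω : ℂ))
    (hC : ∃ a a', C = fun ω => (L a ω : ℂ) + I * (L a' ω : ℂ))
    (hD : ∃ a a', D = fun ω => (L a ω : ℂ) + I * (L a' ω : ℂ)) : Wick P A B C D := by
  have := (hL 0).isProbabilityMeasure
  have hr : ∀ a, MemLp (fun ω => (L a ω : ℂ)) 4 P := fun a =>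
    ((hL a).memLp (by norm_num : (4 : ENNReal) ≠ ⊤)).ofReal
  have hc : ∀ {A : Ω → ℂ}, (∃ a a', A = fun ω => (L a ω : ℂ) + I * (L a' ω : ℂ)) →
      MemLp A 4 P := by
    rintro _ ⟨a, a', rfl⟩
    exact (hr a).add ((hr a').const_mul I)
  have hb := hc hB; have hcc := hc hC; have hdd := hc hD
  have w0 := wick_of_linear hadd hsub hL h0
  have w1 : ∀ b c e, Wick P A (fun ω => (L b ω : ℂ)) (fun ω => (L c ω : ℂ))
      (fun ω => (L e ω : ℂ)) := fun b c e => by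
    obtain ⟨a, a', rfl⟩ := hA
    exact Wick.add_smul (hr a) (hr a') (hr _) (hr _) (hr _) I (w0 _ _ _ _) (w0 _ _ _ _)
  have ha := hc hA
  have w2 : ∀ c e, Wick P B (fun ω => (L c ω : ℂ)) (fun ω => (L e ω : ℂ)) A := fun c e => by
    obtain ⟨b, b', rfl⟩ := hB
    exact Wick.add_smul (hr b) (hr b') (hr _) (hr _) ha I (w1 _ _ _).rotate (w1 _ _ _).rotate
  have w3 : ∀ e, Wick P C (fun ω => (L e ω : ℂ)) A B := fun e => by
    obtain ⟨c, c', rfl⟩ := hC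
    exact Wick.add_smul (hr c) (hr c') (hr _) ha hb I (w2 _ _).rotate (w2 _ _).rotate
  have w4 : Wick P D A B C := by
    obtain ⟨e, e', rfl⟩ := hD
    exact Wick.add_smul (hr e) (hr e') ha hb hcc I (w3 _).rotate (w3 _).rotate
  exact w4.rotate

variable {d : ℕ} {f : Ω → DistrRd d} {m : ℝ} {D : Opens (EuclRd d)} {ac ar : 𝓓(D, ℂ)}

/-- The values of the field and their conjugates. -/
def IsFieldValue (f : Ω → DistrRd d) (A : Ω → ℂ) : Prop :=
  ∃ ψ : TestFn d, A = (fun ω => f ω ψ) ∨ A = fun ω => conj (f ω ψ)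

lemma IsFieldValue.conj {Ω' : Type*} {f : Ω' → DistrRd d} {A : Ω' → ℂ} (hA : IsFieldValue f A) :
    IsFieldValue f (fun ω => conj (A ω)) := by
  obtain ⟨ψ, rfl | rfl⟩ := hA
  · exact ⟨ψ, Or.inr rfl⟩
  · exact ⟨ψ, Or.inl (by simp)⟩

lemma IsCenteredGMIG.memLp_fieldValue (hf : IsCenteredGMIG P f m D ac ar) {A : Ω → ℂ}
    (hA : IsFieldValue f A) {p : ENNReal} (hp : p ≠ ⊤) : MemLp A p P := by
  obtain ⟨ψ, rfl | rfl⟩ := hA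
  · exact (hf.gaussian ψ).memLp hp
  · exact ((hf.gaussian ψ).memLp hp).star

/-- The imaginary part of `f ω ψ` is the real part of `f ω ((-i)ψ)`. Hence field values and their
conjugates are complex combinations of the single real-linear Gaussian family `ψ ↦ Re (f ω ψ)`. -/
lemma IsCenteredGMIG.wick (hf : IsCenteredGMIG P f m D ac ar) {A B C E : Ω → ℂ}
    (hA : IsFieldValue f A) (hB : IsFieldValue f B) (hC : IsFieldValue f C)
    (hE : IsFieldValue f E) : Wick P A B C E := by
  have hrep : ∀ {A : Ω → ℂ}, IsFieldValue f A → ∃ a a' : TestFn d,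
      A = fun ω => (((f ω a).re : ℝ) : ℂ) + I * (((f ω a').re : ℝ) : ℂ) := by
    rintro _ ⟨ψ, rfl | rfl⟩
    · refine ⟨ψ, (-I) • ψ, funext fun ω => ?_⟩
      rw [map_smul]
      apply Complex.ext <;> simp
    · refine ⟨ψ, I • ψ, funext fun ω => ?_⟩
      rw [map_smul]
      apply Complex.ext <;> simp
  refine wick_of_linear_complex (L := fun ψ ω => (f ω ψ).re) (fun a b ω => by simp)
    (fun a b ω => by simp) (fun a => (hf.gaussian a).map_fun Complex.reCLM) (fun a => ?_)
    (hrep hA) (hrep hB) (hrep hC) (hrep hE)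
  have h1 := hf.centered a
  rw [fieldMean] at h1
  have h2 := integral_re (𝕜 := ℂ) (hf.gaussian a).integrable
  simp only [RCLike.re_to_complex] at h2
  rw [h2, h1, Complex.zero_re]

end

noncomputable section

/-! ### Ergodicity of band averages -/

lemma measurable_of_forall_rat {Ω : Type*} [MeasurableSpace Ω] {X : ℝ → Ω → ℂ}
    (hc : ∀ ω, Continuous fun t => X t ω) (hq : ∀ q : ℚ, Measurable (X q)) (t : ℝ) :
    Measurable (X t) := by
  obtain ⟨s, hs⟩ : ∃ s : ℕ → ℚ, Tendsto (fun n => (s n : ℝ)) atTop (𝓝 t) := by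
    have h := Rat.denseRange_cast (𝕜 := ℝ)
    obtain ⟨u, hu, hut⟩ := mem_closure_iff_seq_limit.1 (h t)
    choose s hs using hu
    exact ⟨s, by simpa only [hs] using hut⟩
  refine measurable_of_tendsto_metrizable (fun n => hq (s n)) ?_
  rw [tendsto_pi_nhds]
  exact fun ω => ((hc ω).tendsto t).comp hs

/-- A process with continuous paths has a jointly measurable modification with continuous paths. -/
lemma exists_measurable_modification {Ω : Type*} [MeasurableSpace Ω] {P : Measure Ω}
    {X : ℝ → Ω → ℂ} (hc : ∀ ω, Continuous fun t => X t ω) (hm : ∀ t, AEMeasurable (X t) P) :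
    ∃ X' : ℝ → Ω → ℂ, Measurable (Function.uncurry X') ∧ (∀ ω, Continuous fun t => X' t ω) ∧
      ∀ᵐ ω ∂P, ∀ t, X t ω = X' t ω := by
  -- Measurable versions are needed only at rational times. On the exceptional null set the process
  -- is replaced by zero, which keeps paths continuous, so measurability passes to all times by
  -- limits.
  have hae : ∀ᵐ ω ∂P, ∀ q : ℚ, X q ω = (hm q).mk _ ω :=
    ae_all_iff.2 fun q => (hm q).ae_eq_mk
  obtain ⟨s, hs, hsm, hs0⟩ := exists_measurable_superset_of_null (ae_iff.1 hae)
  set X' : ℝ → Ω → ℂ := fun t => sᶜ.indicator (X t) with hX'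
  have hc' : ∀ ω, Continuous fun t => X' t ω := fun ω => by
    by_cases hω : ω ∈ s
    · simpa [hX', hω] using continuous_const
    · simpa [hX', hω] using hc ω
  have hm' : ∀ t, Measurable (X' t) := by
    refine measurable_of_forall_rat hc' fun q => ?_
    have : X' q = sᶜ.indicator ((hm q).mk _) := by
      ext ω
      by_cases hω : ω ∈ s
      · simp [hX', hω]
      · have h1 : ∀ q : ℚ, X q ω = (hm q).mk _ ω := by
          by_contra hcon
          exact hω (hs hcon)
        simp [hX', hω, h1 q]
    rw [this]
    exact (hm q).measurable_mk.indicator hsm.compl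
  refine ⟨X', measurable_uncurry_of_continuous_of_measurable hc' hm', hc', ?_⟩
  have : ∀ᵐ ω ∂P, ω ∉ s := measure_eq_zero_iff_ae_notMem.1 hs0
  filter_upwards [this] with ω hω t
  simp [hX', hω]

/-- Summability of the second moments makes the expectation of `∑ Xₙ²` finite, so this series
converges almost surely and its terms tend to zero. -/
lemma ae_tendsto_zero_of_integral_sq_le {Ω : Type*} [MeasurableSpace Ω] {P : Measure Ω}
    {X : ℕ → Ω → ℝ} (hX : ∀ n, Integrable (fun ω => X n ω ^ 2) P) {c : ℕ → ℝ} (hc : Summable c)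
    (h : ∀ n, ∫ ω, X n ω ^ 2 ∂P ≤ c n) : ∀ᵐ ω ∂P, Tendsto (fun n => X n ω) atTop (𝓝 0) := by
  have hc0 : ∀ n, 0 ≤ c n := fun n => (integral_nonneg fun ω => sq_nonneg _).trans (h n)
  have h1 : ∀ n, ∫⁻ ω, ENNReal.ofReal (X n ω ^ 2) ∂P ≤ ENNReal.ofReal (c n) := fun n => by
    rw [← ofReal_integral_eq_lintegral_ofReal (hX n) (ae_of_all _ fun ω => sq_nonneg _)]
    exact ENNReal.ofReal_le_ofReal (h n)
  have hm : ∀ n, AEMeasurable (fun ω => ENNReal.ofReal (X n ω ^ 2)) P := fun n =>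
    (hX n).aestronglyMeasurable.aemeasurable.ennreal_ofReal
  have h2 : ∫⁻ ω, ∑' n, ENNReal.ofReal (X n ω ^ 2) ∂P ≠ ⊤ := by
    rw [lintegral_tsum hm]
    refine ne_top_of_le_ne_top ?_ (ENNReal.tsum_le_tsum h1)
    rw [← ENNReal.ofReal_tsum_of_nonneg hc0 hc]
    exact ENNReal.ofReal_ne_top
  filter_upwards [ae_lt_top' (AEMeasurable.tsum hm) h2] with ω hω
  have h3 := ENNReal.tendsto_atTop_zero_of_tsum_ne_top hω.ne
  have h4 : Tendsto (fun n => X n ω ^ 2) atTop (𝓝 0) := by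
    have := (ENNReal.tendsto_toReal ENNReal.zero_ne_top).comp h3
    simpa [Function.comp_def, ENNReal.toReal_ofReal (sq_nonneg _)] using this
  have h5 := h4.sqrt
  rw [Real.sqrt_zero] at h5
  simp_rw [Real.sqrt_sq_eq_abs] at h5
  exact (tendsto_zero_iff_abs_tendsto_zero _).2 h5

section SecondMoment

variable {Ω : Type*} [MeasurableSpace Ω] {P : Measure Ω} [IsProbabilityMeasure P]
  {Y : ℝ → Ω → ℂ} {a b C : ℝ}

lemma integrable_uncurry_of_sq_le (hY : Measurable (Function.uncurry Y))
    (hL : ∀ t ∈ Set.Icc a b, MemLp (Y t) 2 P)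
    (hC : ∀ t ∈ Set.Icc a b, ∫ ω, ‖Y t ω‖ ^ 2 ∂P ≤ C) :
    Integrable (Function.uncurry Y) ((volume.restrict (Set.Icc a b)).prod P) := by
  rw [integrable_prod_iff hY.aestronglyMeasurable]
  constructor
  · exact (ae_restrict_iff' measurableSet_Icc).2 (ae_of_all _ fun t ht =>
      (hL t ht).integrable one_le_two)
  · refine Integrable.mono' (integrable_const (1 + C)) ?_ ?_
    · exact (hY.norm.stronglyMeasurable.integral_prod_right' (ν := P)).aestronglyMeasurable
    · refine (ae_restrict_iff' measurableSet_Icc).2 (ae_of_all _ fun t ht => ?_)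
      rw [Real.norm_of_nonneg (integral_nonneg fun _ => norm_nonneg _)]
      have h2 : Integrable (fun ω => ‖Y t ω‖ ^ 2) P := by
        simpa using (hL t ht).integrable_norm_pow (by norm_num)
      calc ∫ ω, ‖Y t ω‖ ∂P ≤ ∫ ω, (1 + ‖Y t ω‖ ^ 2) ∂P := by
            refine integral_mono ((hL t ht).integrable one_le_two).norm
              ((integrable_const _).add h2) fun ω => ?_
            change ‖Y t ω‖ ≤ 1 + ‖Y t ω‖ ^ 2
            nlinarith [sq_nonneg (‖Y t ω‖ - 1), norm_nonneg (Y t ω)]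
        _ = 1 + ∫ ω, ‖Y t ω‖ ^ 2 ∂P := by
            rw [integral_add (integrable_const _) h2]; simp
        _ ≤ 1 + C := by linarith [hC t ht]

/-- The second moment of an integral of a process. -/
lemma integral_sq_norm_integral_le (hY : Measurable (Function.uncurry Y))
    (hL : ∀ t ∈ Set.Icc a b, MemLp (Y t) 2 P)
    (hC : ∀ t ∈ Set.Icc a b, ∫ ω, ‖Y t ω‖ ^ 2 ∂P ≤ C) {k : ℝ × ℝ → ℝ}
    (hk : Integrable k ((volume.restrict (Set.Icc a b)).prod (volume.restrict (Set.Icc a b))))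
    (hYk : ∀ s ∈ Set.Icc a b, ∀ t ∈ Set.Icc a b, ‖∫ ω, Y s ω * conj (Y t ω) ∂P‖ ≤ k (s, t)) :
    Integrable (fun ω => ‖∫ t in Set.Icc a b, Y t ω‖ ^ 2) P ∧
    ∫ ω, ‖∫ t in Set.Icc a b, Y t ω‖ ^ 2 ∂P ≤
      ∫ q, k q ∂((volume.restrict (Set.Icc a b)).prod (volume.restrict (Set.Icc a b))) := by
  set μ : Measure ℝ := volume.restrict (Set.Icc a b) with hμ
  have hsq : ∀ t ∈ Set.Icc a b, Integrable (fun ω => ‖Y t ω‖ ^ 2) P := fun t ht => by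
    simpa using (hL t ht).integrable_norm_pow (by norm_num)
  set F : Ω × (ℝ × ℝ) → ℂ := fun q => Y q.2.1 q.1 * conj (Y q.2.2 q.1) with hF
  have hFm : Measurable F := by
    have h1 : Measurable fun q : Ω × (ℝ × ℝ) => Y q.2.1 q.1 :=
      hY.comp (g := Function.uncurry Y) (f := fun q : Ω × (ℝ × ℝ) => (q.2.1, q.1)) (by fun_prop)
    have h2 : Measurable fun q : Ω × (ℝ × ℝ) => Y q.2.2 q.1 :=
      hY.comp (g := Function.uncurry Y) (f := fun q : Ω × (ℝ × ℝ) => (q.2.2, q.1)) (by fun_prop)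
    exact h1.mul (Complex.continuous_conj.measurable.comp h2)
  have hmem : ∀ᵐ q ∂(μ.prod μ), q ∈ Set.Icc a b ×ˢ Set.Icc a b := by
    rw [hμ, Measure.prod_restrict]
    exact ae_restrict_mem (measurableSet_Icc.prod measurableSet_Icc)
  have hFi : Integrable F (P.prod (μ.prod μ)) := by
    rw [integrable_prod_iff' hFm.aestronglyMeasurable]
    constructor
    · filter_upwards [hmem] with q hq
      exact (hL _ hq.1).integrable_mul (hL _ hq.2).star
    · refine Integrable.mono' (integrable_const C) ?_ ?_
      · exact (hFm.norm.stronglyMeasurable.integral_prod_left' (μ := P)).aestronglyMeasurable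
      · filter_upwards [hmem] with q hq
        rw [Real.norm_of_nonneg (integral_nonneg fun _ => norm_nonneg _)]
        calc ∫ ω, ‖F (ω, q)‖ ∂P ≤ ∫ ω, (1 / 2 * ‖Y q.1 ω‖ ^ 2 + 1 / 2 * ‖Y q.2 ω‖ ^ 2) ∂P := by
              refine integral_mono ((hL _ hq.1).integrable_mul (hL _ hq.2).star).norm
                (((hsq _ hq.1).const_mul _).add ((hsq _ hq.2).const_mul _)) fun ω => ?_
              simp only [hF, norm_mul, RCLike.norm_conj]
              nlinarith [sq_nonneg (‖Y q.1 ω‖ - ‖Y q.2 ω‖)]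
          _ = 1 / 2 * ∫ ω, ‖Y q.1 ω‖ ^ 2 ∂P + 1 / 2 * ∫ ω, ‖Y q.2 ω‖ ^ 2 ∂P := by
              rw [integral_add ((hsq _ hq.1).const_mul _) ((hsq _ hq.2).const_mul _),
                integral_const_mul, integral_const_mul]
          _ ≤ C := by linarith [hC _ hq.1, hC _ hq.2]
  have hval : ∀ ω, ∫ q, F (ω, q) ∂(μ.prod μ) = ((‖∫ t, Y t ω ∂μ‖ ^ 2 : ℝ) : ℂ) := fun ω => by
    have h1 : ((‖∫ t, Y t ω ∂μ‖ ^ 2 : ℝ) : ℂ) = (∫ t, Y t ω ∂μ) * conj (∫ t, Y t ω ∂μ) := by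
      rw [Complex.mul_conj, Complex.normSq_eq_norm_sq]
    rw [h1, ← integral_conj, ← integral_prod_mul]
  have hi1 : Integrable (fun ω => ((‖∫ t, Y t ω ∂μ‖ ^ 2 : ℝ) : ℂ)) P := by
    have := hFi.integral_prod_left
    simpa only [hval] using this
  have hi2 : Integrable (fun ω => ‖∫ t, Y t ω ∂μ‖ ^ 2) P := by
    simpa only [RCLike.re_to_complex, Complex.ofReal_re] using hi1.re
  refine ⟨hi2, ?_⟩
  -- The squared integral is a double integral over two times; Fubini brings in the two-time
  -- covariance, which `k` dominates.
  have h2 : ((∫ ω, ‖∫ t, Y t ω ∂μ‖ ^ 2 ∂P : ℝ) : ℂ) = ∫ q, ∫ ω, F (ω, q) ∂P ∂(μ.prod μ) := by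
    rw [← integral_integral_swap (f := fun ω q => F (ω, q)) hFi, ← integral_complex_ofReal]
    simp_rw [hval]
  have h3 : ‖((∫ ω, ‖∫ t, Y t ω ∂μ‖ ^ 2 ∂P : ℝ) : ℂ)‖ ≤ ∫ q, k q ∂(μ.prod μ) := by
    rw [h2]
    refine norm_integral_le_of_norm_le hk ?_
    filter_upwards [hmem] with q hq using hYk _ hq.1 _ hq.2
  rw [Complex.norm_real] at h3
  exact (le_abs_self _).trans h3

end SecondMoment

/-- Any `x` lies between consecutive squares, so the average over `[1, x]` is controlled by the
value at the lower square and the absolute mass of one gap. A band average is the difference of two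
averages starting at 1. -/
lemma tendsto_integral_div_of_squares {y : ℝ → ℂ}
    (hy : ∀ b, IntegrableOn y (Set.Icc 1 b))
    (h1 : Tendsto (fun n : ℕ => ‖∫ t in Set.Icc 1 (((n : ℝ) + 1) ^ 2), y t‖ / ((n : ℝ) + 1) ^ 2)
      atTop (𝓝 0))
    (h2 : Tendsto (fun n : ℕ => (∫ t in Set.Icc (((n : ℝ) + 1) ^ 2) (((n : ℝ) + 2) ^ 2), ‖y t‖) /
      ((n : ℝ) + 1) ^ 2) atTop (𝓝 0)) :
    Tendsto (fun Q : ℝ => (1 / Q : ℂ) * ∫ t in Q..(2 * Q), y t) atTop (𝓝 0) := by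
  have hii : ∀ a b, 1 ≤ a → 1 ≤ b → IntervalIntegrable y volume a b := fun a b ha hb => by
    rw [intervalIntegrable_iff]
    refine (hy (max a b)).mono_set fun t ht => ?_
    rw [Set.uIoc, Set.mem_Ioc] at ht
    exact ⟨(le_min ha hb).trans ht.1.le, ht.2⟩
  set s : ℝ → ℂ := fun x => ∫ t in (1 : ℝ)..x, y t with hs
  have hsum := h1.add h2
  rw [add_zero] at hsum
  -- The shift by one makes `(N x + 1)² ≤ x ≤ (N x + 2)²`, matching the indexing of the hypotheses.
  set N : ℝ → ℕ := fun x => ⌊Real.sqrt x⌋₊ - 1 with hN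
  have hNt : Tendsto N atTop atTop :=
    (tendsto_sub_atTop_nat 1).comp (tendsto_nat_floor_atTop.comp Real.tendsto_sqrt_atTop)
  have hsx : Tendsto (fun x => ‖s x‖ / x) atTop (𝓝 0) := by
    refine squeeze_zero' ?_ ?_ (hsum.comp hNt)
    · filter_upwards [eventually_ge_atTop 1] with x hx
      positivity
    · filter_upwards [eventually_ge_atTop 1] with x hx
      have hsq : 1 ≤ Real.sqrt x := Real.one_le_sqrt.2 hx
      have hfl : 1 ≤ ⌊Real.sqrt x⌋₊ := Nat.one_le_floor_iff _ |>.2 hsq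
      have hNx : (N x : ℝ) + 1 = ⌊Real.sqrt x⌋₊ := by
        simp only [hN]; push_cast [hfl]; ring
      have hx0 : (0 : ℝ) ≤ x := by linarith
      have hlo : ((N x : ℝ) + 1) ^ 2 ≤ x := by
        rw [hNx]
        calc (⌊Real.sqrt x⌋₊ : ℝ) ^ 2 ≤ Real.sqrt x ^ 2 := by
              gcongr; exact Nat.floor_le (Real.sqrt_nonneg x)
          _ = x := Real.sq_sqrt hx0
      have hhi : x ≤ ((N x : ℝ) + 2) ^ 2 := by
        have : (N x : ℝ) + 2 = ⌊Real.sqrt x⌋₊ + 1 := by linarith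
        rw [this]
        calc x = Real.sqrt x ^ 2 := (Real.sq_sqrt hx0).symm
          _ ≤ _ := by gcongr; exact (Nat.lt_floor_add_one _).le
      have hn1 : (1 : ℝ) ≤ ((N x : ℝ) + 1) ^ 2 := by
        have : (0 : ℝ) ≤ N x := Nat.cast_nonneg _
        nlinarith
      rw [Function.comp_apply, ← add_div]
      refine div_le_div₀ (by positivity) ?_ (by linarith) hlo
      have e1 : s x = (∫ t in Set.Icc 1 (((N x : ℝ) + 1) ^ 2), y t) +
          ∫ t in (((N x : ℝ) + 1) ^ 2)..x, y t := by
        rw [integral_Icc_eq_integral_Ioc, ← intervalIntegral.integral_of_le hn1, hs,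
          intervalIntegral.integral_add_adjacent_intervals (hii _ _ le_rfl hn1) (hii _ _ hn1 hx)]
      rw [e1]
      refine (norm_add_le _ _).trans (add_le_add le_rfl ?_)
      rw [intervalIntegral.integral_of_le hlo]
      refine (norm_integral_le_integral_norm _).trans ?_
      refine setIntegral_mono_set ((hy (((N x : ℝ) + 2) ^ 2)).mono_set
        (Set.Icc_subset_Icc_left hn1)).norm (ae_of_all _ fun t => norm_nonneg _) ?_
      exact (Set.Ioc_subset_Icc_self.trans (Set.Icc_subset_Icc_right hhi)).eventuallyLE
  have h2x : Tendsto (fun Q : ℝ => 2 * (‖s (2 * Q)‖ / (2 * Q)) + ‖s Q‖ / Q) atTop (𝓝 0) := by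
    have := ((hsx.comp (tendsto_id.const_mul_atTop (by norm_num : (0 : ℝ) < 2))).const_mul 2).add hsx
    simpa using this
  rw [tendsto_zero_iff_norm_tendsto_zero]
  refine squeeze_zero' (Eventually.of_forall fun _ => norm_nonneg _) ?_ h2x
  filter_upwards [eventually_ge_atTop 1] with Q hQ
  have e : ∫ t in Q..(2 * Q), y t = s (2 * Q) - s Q := by
    rw [hs, eq_sub_iff_add_eq', intervalIntegral.integral_add_adjacent_intervals
      (hii _ _ le_rfl hQ) (hii _ _ hQ (by linarith))]
  have hQ0 : 0 < Q := by linarith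
  rw [e, norm_mul, norm_div, norm_one, Complex.norm_real, Real.norm_of_nonneg hQ0.le]
  calc 1 / Q * ‖s (2 * Q) - s Q‖ ≤ 1 / Q * (‖s (2 * Q)‖ + ‖s Q‖) := by
        gcongr; exact norm_sub_le _ _
    _ = 2 * (‖s (2 * Q)‖ / (2 * Q)) + ‖s Q‖ / Q := by field_simp

/-- The law of large numbers for band averages of a process with decaying correlations. -/
theorem ae_tendsto_bandAverage {Ω : Type*} [MeasurableSpace Ω] {P : Measure Ω}
    [IsProbabilityMeasure P] {Y : ℝ → Ω → ℂ} (hY : Measurable (Function.uncurry Y)) {C : ℝ}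
    (hC0 : 0 ≤ C) (hL : ∀ t, 1 ≤ t → MemLp (Y t) 2 P)
    (hcov : ∀ s t, 1 ≤ s → 1 ≤ t →
      ‖∫ ω, Y s ω * conj (Y t ω) ∂P‖ ≤ C * (1 + ‖s - t‖) ^ (-2 : ℝ)) :
    ∀ᵐ ω ∂P, (∀ b, IntegrableOn (fun t => Y t ω) (Set.Icc 1 b)) ∧
      Tendsto (fun Q : ℝ => (1 / Q : ℂ) * ∫ t in Q..(2 * Q), Y t ω) atTop (𝓝 0) := by
  have hsq : ∀ t, 1 ≤ t → Integrable (fun ω => ‖Y t ω‖ ^ 2) P := fun t ht => by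
    simpa using (hL t ht).integrable_norm_pow (by norm_num)
  have hC : ∀ t, 1 ≤ t → ∫ ω, ‖Y t ω‖ ^ 2 ∂P ≤ C := fun t ht => by
    have h1 := hcov t t ht ht
    have h2 : ∫ ω, Y t ω * conj (Y t ω) ∂P = ((∫ ω, ‖Y t ω‖ ^ 2 ∂P : ℝ) : ℂ) := by
      rw [← integral_complex_ofReal]
      congr 1; ext ω
      rw [Complex.mul_conj, Complex.normSq_eq_norm_sq]
    rw [h2, Complex.norm_real, sub_self, norm_zero, add_zero, Real.one_rpow, mul_one] at h1
    exact (le_abs_self _).trans h1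
  have hint : ∀ᵐ ω ∂P, ∀ b, IntegrableOn (fun t => Y t ω) (Set.Icc 1 b) := by
    have : ∀ᵐ ω ∂P, ∀ n : ℕ, IntegrableOn (fun t => Y t ω) (Set.Icc 1 (n : ℝ)) :=
      ae_all_iff.2 fun n => (integrable_uncurry_of_sq_le hY (fun t ht => hL t ht.1)
        (fun t ht => hC t ht.1)).prod_left_ae
    filter_upwards [this] with ω hω b
    obtain ⟨n, hn⟩ := exists_nat_ge b
    exact (hω n).mono_set (Set.Icc_subset_Icc_right hn)
  have hn1 : ∀ n : ℕ, (1 : ℝ) ≤ ((n : ℝ) + 1) ^ 2 := fun n => by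
    have : (0 : ℝ) ≤ n := Nat.cast_nonneg n
    nlinarith
  set c₀ : ℝ := ∫ t : ℝ, (1 + ‖t‖) ^ (-2 : ℝ) with hc₀
  have hker : Integrable fun t : ℝ => (1 + ‖t‖) ^ (-2 : ℝ) :=
    integrable_one_add_norm (by simp)
  have hc₀0 : 0 ≤ c₀ := integral_nonneg fun t => by positivity
  have hsummable : ∀ K : ℝ, Summable fun n : ℕ => K * (((n : ℝ) + 1) ^ 2)⁻¹ := fun K => by
    refine Summable.mul_left K ?_
    have := (summable_nat_add_iff 1).2 (Real.summable_nat_pow_inv.2 (by norm_num : 1 < 2))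
    simpa using this
  have hkc : Continuous fun q : ℝ × ℝ => C * (1 + ‖q.1 - q.2‖) ^ (-2 : ℝ) := by
    refine continuous_const.mul (Continuous.rpow_const (by fun_prop) fun q => Or.inl ?_)
    positivity
  have hA : ∀ᵐ ω ∂P, Tendsto (fun n : ℕ =>
      ‖∫ t in Set.Icc 1 (((n : ℝ) + 1) ^ 2), Y t ω‖ / ((n : ℝ) + 1) ^ 2) atTop (𝓝 0) := by
    have hk : ∀ n : ℕ, Integrable (fun q : ℝ × ℝ => C * (1 + ‖q.1 - q.2‖) ^ (-2 : ℝ))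
        ((volume.restrict (Set.Icc 1 (((n : ℝ) + 1) ^ 2))).prod
          (volume.restrict (Set.Icc 1 (((n : ℝ) + 1) ^ 2)))) := fun n => by
      rw [Measure.prod_restrict]
      exact hkc.continuousOn.integrableOn_compact (isCompact_Icc.prod isCompact_Icc)
    have hmain := fun n : ℕ => integral_sq_norm_integral_le (a := 1) (b := ((n : ℝ) + 1) ^ 2) hY
      (fun t ht => hL t ht.1) (fun t ht => hC t ht.1) (hk n)
      (fun s hs t ht => hcov s t hs.1 ht.1)
    refine ae_tendsto_zero_of_integral_sq_le (c := fun n => C * c₀ * (((n : ℝ) + 1) ^ 2)⁻¹)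
      (fun n => ?_) (hsummable _) fun n => ?_
    · simp_rw [div_pow]
      exact (hmain n).1.div_const _
    · simp_rw [div_pow]
      rw [integral_div]
      -- Integrability of the kernel in `s - t` makes the double integral linear in the length
      -- `(n+1)²` of the interval. Division by the square of the length leaves the summable
      -- `(n+1)^{-2}`.
      have hle : ∫ q, C * (1 + ‖q.1 - q.2‖) ^ (-2 : ℝ)
          ∂((volume.restrict (Set.Icc 1 (((n : ℝ) + 1) ^ 2))).prod
          (volume.restrict (Set.Icc 1 (((n : ℝ) + 1) ^ 2)))) ≤ C * c₀ * ((n : ℝ) + 1) ^ 2 := by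
        rw [integral_prod _ (hk n)]
        calc _ ≤ ∫ _s in Set.Icc 1 (((n : ℝ) + 1) ^ 2), C * c₀ := by
              refine setIntegral_mono (hk n).integral_prod_left (integrable_const _) fun s => ?_
              rw [integral_const_mul]
              refine mul_le_mul_of_nonneg_left ?_ hC0
              have h3 := integral_sub_left_eq_self (fun t : ℝ => (1 + ‖t‖) ^ (-2 : ℝ)) volume s
              rw [hc₀, ← h3]
              exact setIntegral_le_integral (hker.comp_sub_left s)
                (ae_of_all _ fun t => by positivity)
          _ ≤ C * c₀ * ((n : ℝ) + 1) ^ 2 := by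
              rw [setIntegral_const, smul_eq_mul, mul_comm, Measure.real, Real.volume_Icc,
                ENNReal.toReal_ofReal (by linarith [hn1 n])]
              have : 0 ≤ C * c₀ := by positivity
              nlinarith
      rw [div_le_iff₀ (by positivity)]
      refine ((hmain n).2.trans hle).trans (le_of_eq ?_)
      field_simp
  -- In the gaps only the constant bound on second moments is used, applied to `‖Y‖` as a process. A
  -- gap has length at most `3(n+1)`, so the normalized second moment is at most `9C(n+1)^{-2}`.
  have hB : ∀ᵐ ω ∂P, Tendsto (fun n : ℕ =>
      ‖∫ t in Set.Icc (((n : ℝ) + 1) ^ 2) (((n : ℝ) + 2) ^ 2), ((‖Y t ω‖ : ℝ) : ℂ)‖ /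
        ((n : ℝ) + 1) ^ 2) atTop (𝓝 0) := by
    have hYn : Measurable (Function.uncurry fun t ω => ((‖Y t ω‖ : ℝ) : ℂ)) :=
      Complex.measurable_ofReal.comp hY.norm
    have hmain := fun n : ℕ => integral_sq_norm_integral_le (P := P) (a := ((n : ℝ) + 1) ^ 2)
      (b := ((n : ℝ) + 2) ^ 2) hYn (k := fun _ => C) (C := C)
      (fun t ht => ((hL t ((hn1 n).trans ht.1)).norm).ofReal)
      (fun t ht => by simpa using hC t ((hn1 n).trans ht.1)) (integrable_const C)
      (fun s hs t ht => by
        have hs' := (hn1 n).trans hs.1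
        have ht' := (hn1 n).trans ht.1
        refine (norm_integral_le_integral_norm _).trans ?_
        calc _ ≤ ∫ ω, (1 / 2 * ‖Y s ω‖ ^ 2 + 1 / 2 * ‖Y t ω‖ ^ 2) ∂P := by
              refine integral_mono_of_nonneg (ae_of_all _ fun _ => norm_nonneg _)
                (((hsq s hs').const_mul _).add ((hsq t ht').const_mul _)) (ae_of_all _ fun ω => ?_)
              simp only [norm_mul, Complex.norm_real, norm_norm, RCLike.norm_conj]
              nlinarith [sq_nonneg (‖Y s ω‖ - ‖Y t ω‖)]
          _ = 1 / 2 * ∫ ω, ‖Y s ω‖ ^ 2 ∂P + 1 / 2 * ∫ ω, ‖Y t ω‖ ^ 2 ∂P := by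
              rw [integral_add ((hsq s hs').const_mul _) ((hsq t ht').const_mul _),
                integral_const_mul, integral_const_mul]
          _ ≤ C := by linarith [hC s hs', hC t ht'])
    refine ae_tendsto_zero_of_integral_sq_le (c := fun n => C * 9 * (((n : ℝ) + 1) ^ 2)⁻¹)
      (fun n => ?_) (hsummable _) fun n => ?_
    · simp_rw [div_pow]
      exact (hmain n).1.div_const _
    · simp_rw [div_pow]
      rw [integral_div, div_le_iff₀ (by positivity)]
      refine (hmain n).2.trans ?_
      have hn0 : (0 : ℝ) ≤ n := Nat.cast_nonneg n
      rw [integral_const, smul_eq_mul, ← Set.univ_prod_univ, measureReal_prod_prod,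
        measureReal_restrict_apply MeasurableSet.univ, Set.univ_inter, Measure.real,
        Real.volume_Icc, ENNReal.toReal_ofReal (by nlinarith)]
      have h9 : ((n : ℝ) + 2) ^ 2 - ((n : ℝ) + 1) ^ 2 ≤ 3 * ((n : ℝ) + 1) := by nlinarith
      have h8 : 0 ≤ ((n : ℝ) + 2) ^ 2 - ((n : ℝ) + 1) ^ 2 := by nlinarith
      have h7 : C * 9 * (((n : ℝ) + 1) ^ 2)⁻¹ * (((n : ℝ) + 1) ^ 2) ^ 2 =
          (3 * ((n : ℝ) + 1)) * (3 * ((n : ℝ) + 1)) * C := by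
        field_simp; ring
      rw [h7]
      exact mul_le_mul_of_nonneg_right (mul_le_mul h9 h9 h8 (h8.trans h9)) hC0
  filter_upwards [hint, hA, hB] with ω h1 h2 h3
  refine ⟨h1, tendsto_integral_div_of_squares h1 h2 (h3.congr fun n => ?_)⟩
  rw [integral_complex_ofReal, Complex.norm_real, Real.norm_of_nonneg
    (integral_nonneg fun _ => norm_nonneg _)]

end

noncomputable section

variable {d : ℕ}

/-! ### Fourier transforms of test functions -/

lemma fourierHat_eq (χ : EuclRd d → ℂ) (ξ : EuclRd d) :
    fourierHat χ ξ = ∫ x, planeWave ξ x * χ x := rfl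

lemma fourierHat_waveTest (η ξ : EuclRd d) (χ : TestFn d) :
    fourierHat (waveTest η χ) ξ = fourierHat χ (ξ + η) := by
  rw [fourierHat_eq, fourierHat_eq]
  congr 1
  ext x
  rw [waveTest_apply, planeWave_add]
  ring

/-- A test function as a Schwartz function. -/
def TestFn.toSchwartz (χ : TestFn d) : SchwartzMap (EuclRd d) ℂ :=
  χ.hasCompactSupport.toSchwartzMap χ.contDiff

lemma TestFn.toSchwartz_coe (χ : TestFn d) : (TestFn.toSchwartz χ : EuclRd d → ℂ) = χ := rfl

lemma fourierHat_eq_fourier (χ : TestFn d) (ξ : EuclRd d) :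
    fourierHat χ ξ = FourierTransform.fourier (χ : EuclRd d → ℂ) ((2 * Real.pi)⁻¹ • ξ) := by
  rw [Real.fourier_eq', fourierHat]
  congr 1
  ext x
  rw [smul_eq_mul, inner_smul_right]
  congr 2
  have : (Real.pi : ℂ) ≠ 0 := by exact_mod_cast Real.pi_ne_zero
  push_cast
  field_simp

lemma fourierHat_eq_schwartz (χ : TestFn d) (ξ : EuclRd d) :
    fourierHat χ ξ = FourierTransform.fourier (TestFn.toSchwartz χ) ((2 * Real.pi)⁻¹ • ξ) := by
  rw [fourierHat_eq_fourier, SchwartzMap.fourier_coe]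
  rfl

lemma continuous_fourierHat (χ : TestFn d) : Continuous (fourierHat (χ : EuclRd d → ℂ)) := by
  simp_rw [funext fun ξ => fourierHat_eq_schwartz χ ξ]
  exact (SchwartzMap.continuous _).comp (continuous_const_smul _)

lemma exists_norm_fourierHat_le (χ : TestFn d) (k : ℕ) :
    ∃ C, 0 ≤ C ∧ ∀ ξ, ‖fourierHat χ ξ‖ ≤ C * (1 + ‖ξ‖) ^ (-(k : ℝ)) := by
  obtain ⟨C₁, h1, hC₁⟩ := (FourierTransform.fourier (TestFn.toSchwartz χ)).decay k 0
  obtain ⟨C₂, h2, hC₂⟩ := (FourierTransform.fourier (TestFn.toSchwartz χ)).decay 0 0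
  have hpi : 0 < (2 * Real.pi) := by positivity
  refine ⟨2 ^ k * (C₂ + (2 * Real.pi) ^ k * C₁), by positivity, fun ξ => ?_⟩
  have e1 := hC₁ ((2 * Real.pi)⁻¹ • ξ)
  have e2 := hC₂ ((2 * Real.pi)⁻¹ • ξ)
  rw [norm_iteratedFDeriv_zero, ← fourierHat_eq_schwartz] at e1 e2
  rw [pow_zero, one_mul] at e2
  rw [norm_smul, norm_inv, Real.norm_of_nonneg hpi.le, mul_pow, inv_pow, mul_assoc,
    inv_mul_le_iff₀ (by positivity)] at e1
  rw [Real.rpow_neg (by positivity), Real.rpow_natCast, ← div_eq_mul_inv,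
    le_div_iff₀ (by positivity)]
  have e3 : (1 + ‖ξ‖) ^ k ≤ 2 ^ k * (1 + ‖ξ‖ ^ k) := by
    have h := norm_nonneg ξ
    rcases le_total ‖ξ‖ 1 with hx | hx
    · calc (1 + ‖ξ‖) ^ k ≤ 2 ^ k := by gcongr; linarith
        _ ≤ 2 ^ k * (1 + ‖ξ‖ ^ k) := by
          have : 0 ≤ ‖ξ‖ ^ k := by positivity
          nlinarith [pow_pos (two_pos : (0 : ℝ) < 2) k]
    · calc (1 + ‖ξ‖) ^ k ≤ (2 * ‖ξ‖) ^ k := by gcongr; linarith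
        _ = 2 ^ k * ‖ξ‖ ^ k := mul_pow _ _ _
        _ ≤ 2 ^ k * (1 + ‖ξ‖ ^ k) := by gcongr; linarith
  calc ‖fourierHat χ ξ‖ * (1 + ‖ξ‖) ^ k ≤ ‖fourierHat χ ξ‖ * (2 ^ k * (1 + ‖ξ‖ ^ k)) := by gcongr
    _ = 2 ^ k * (‖fourierHat χ ξ‖ + ‖ξ‖ ^ k * ‖fourierHat χ ξ‖) := by ring
    _ ≤ _ := by gcongr

lemma integrable_rpow_mul_fourierHat (χ : TestFn d) (p : ℝ) :
    Integrable fun ζ : EuclRd d => (1 + ‖ζ‖) ^ p * ‖fourierHat χ ζ‖ := by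
  obtain ⟨k, hk⟩ := exists_nat_gt (p + d)
  obtain ⟨C, hC0, hC⟩ := exists_norm_fourierHat_le χ k
  have hint : Integrable fun ζ : EuclRd d => C * (1 + ‖ζ‖) ^ (-((k : ℝ) - p)) :=
    (integrable_one_add_norm (by rw [finrank_euclideanSpace_fin]; linarith)).const_mul C
  have hc : Continuous fun ζ : EuclRd d => (1 + ‖ζ‖) ^ p * ‖fourierHat χ ζ‖ := by
    refine Continuous.mul (Continuous.rpow_const (by fun_prop) fun ζ => Or.inl ?_)
      (continuous_fourierHat χ).norm
    positivity
  refine hint.mono' hc.aestronglyMeasurable (ae_of_all _ fun ζ => ?_)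
  rw [Real.norm_of_nonneg (by positivity)]
  calc _ ≤ (1 + ‖ζ‖) ^ p * (C * (1 + ‖ζ‖) ^ (-(k : ℝ))) := by gcongr; exact hC ζ
    _ = C * ((1 + ‖ζ‖) ^ p * (1 + ‖ζ‖) ^ (-(k : ℝ))) := by ring
    _ = _ := by
      rw [← Real.rpow_add (by positivity)]
      congr 2; ring

lemma integrable_fourierHat (χ : TestFn d) : Integrable (fourierHat (χ : EuclRd d → ℂ)) := by
  refine (integrable_norm_iff (continuous_fourierHat χ).aestronglyMeasurable).1 ?_
  simpa using integrable_rpow_mul_fourierHat χ 0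

/-- Fourier inversion for test functions. -/
lemma fourierHat_inversion (χ : TestFn d) (x : EuclRd d) :
    (1 / ((2 * Real.pi) ^ d : ℝ) : ℂ) * ∫ ζ, planeWave (-ζ) x * fourierHat χ ζ = χ x := by
  have hi : Integrable (χ : EuclRd d → ℂ) :=
    χ.continuous.integrable_of_hasCompactSupport χ.hasCompactSupport
  have hF : Integrable (FourierTransform.fourier (χ : EuclRd d → ℂ)) := by
    have := (FourierTransform.fourier (TestFn.toSchwartz χ)).integrable (μ := volume)
    rwa [SchwartzMap.fourier_coe, TestFn.toSchwartz_coe] at this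
  have h := hi.fourierInv_fourier_eq hF (v := x) χ.continuous.continuousAt
  rw [Real.fourierInv_eq'] at h
  have h2 := Measure.integral_comp_smul (volume : Measure (EuclRd d))
    (fun ζ => planeWave (-ζ) x * fourierHat χ ζ) (2 * Real.pi)
  rw [finrank_euclideanSpace_fin, abs_of_nonneg (by positivity), Complex.real_smul] at h2
  have h3 : (1 / ((2 * Real.pi) ^ d : ℝ) : ℂ) = ((((2 * Real.pi) ^ d)⁻¹ : ℝ) : ℂ) := by
    push_cast; rw [one_div]
  rw [h3, ← h2, ← h]
  congr 1
  ext v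
  rw [fourierHat_eq_fourier, smul_smul, inv_mul_cancel₀ (by positivity), one_smul, smul_eq_mul,
    planeWave, inner_neg_right, inner_smul_right, real_inner_comm]
  congr 2
  push_cast
  ring

/-! ### Oscillatory bilinear forms of pseudo-differential operators -/

/-- Peetre's inequality: a shift by `a` changes a power weight by at most `(1+‖a‖)^{|p|}`. For
negative `p` the roles of `b` and `a + b` are exchanged. -/
lemma one_add_norm_add_rpow_le {E : Type*} [SeminormedAddCommGroup E] (a b : E) (p : ℝ) :
    (1 + ‖a + b‖) ^ p ≤ (1 + ‖b‖) ^ p * (1 + ‖a‖) ^ |p| := by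
  have h1 : 1 + ‖a + b‖ ≤ (1 + ‖b‖) * (1 + ‖a‖) := by
    nlinarith [norm_add_le a b, norm_nonneg a, norm_nonneg b]
  have h2 : 1 + ‖b‖ ≤ (1 + ‖a + b‖) * (1 + ‖a‖) := by
    have : ‖b‖ ≤ ‖a + b‖ + ‖a‖ := by
      calc ‖b‖ = ‖(a + b) - a‖ := by rw [add_sub_cancel_left]
        _ ≤ _ := norm_sub_le _ _
    nlinarith [norm_nonneg a, norm_nonneg (a + b)]
  rcases le_total 0 p with hp | hp
  · rw [abs_of_nonneg hp, ← Real.mul_rpow (by positivity) (by positivity)]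
    exact Real.rpow_le_rpow (by positivity) h1 hp
  · rw [abs_of_nonpos hp]
    have h3 := Real.rpow_le_rpow_of_nonpos (by positivity) h2 hp
    rw [Real.mul_rpow (by positivity) (by positivity)] at h3
    have h4 : (1 + ‖a‖) ^ p * (1 + ‖a‖) ^ (-p) = 1 := by
      rw [← Real.rpow_add (by positivity)]; simp
    calc (1 + ‖a + b‖) ^ p = ((1 + ‖a + b‖) ^ p * (1 + ‖a‖) ^ p) * (1 + ‖a‖) ^ (-p) := by
          rw [mul_assoc, h4, mul_one]
      _ ≤ _ := by gcongr

/-- One integration by parts in the direction `η` gains `1/‖η‖`, and the trivial bound covers small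
`η`. One power is enough here, since covariances of products contain two such factors. -/
lemma norm_integral_planeWave_mul_le {g : EuclRd d → ℂ} (hg : ContDiff ℝ 1 g) {K : Set (EuclRd d)}
    (hK : IsCompact K) (hs : ∀ x ∉ K, g x = 0) {M : ℝ} (h0 : ∀ x, ‖g x‖ ≤ M)
    (h1 : ∀ x, ‖fderiv ℝ g x‖ ≤ M) (η : EuclRd d) :
    ‖∫ x, planeWave (-η) x * g x‖ ≤ 2 * M * volume.real K * (1 + ‖η‖) ^ (-1 : ℝ) := by
  have hM : 0 ≤ M := (norm_nonneg _).trans (h0 0)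
  have hgs : HasCompactSupport g := HasCompactSupport.intro hK fun x hx => hs x hx
  have hts : ∀ x ∉ K, x ∉ tsupport g := fun x hx h =>
    hx (closure_minimal (fun y hy => by by_contra hc; exact hy (hs y hc)) hK.isClosed h)
  have hfs : ∀ x ∉ K, fderiv ℝ g x = 0 := fun x hx =>
    image_eq_zero_of_notMem_tsupport fun h => hts x hx (tsupport_fderiv_subset ℝ h)
  have hb : ∀ {F : EuclRd d → ℂ} {c : ℝ}, (∀ x ∉ K, F x = 0) → (∀ x, ‖F x‖ ≤ c) →
      ‖∫ x, F x‖ ≤ c * volume.real K := fun {F c} hF hc => by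
    rw [← setIntegral_eq_integral_of_forall_compl_eq_zero hF]
    exact norm_setIntegral_le_of_norm_le_const hK.measure_lt_top fun x _ => hc x
  have e1 : ‖∫ x, planeWave (-η) x * g x‖ ≤ M * volume.real K :=
    hb (fun x hx => by rw [hs x hx, mul_zero]) fun x => by
      rw [norm_mul, norm_planeWave, one_mul]; exact h0 x
  have hpc := contDiff_planeWave (-η)
  have hdg : Differentiable ℝ g := hg.differentiable one_ne_zero
  have hgd : Continuous fun x => fderiv ℝ g x η :=
    (hg.continuous_fderiv one_ne_zero).clm_apply continuous_const
  have e2 : ∫ x, g x * fderiv ℝ (planeWave (-η)) x η = -∫ x, fderiv ℝ g x η * planeWave (-η) x := by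
    refine integral_mul_fderiv_eq_neg_fderiv_mul_of_integrable ?_ ?_ ?_
      (fun x _ => hdg x) (fun x _ => (hpc.differentiable (by simp)) x)
    · exact (hgd.mul hpc.continuous).integrable_of_hasCompactSupport
        (HasCompactSupport.intro hK fun x hx => by simp [hfs x hx])
    · refine Continuous.integrable_of_hasCompactSupport (hg.continuous.mul
        ((hpc.continuous_fderiv (by simp)).clm_apply continuous_const)) hgs.mul_right
    · exact (hg.continuous.mul hpc.continuous).integrable_of_hasCompactSupport hgs.mul_right
  have e3 : ∫ x, g x * fderiv ℝ (planeWave (-η)) x η =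
      (I * ((‖η‖ ^ 2 : ℝ) : ℂ)) * ∫ x, planeWave (-η) x * g x := by
    rw [← integral_const_mul]
    congr 1; ext x
    rw [hasFDerivAt_planeWave, inner_neg_right, real_inner_self_eq_norm_sq]
    push_cast; ring
  have e4 : ‖η‖ ^ 2 * ‖∫ x, planeWave (-η) x * g x‖ ≤ (M * ‖η‖) * volume.real K := by
    have : ‖(I * ((‖η‖ ^ 2 : ℝ) : ℂ)) * ∫ x, planeWave (-η) x * g x‖ ≤
        (M * ‖η‖) * volume.real K := by
      rw [← e3, e2, norm_neg]
      refine hb (fun x hx => by simp [hfs x hx]) fun x => ?_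
      rw [norm_mul, norm_planeWave, mul_one]
      exact (ContinuousLinearMap.le_opNorm _ _).trans (by gcongr; exact h1 x)
    rwa [norm_mul, norm_mul, norm_I, one_mul, Complex.norm_real,
      Real.norm_of_nonneg (by positivity)] at this
  have e5 : ‖η‖ * ‖∫ x, planeWave (-η) x * g x‖ ≤ M * volume.real K := by
    rcases eq_or_lt_of_le (norm_nonneg η) with h | h
    · rw [← h, zero_mul]; positivity
    · refine le_of_mul_le_mul_left ?_ h
      calc _ = ‖η‖ ^ 2 * ‖∫ x, planeWave (-η) x * g x‖ := by ring
        _ ≤ _ := e4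
        _ = _ := by ring
  rw [Real.rpow_neg_one, ← div_eq_mul_inv, le_div_iff₀ (by positivity)]
  linarith

end

/-! ### Bilinear forms of symbols on modulated cutoffs: decay and principal term. -/

noncomputable section

variable {d : ℕ}

lemma IsSymbol.exists_norm_le {s : ℝ} {σ : EuclRd d → EuclRd d → ℂ} (h : IsSymbol s σ) :
    ∃ C, 0 ≤ C ∧ ∀ x ξ, ‖σ x ξ‖ ≤ C * (1 + ‖ξ‖) ^ s := by
  obtain ⟨C, hC⟩ := h.2 0 0
  refine ⟨|C|, abs_nonneg C, fun x ξ => ?_⟩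
  have := hC x ξ
  rw [norm_iteratedFDeriv_zero, norm_iteratedFDeriv_zero, Nat.cast_zero, sub_zero] at this
  exact this.trans (by gcongr; exact le_abs_self C)

lemma IsSymbol.exists_norm_fderiv_le {s : ℝ} {σ : EuclRd d → EuclRd d → ℂ} (h : IsSymbol s σ) :
    ∃ C, 0 ≤ C ∧ ∀ x ξ, ‖fderiv ℝ (fun x => σ x ξ) x‖ ≤ C * (1 + ‖ξ‖) ^ s := by
  obtain ⟨C, hC⟩ := h.2 0 1
  refine ⟨|C|, abs_nonneg C, fun x ξ => ?_⟩
  have := hC x ξ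
  rw [norm_iteratedFDeriv_zero, norm_iteratedFDeriv_one, Nat.cast_zero, sub_zero] at this
  exact this.trans (by gcongr; exact le_abs_self C)

lemma IsSymbol.contDiff_left {s : ℝ} {σ : EuclRd d → EuclRd d → ℂ} (h : IsSymbol s σ)
    (ξ : EuclRd d) : ContDiff ℝ (⊤ : ℕ∞) (fun x => σ x ξ) :=
  h.1.comp (contDiff_id.prodMk contDiff_const)

/-- The bilinear form of a pseudo-differential operator on modulations of a cutoff. -/
def oscForm (σ : EuclRd d → EuclRd d → ℂ) (χ : TestFn d) (θ : EuclRd d) (l μ : ℝ) : ℂ :=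
  ∫ x, pseudoDiff σ (waveTest ((-l) • θ) χ) x * waveTest ((-μ) • θ) χ x

/-- The integrand of the bilinear form. -/
def oscIntegrand (σ : EuclRd d → EuclRd d → ℂ) (χ : TestFn d) (θ : EuclRd d) (l s : ℝ)
    (q : EuclRd d × EuclRd d) : ℂ :=
  planeWave (-(q.2 + s • θ)) q.1 * (σ q.1 (q.2 + l • θ) * χ q.1) * fourierHat χ q.2

variable {s : ℝ} {σ : EuclRd d → EuclRd d → ℂ} {χ : TestFn d} {θ : EuclRd d}

lemma continuous_oscIntegrand (hσ : IsSymbol s σ) (l r : ℝ) :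
    Continuous (oscIntegrand σ χ θ l r) := by
  have h1 : Continuous fun q : EuclRd d × EuclRd d => σ q.1 (q.2 + l • θ) :=
    hσ.1.continuous.comp (f := fun q : EuclRd d × EuclRd d => (q.1, q.2 + l • θ)) (by fun_prop)
  have h2 : Continuous fun q : EuclRd d × EuclRd d => planeWave (-(q.2 + r • θ)) q.1 :=
    contDiff_planeWave_uncurry.continuous.comp
      (f := fun q : EuclRd d × EuclRd d => (-(q.2 + r • θ), q.1)) (by fun_prop)
  exact (h2.mul (h1.mul (χ.continuous.comp continuous_fst))).mul
    ((continuous_fourierHat χ).comp continuous_snd)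

lemma norm_oscIntegrand_le (hθ : ‖θ‖ = 1) {C : ℝ} (hC0 : 0 ≤ C)
    (hC : ∀ x ξ, ‖σ x ξ‖ ≤ C * (1 + ‖ξ‖) ^ s) (l r : ℝ) (q : EuclRd d × EuclRd d) :
    ‖oscIntegrand σ χ θ l r q‖ ≤
      (C * (1 + |l|) ^ s * ‖χ q.1‖) * ((1 + ‖q.2‖) ^ |s| * ‖fourierHat χ q.2‖) := by
  have h := one_add_norm_add_rpow_le q.2 (l • θ) s
  rw [norm_smul, hθ, mul_one, Real.norm_eq_abs] at h
  rw [oscIntegrand, norm_mul, norm_mul, norm_planeWave, one_mul, norm_mul]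
  calc _ ≤ C * ((1 + |l|) ^ s * (1 + ‖q.2‖) ^ |s|) * ‖χ q.1‖ * ‖fourierHat χ q.2‖ := by
        gcongr
        exact (hC _ _).trans (by gcongr)
    _ = _ := by ring

lemma integrable_testFn (χ : TestFn d) : Integrable (χ : EuclRd d → ℂ) :=
  χ.continuous.integrable_of_hasCompactSupport χ.hasCompactSupport

lemma integrable_oscIntegrand (hσ : IsSymbol s σ) (hθ : ‖θ‖ = 1) (l r : ℝ) :
    Integrable (oscIntegrand σ χ θ l r) := by
  obtain ⟨C, hC0, hC⟩ := hσ.exists_norm_le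
  refine Integrable.mono' (((integrable_testFn χ).norm.const_mul (C * (1 + |l|) ^ s)).mul_prod
    (integrable_rpow_mul_fourierHat χ |s|)) (continuous_oscIntegrand hσ l r).aestronglyMeasurable
    (ae_of_all _ fun q => ?_)
  exact norm_oscIntegrand_le hθ hC0 hC l r q

/-- The shift `ξ = ζ + lθ` centres the Fourier transform of the modulated cutoff at the origin. The
large frequency then sits only in the symbol, and the phase sees `l` and `μ` only through `l + μ`.
-/
lemma oscForm_eq (hσ : IsSymbol s σ) (hθ : ‖θ‖ = 1) (l μ : ℝ) :
    oscForm σ χ θ l μ = (1 / ((2 * Real.pi) ^ d : ℝ) : ℂ) *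
      ∫ q, oscIntegrand σ χ θ l (l + μ) q := by
  have hprod := integral_prod _ (integrable_oscIntegrand (χ := χ) hσ hθ l (l + μ))
  rw [← Measure.volume_eq_prod] at hprod
  rw [hprod, oscForm, ← integral_const_mul]
  congr 1
  ext x
  rw [pseudoDiff, mul_assoc]
  congr 1
  rw [← integral_add_right_eq_self _ (l • θ), ← integral_mul_const]
  congr 1
  ext ζ
  rw [fourierHat_waveTest, waveTest_apply, neg_smul, add_neg_cancel_right]
  have e1 : cexp (I * (inner ℝ x (ζ + l • θ) : ℝ)) = planeWave (-(ζ + l • θ)) x := by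
    rw [planeWave, inner_neg_right]
    congr 1; push_cast; ring
  have e2 : planeWave (-(ζ + (l + μ) • θ)) x =
      planeWave (-(ζ + l • θ)) x * planeWave ((-μ) • θ) x := by
    rw [← planeWave_add]
    congr 1
    module
  rw [oscIntegrand, e1, e2]
  ring

/-- An `x`-derivative does not change the order of a symbol, so the product with the cutoff is
bounded in `C¹` by `(1+|ξ|)^s` and one integration by parts applies uniformly in `ξ`. -/
lemma IsSymbol.exists_norm_integral_planeWave_le (hσ : IsSymbol s σ) (χ : TestFn d) :
    ∃ A, 0 ≤ A ∧ ∀ ξ η, ‖∫ x, planeWave (-η) x * (σ x ξ * χ x)‖ ≤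
      A * (1 + ‖ξ‖) ^ s * (1 + ‖η‖) ^ (-1 : ℝ) := by
  obtain ⟨C₀, hC₀0, hC₀⟩ := hσ.exists_norm_le
  obtain ⟨C₁, hC₁0, hC₁⟩ := hσ.exists_norm_fderiv_le
  obtain ⟨X₀, hX₀⟩ := χ.hasCompactSupport.exists_bound_of_continuous χ.continuous
  obtain ⟨X₁, hX₁⟩ := (χ.hasCompactSupport.fderiv ℝ).exists_bound_of_continuous
    (χ.contDiff.continuous_fderiv (by simp))
  have hX₀0 : 0 ≤ X₀ := (norm_nonneg _).trans (hX₀ 0)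
  have hX₁0 : 0 ≤ X₁ := (norm_nonneg _).trans (hX₁ 0)
  obtain ⟨A, hA⟩ : ∃ A, A = C₀ * X₀ + (C₀ * X₁ + X₀ * C₁) := ⟨_, rfl⟩
  have hA₁ : C₀ * X₀ ≤ A := by
    have : 0 ≤ C₀ * X₁ + X₀ * C₁ := by positivity
    linarith
  have hA₂ : C₀ * X₁ + X₀ * C₁ ≤ A := by
    have : 0 ≤ C₀ * X₀ := by positivity
    linarith
  have hA0 : 0 ≤ A := le_trans (by positivity) hA₁
  refine ⟨2 * A * volume.real (tsupport χ), by positivity, fun ξ η => ?_⟩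
  have hw : 0 ≤ (1 + ‖ξ‖) ^ s := by positivity
  have hg : ContDiff ℝ 1 fun x => σ x ξ * χ x :=
    ((hσ.contDiff_left ξ).mul χ.contDiff).of_le (by exact_mod_cast le_top)
  have h0 : ∀ x, ‖σ x ξ * χ x‖ ≤ A * (1 + ‖ξ‖) ^ s := fun x => by
    rw [norm_mul]
    calc ‖σ x ξ‖ * ‖χ x‖ ≤ C₀ * (1 + ‖ξ‖) ^ s * X₀ :=
          mul_le_mul (hC₀ x ξ) (hX₀ x) (norm_nonneg _) (by positivity)
      _ = C₀ * X₀ * (1 + ‖ξ‖) ^ s := by ring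
      _ ≤ A * (1 + ‖ξ‖) ^ s := mul_le_mul_of_nonneg_right hA₁ hw
  have h1 : ∀ x, ‖fderiv ℝ (fun x => σ x ξ * χ x) x‖ ≤ A * (1 + ‖ξ‖) ^ s := fun x => by
    rw [fderiv_fun_mul ((hσ.contDiff_left ξ).differentiable (by simp) x)
      (χ.contDiff.differentiable (by simp) x)]
    refine (norm_add_le _ _).trans ?_
    rw [norm_smul, norm_smul]
    calc ‖σ x ξ‖ * ‖fderiv ℝ χ x‖ + ‖χ x‖ * ‖fderiv ℝ (fun x => σ x ξ) x‖
        ≤ C₀ * (1 + ‖ξ‖) ^ s * X₁ + X₀ * (C₁ * (1 + ‖ξ‖) ^ s) :=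
          add_le_add (mul_le_mul (hC₀ x ξ) (hX₁ x) (norm_nonneg _) (by positivity))
            (mul_le_mul (hX₀ x) (hC₁ x ξ) (norm_nonneg _) hX₀0)
      _ = (C₀ * X₁ + X₀ * C₁) * (1 + ‖ξ‖) ^ s := by ring
      _ ≤ A * (1 + ‖ξ‖) ^ s := mul_le_mul_of_nonneg_right hA₂ hw
  have hb := norm_integral_planeWave_mul_le hg (K := tsupport χ) χ.hasCompactSupport
    (fun x hx => by rw [image_eq_zero_of_notMem_tsupport hx, mul_zero]) h0 h1 η
  refine hb.trans (le_of_eq ?_)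
  ring

/-- Decay of the bilinear form. -/
theorem exists_norm_oscForm_le (hσ : IsSymbol s σ) (hθ : ‖θ‖ = 1) :
    ∃ C, 0 ≤ C ∧ ∀ l μ : ℝ, ‖oscForm σ χ θ l μ‖ ≤
      C * (1 + |l|) ^ s * (1 + |l + μ|) ^ (-1 : ℝ) := by
  obtain ⟨A, hA0, hA⟩ := hσ.exists_norm_integral_planeWave_le χ
  obtain ⟨N, hN⟩ : ∃ N, N = ∫ ζ : EuclRd d, (1 + ‖ζ‖) ^ (|s| + 1) * ‖fourierHat χ ζ‖ := ⟨_, rfl⟩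
  have hN0 : 0 ≤ N := hN ▸ integral_nonneg fun ζ => by positivity
  obtain ⟨c, hc⟩ : ∃ c : ℝ, c = ((2 * Real.pi) ^ d)⁻¹ := ⟨_, rfl⟩
  have hc0 : 0 ≤ c := by rw [hc]; positivity
  refine ⟨c * (A * N), by positivity, fun l μ => ?_⟩
  -- The `x`-integral is done first to obtain the decay. Peetre's inequality then removes `ζ` from
  -- both weights at the price of a power of `1+|ζ|`, which the rapid decay of the transformed
  -- cutoff absorbs.
  have hswap := integral_prod_symm _ (integrable_oscIntegrand (χ := χ) hσ hθ l (l + μ))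
  rw [← Measure.volume_eq_prod] at hswap
  have hinner : ∀ ζ : EuclRd d, ‖∫ x, oscIntegrand σ χ θ l (l + μ) (x, ζ)‖ ≤
      (A * (1 + |l|) ^ s * (1 + |l + μ|) ^ (-1 : ℝ)) *
        ((1 + ‖ζ‖) ^ (|s| + 1) * ‖fourierHat χ ζ‖) := by
    intro ζ
    have h0 : ∫ x, oscIntegrand σ χ θ l (l + μ) (x, ζ) =
        (∫ x, planeWave (-(ζ + (l + μ) • θ)) x * (σ x (ζ + l • θ) * χ x)) * fourierHat χ ζ := by
      rw [← integral_mul_const]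
      rfl
    rw [h0, norm_mul]
    have hp1 := one_add_norm_add_rpow_le ζ (l • θ) s
    have hp2 := one_add_norm_add_rpow_le ζ ((l + μ) • θ) (-1)
    rw [norm_smul, hθ, mul_one, Real.norm_eq_abs] at hp1 hp2
    rw [abs_neg, abs_one, Real.rpow_one] at hp2
    calc _ ≤ A * (1 + ‖ζ + l • θ‖) ^ s * (1 + ‖ζ + (l + μ) • θ‖) ^ (-1 : ℝ) *
          ‖fourierHat χ ζ‖ := mul_le_mul_of_nonneg_right (hA _ _) (norm_nonneg _)
      _ ≤ (A * ((1 + |l|) ^ s * (1 + ‖ζ‖) ^ |s|)) *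
          ((1 + |l + μ|) ^ (-1 : ℝ) * (1 + ‖ζ‖)) * ‖fourierHat χ ζ‖ := by
          refine mul_le_mul_of_nonneg_right (mul_le_mul ?_ hp2 ?_ ?_) (norm_nonneg _)
          · exact mul_le_mul_of_nonneg_left hp1 hA0
          · positivity
          · positivity
      _ = _ := by
          rw [Real.rpow_add (by positivity), Real.rpow_one]
          ring
  have hcn : ‖(1 / ((2 * Real.pi) ^ d : ℝ) : ℂ)‖ = c := by
    rw [norm_div, norm_one, Complex.norm_real, Real.norm_of_nonneg (by positivity), one_div, hc]
  rw [oscForm_eq hσ hθ, hswap, norm_mul, hcn]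
  have hI : ‖∫ ζ, ∫ x, oscIntegrand σ χ θ l (l + μ) (x, ζ)‖ ≤
      (A * (1 + |l|) ^ s * (1 + |l + μ|) ^ (-1 : ℝ)) * N := by
    rw [hN, ← integral_const_mul]
    exact norm_integral_le_of_norm_le
      ((integrable_rpow_mul_fourierHat χ (|s| + 1)).const_mul _) (ae_of_all _ hinner)
  refine (mul_le_mul_of_nonneg_left hI hc0).trans (le_of_eq ?_)
  ring

lemma rpow_mul_one_add_rpow_neg_le {κ : ℝ} (hκ : 1 ≤ κ) (m : ℝ) :
    κ ^ m * (1 + |κ|) ^ (-m) ≤ 2 ^ |m| := by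
  have hκ0 : 0 < κ := by linarith
  rw [abs_of_pos hκ0]
  rcases le_total 0 m with h | h
  · have h1 : (1 + κ) ^ (-m) ≤ κ ^ (-m) :=
      Real.rpow_le_rpow_of_nonpos hκ0 (by linarith) (by linarith)
    calc κ ^ m * (1 + κ) ^ (-m) ≤ κ ^ m * κ ^ (-m) := by gcongr
      _ = 1 := by rw [← Real.rpow_add hκ0]; simp
      _ ≤ 2 ^ |m| := Real.one_le_rpow one_le_two (abs_nonneg m)
  · have h1 : (1 + κ) ^ (-m) ≤ (2 * κ) ^ (-m) :=
      Real.rpow_le_rpow (by linarith) (by linarith) (by linarith)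
    calc κ ^ m * (1 + κ) ^ (-m) ≤ κ ^ m * (2 * κ) ^ (-m) := by gcongr
      _ = 2 ^ (-m) * (κ ^ m * κ ^ (-m)) := by
          rw [Real.mul_rpow two_pos.le hκ0.le]; ring
      _ = 2 ^ |m| := by rw [← Real.rpow_add hκ0, abs_of_nonpos h]; simp

lemma tendsto_norm_add_smul_div (hθ : ‖θ‖ = 1) (ζ : EuclRd d) :
    Tendsto (fun κ : ℝ => ‖ζ + κ • θ‖ / κ) atTop (𝓝 1) := by
  have h1 : Tendsto (fun κ : ℝ => ‖κ⁻¹ • ζ + θ‖) atTop (𝓝 ‖(0 : ℝ) • ζ + θ‖) :=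
    ((tendsto_inv_atTop_zero.smul_const ζ).add_const θ).norm
  rw [zero_smul, zero_add, hθ] at h1
  refine h1.congr' ?_
  filter_upwards [eventually_gt_atTop 0] with κ hκ
  have : ζ + κ • θ = κ • (κ⁻¹ • ζ + θ) := by
    rw [smul_add, smul_inv_smul₀ hκ.ne']
  rw [this, norm_smul, Real.norm_of_nonneg hκ.le]
  field_simp

/-- Convergence of rescaled symbols to the principal symbol. -/
lemma HasPrincipalSymbol.tendsto {D : Opens (EuclRd d)} {m : ℝ} {a : EuclRd d → ℂ}
    (hσ : HasPrincipalSymbol D m a σ) (hθ : ‖θ‖ = 1) (x ζ : EuclRd d) :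
    Tendsto (fun κ : ℝ => ((κ ^ m : ℝ) : ℂ) * σ x (ζ + κ • θ)) atTop (𝓝 (a x)) := by
  obtain ⟨-, -, b, hb, -, hab⟩ := hσ
  obtain ⟨C, hC0, hC⟩ := hb.exists_norm_le
  have hn := tendsto_norm_add_smul_div hθ ζ
  have hinf : Tendsto (fun κ : ℝ => ‖ζ + κ • θ‖) atTop atTop := by
    refine (hn.pos_mul_atTop one_pos tendsto_id).congr' ?_
    filter_upwards [eventually_gt_atTop 0] with κ hκ
    simp only [id]
    field_simp
  have h1 : Tendsto (fun κ : ℝ => ((κ ^ m * ‖ζ + κ • θ‖ ^ (-m) : ℝ) : ℂ)) atTop (𝓝 1) := by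
    have h2 : Tendsto (fun κ : ℝ => (‖ζ + κ • θ‖ / κ) ^ (-m)) atTop (𝓝 (1 ^ (-m))) :=
      hn.rpow_const (Or.inl one_ne_zero)
    rw [Real.one_rpow] at h2
    have h3 : Tendsto (fun κ : ℝ => κ ^ m * ‖ζ + κ • θ‖ ^ (-m)) atTop (𝓝 1) := by
      refine h2.congr' ?_
      filter_upwards [eventually_gt_atTop 0] with κ hκ
      rw [Real.div_rpow (norm_nonneg _) hκ.le, Real.rpow_neg hκ.le, div_inv_eq_mul, mul_comm]
    exact_mod_cast (Complex.continuous_ofReal.tendsto 1).comp h3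
  -- The remainder symbol has order `-m - 1`, so after multiplication by `κ^m` it is still `O(1/κ)`.
  have h4 : Tendsto (fun κ : ℝ => ((κ ^ m : ℝ) : ℂ) * b x (ζ + κ • θ)) atTop (𝓝 0) := by
    have h5 : Tendsto (fun κ : ℝ => (C * 2 ^ |m| * (1 + ‖ζ‖) ^ |-m - 1|) * (1 + κ)⁻¹) atTop
        (𝓝 0) := by
      have : Tendsto (fun κ : ℝ => (1 + κ)⁻¹) atTop (𝓝 0) :=
        tendsto_inv_atTop_zero.comp (tendsto_atTop_add_const_left _ _ tendsto_id)
      simpa using this.const_mul (C * 2 ^ |m| * (1 + ‖ζ‖) ^ |-m - 1|)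
    refine squeeze_zero_norm' ?_ h5
    filter_upwards [eventually_ge_atTop 1] with κ hκ
    have hκ0 : 0 < κ := by linarith
    have hp := one_add_norm_add_rpow_le ζ (κ • θ) (-m - 1)
    rw [norm_smul, hθ, mul_one, Real.norm_eq_abs] at hp
    rw [norm_mul, Complex.norm_real, Real.norm_of_nonneg (by positivity)]
    calc κ ^ m * ‖b x (ζ + κ • θ)‖
        ≤ κ ^ m * (C * ((1 + |κ|) ^ (-m - 1) * (1 + ‖ζ‖) ^ |-m - 1|)) := by
          gcongr
          exact (hC _ _).trans (by gcongr)
      _ = C * (κ ^ m * (1 + |κ|) ^ (-m)) * (1 + ‖ζ‖) ^ |-m - 1| * (1 + κ)⁻¹ := by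
          rw [sub_eq_add_neg, Real.rpow_add (by positivity), Real.rpow_neg_one, abs_of_pos hκ0]
          ring
      _ ≤ C * 2 ^ |m| * (1 + ‖ζ‖) ^ |-m - 1| * (1 + κ)⁻¹ := by
          gcongr
          exact rpow_mul_one_add_rpow_neg_le hκ m
  have h6 := (h1.const_mul (a x)).add h4
  rw [mul_one, add_zero] at h6
  refine h6.congr' ?_
  filter_upwards [hinf.eventually_ge_atTop 1] with κ hκ
  rw [hab _ _ hκ]
  push_cast
  ring

/-- The principal term of the bilinear form. -/
theorem tendsto_oscForm {D : Opens (EuclRd d)} {m : ℝ} {a : 𝓓(D, ℂ)}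
    (hσ : HasPrincipalSymbol D m a σ) (hθ : ‖θ‖ = 1) (hχ : ∀ x ∈ D, χ x = 1) (τ : ℝ) :
    Tendsto (fun κ : ℝ => ((κ ^ m : ℝ) : ℂ) * oscForm σ χ θ κ (-(κ + τ))) atTop
      (𝓝 (fourierHat a (τ • θ))) := by
  obtain ⟨C, hC0, hC⟩ := hσ.1.exists_norm_le
  have ha0 : ∀ x, x ∉ D → a x = 0 := fun x hx =>
    image_eq_zero_of_notMem_tsupport fun h => hx (a.tsupport_subset h)
  set L : EuclRd d × EuclRd d → ℂ := fun q =>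
    planeWave (-(q.2 + (-τ) • θ)) q.1 * (a q.1 * χ q.1) * fourierHat χ q.2 with hL
  have hlim : Tendsto (fun κ : ℝ => ∫ q, ((κ ^ m : ℝ) : ℂ) * oscIntegrand σ χ θ κ (-τ) q) atTop
      (𝓝 (∫ q, L q)) := by
    refine tendsto_integral_filter_of_dominated_convergence
      (fun q => (C * 2 ^ |m| * ‖χ q.1‖) * ((1 + ‖q.2‖) ^ |-m| * ‖fourierHat χ q.2‖)) ?_ ?_ ?_ ?_
    · exact Eventually.of_forall fun κ =>
        (continuous_const.mul (continuous_oscIntegrand hσ.1 κ (-τ))).aestronglyMeasurable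
    · filter_upwards [eventually_ge_atTop 1] with κ hκ
      refine ae_of_all _ fun q => ?_
      have h1 := norm_oscIntegrand_le (χ := χ) hθ hC0 hC κ (-τ) q
      have hκ0 : 0 < κ := by linarith
      rw [norm_mul, Complex.norm_real, Real.norm_of_nonneg (by positivity)]
      calc _ ≤ κ ^ m * ((C * (1 + |κ|) ^ (-m) * ‖χ q.1‖) *
            ((1 + ‖q.2‖) ^ |-m| * ‖fourierHat χ q.2‖)) := by gcongr
        _ = (C * (κ ^ m * (1 + |κ|) ^ (-m)) * ‖χ q.1‖) *
            ((1 + ‖q.2‖) ^ |-m| * ‖fourierHat χ q.2‖) := by ring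
        _ ≤ _ := by
            gcongr
            exact rpow_mul_one_add_rpow_neg_le hκ m
    · exact ((integrable_testFn χ).norm.const_mul _).mul_prod
        (integrable_rpow_mul_fourierHat χ |-m|)
    · refine ae_of_all _ fun q => ?_
      have h1 := hσ.tendsto hθ q.1 q.2
      have h2 := h1.const_mul (planeWave (-(q.2 + (-τ) • θ)) q.1 * χ q.1 * fourierHat χ q.2)
      simp only [hL, oscIntegrand]
      convert h2 using 2 <;> ring
  have hLint : Integrable L := by
    have hac : Continuous fun x => a x * χ x := a.continuous.mul χ.continuous
    have hai : Integrable fun x => a x * χ x :=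
      hac.integrable_of_hasCompactSupport χ.hasCompactSupport.mul_left
    refine (hai.norm.mul_prod (integrable_fourierHat χ).norm).mono' ?_ (ae_of_all _ fun q => ?_)
    · have h2 : Continuous fun q : EuclRd d × EuclRd d => planeWave (-(q.2 + (-τ) • θ)) q.1 :=
        contDiff_planeWave_uncurry.continuous.comp
          (f := fun q : EuclRd d × EuclRd d => (-(q.2 + (-τ) • θ), q.1)) (by fun_prop)
      exact ((h2.mul (hac.comp continuous_fst)).mul
        ((continuous_fourierHat χ).comp continuous_snd)).aestronglyMeasurable
    · simp [hL]
  -- The limit integrand factors, and Fourier inversion in `ζ` returns another factor `χ`. The two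
  -- cutoffs disappear because `χ = 1` on `D` and `a = 0` off `D`.
  have hval : (1 / ((2 * Real.pi) ^ d : ℝ) : ℂ) * ∫ q, L q = fourierHat a (τ • θ) := by
    rw [Measure.volume_eq_prod, integral_prod _ hLint, ← integral_const_mul, fourierHat_eq]
    congr 1
    ext x
    have h1 : ∀ ζ, L (x, ζ) = (planeWave (τ • θ) x * (a x * χ x)) *
        (planeWave (-ζ) x * fourierHat χ ζ) := fun ζ => by
      simp only [hL]
      rw [show -(ζ + (-τ) • θ) = τ • θ + -ζ by module, planeWave_add]
      ring
    simp_rw [h1]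
    rw [integral_const_mul, mul_left_comm, fourierHat_inversion]
    by_cases hx : x ∈ D
    · rw [hχ x hx]; ring
    · rw [ha0 x hx]; ring
  rw [← hval]
  refine (hlim.const_mul _).congr fun κ => ?_
  rw [oscForm_eq hσ.1 hθ, integral_const_mul, show κ + -(κ + τ) = -τ by ring]
  ring

end

noncomputable section

variable {d : ℕ}

/-! ### Band averages of products of field values -/

lemma tendsto_bandAverage_of_tendsto {g : ℝ → ℂ} {L : ℂ} (hg : Tendsto g atTop (𝓝 L))
    (hi : ∀ Q, 1 ≤ Q → IntervalIntegrable g volume Q (2 * Q)) :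
    Tendsto (fun Q : ℝ => (1 / Q : ℂ) * ∫ t in Q..(2 * Q), g t) atTop (𝓝 L) := by
  rw [Metric.tendsto_atTop] at hg ⊢
  intro ε hε
  obtain ⟨N, hN⟩ := hg (ε / 2) (by positivity)
  refine ⟨max N 1, fun Q hQ => ?_⟩
  have hQN : N ≤ Q := (le_max_left _ _).trans hQ
  have hQ1 : 1 ≤ Q := (le_max_right _ _).trans hQ
  have hQ0 : 0 < Q := by linarith
  have hQc : (Q : ℂ) ≠ 0 := by exact_mod_cast hQ0.ne'
  have e : (1 / Q : ℂ) * (∫ t in Q..(2 * Q), g t) - L = (1 / Q : ℂ) * ∫ t in Q..(2 * Q), (g t - L) := by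
    rw [intervalIntegral.integral_sub (hi Q hQ1) intervalIntegrable_const,
      intervalIntegral.integral_const, Complex.real_smul]
    push_cast
    field_simp
    ring
  have hb : ‖∫ t in Q..(2 * Q), (g t - L)‖ ≤ ε / 2 * |2 * Q - Q| := by
    refine intervalIntegral.norm_integral_le_of_norm_le_const fun t ht => ?_
    rw [Set.uIoc_of_le (by linarith)] at ht
    rw [← dist_eq_norm]
    exact (hN t (hQN.trans ht.1.le)).le
  rw [dist_eq_norm, e, norm_mul, norm_div, norm_one, Complex.norm_real, Real.norm_of_nonneg hQ0.le]
  rw [show 2 * Q - Q = Q by ring, abs_of_pos hQ0] at hb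
  calc 1 / Q * ‖∫ t in Q..(2 * Q), (g t - L)‖ ≤ 1 / Q * (ε / 2 * Q) := by gcongr
    _ = ε / 2 := by field_simp
    _ < ε := by linarith

section Field

variable {Ω : Type*} [MeasurableSpace Ω] {P : Measure Ω} [IsProbabilityMeasure P]
  {f : Ω → DistrRd d} {m : ℝ} {D : Opens (EuclRd d)} {ac ar : 𝓓(D, ℂ)}

/-- Of the three pairings in Wick's formula, the one pairing each product with itself is cancelled
by subtracting the means. -/
lemma IsCenteredGMIG.covariance_mul (hf : IsCenteredGMIG P f m D ac ar) {Z W Z' W' : Ω → ℂ}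
    (hZ : IsFieldValue f Z) (hW : IsFieldValue f W) (hZ' : IsFieldValue f Z')
    (hW' : IsFieldValue f W') :
    ∫ ω, (Z ω * W ω - ∫ ω, Z ω * W ω ∂P) * conj (Z' ω * W' ω - ∫ ω, Z' ω * W' ω ∂P) ∂P =
      (∫ ω, Z ω * conj (Z' ω) ∂P) * (∫ ω, W ω * conj (W' ω) ∂P) +
      (∫ ω, Z ω * conj (W' ω) ∂P) * (∫ ω, W ω * conj (Z' ω) ∂P) := by
  have hw := hf.wick hZ hW hZ'.conj hW'.conj
  have m4 : ∀ {A}, IsFieldValue f A → MemLp A 4 P := fun hA =>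
    hf.memLp_fieldValue hA (by norm_num)
  have m2 : ∀ {A}, IsFieldValue f A → MemLp A 2 P := fun hA =>
    hf.memLp_fieldValue hA (by norm_num)
  have i1 : Integrable (fun ω => Z ω * W ω) P := (m2 hZ).integrable_mul (m2 hW)
  have i2 : Integrable (fun ω => conj (Z' ω) * conj (W' ω)) P :=
    (m2 hZ'.conj).integrable_mul (m2 hW'.conj)
  have i3 := integrable_mul_four (m4 hZ) (m4 hW) (m4 hZ'.conj) (m4 hW'.conj)
  set e := ∫ ω, Z ω * W ω ∂P with he
  have he' : conj (∫ ω, Z' ω * W' ω ∂P) = ∫ ω, conj (Z' ω) * conj (W' ω) ∂P := by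
    rw [← integral_conj]; simp only [map_mul]
  set e' := ∫ ω, conj (Z' ω) * conj (W' ω) ∂P with hed
  have hexp : ∀ ω, (Z ω * W ω - e) * conj (Z' ω * W' ω - ∫ ω, Z' ω * W' ω ∂P) =
      Z ω * W ω * conj (Z' ω) * conj (W' ω) - e' * (Z ω * W ω) -
        e * (conj (Z' ω) * conj (W' ω)) + e * e' := fun ω => by
    rw [map_sub, he', map_mul]; ring
  simp_rw [hexp]
  have j1 : Integrable (fun ω => Z ω * W ω * conj (Z' ω) * conj (W' ω) - e' * (Z ω * W ω)) P :=
    i3.sub (i1.const_mul e')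
  have j2 : Integrable (fun ω => Z ω * W ω * conj (Z' ω) * conj (W' ω) - e' * (Z ω * W ω) -
      e * (conj (Z' ω) * conj (W' ω))) P := j1.sub (i2.const_mul e)
  rw [integral_add j2 (integrable_const _), integral_sub j1 (i2.const_mul e),
    integral_sub i3 (i1.const_mul e'),
    integral_const_mul, integral_const_mul, hw, ← he, ← hed]
  simp
  ring

/-- Ergodicity of weighted band averages of products of field values. -/
theorem IsCenteredGMIG.ae_tendsto_product (hf : IsCenteredGMIG P f m D ac ar) {Z W : ℝ → Ω → ℂ}
    (hZ : ∀ t, IsFieldValue f (Z t)) (hW : ∀ t, IsFieldValue f (W t))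
    (hZc : ∀ ω, Continuous fun t => Z t ω) (hWc : ∀ ω, Continuous fun t => W t ω)
    {w : ℝ → ℝ} (hwm : Measurable w) (hwc : ContinuousOn w (Set.Ici 1))
    (hw0 : ∀ t, 1 ≤ t → 0 ≤ w t) (hw : ∀ t, 1 ≤ t → w t ≤ t ^ m)
    {L : ℂ} (hL : Tendsto (fun t => (w t : ℂ) * ∫ ω, Z t ω * W t ω ∂P) atTop (𝓝 L))
    {C : ℝ} (hC0 : 0 ≤ C)
    (h1 : ∀ s t, 1 ≤ s → 1 ≤ t → s ^ m * t ^ m * (‖∫ ω, Z s ω * conj (Z t ω) ∂P‖ *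
      ‖∫ ω, W s ω * conj (W t ω) ∂P‖) ≤ C * (1 + ‖s - t‖) ^ (-2 : ℝ))
    (h2 : ∀ s t, 1 ≤ s → 1 ≤ t → s ^ m * t ^ m * (‖∫ ω, Z s ω * conj (W t ω) ∂P‖ *
      ‖∫ ω, W s ω * conj (Z t ω) ∂P‖) ≤ C * (1 + ‖s - t‖) ^ (-2 : ℝ)) :
    ∀ᵐ ω ∂P, Tendsto (fun Q : ℝ => (1 / Q : ℂ) *
      ∫ t in Q..(2 * Q), (w t : ℂ) * (Z t ω * W t ω)) atTop (𝓝 L) := by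
  have m4 : ∀ {A}, IsFieldValue f A → MemLp A 4 P := fun hA =>
    hf.memLp_fieldValue hA (by norm_num)
  -- Jointly measurable versions serve the Fubini arguments; they agree with the original processes
  -- for all times at once, almost surely, so the averages are unchanged.
  obtain ⟨Z', hZm, -, hZZ⟩ := exists_measurable_modification hZc fun t =>
    (m4 (hZ t)).aestronglyMeasurable.aemeasurable
  obtain ⟨W', hWm, -, hWW⟩ := exists_measurable_modification hWc fun t =>
    (m4 (hW t)).aestronglyMeasurable.aemeasurable
  set e : ℝ → ℂ := fun t => ∫ ω, Z t ω * W t ω ∂P with he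
  have he' : e = fun t => ∫ ω, Z' t ω * W' t ω ∂P := by
    ext t
    refine integral_congr_ae ?_
    filter_upwards [hZZ, hWW] with ω h h'
    rw [h, h']
  have hprodm : Measurable fun q : ℝ × Ω => Z' q.1 q.2 * W' q.1 q.2 := hZm.mul hWm
  have hem : Measurable e := by
    rw [he']
    exact (hprodm.stronglyMeasurable.integral_prod_right' (ν := P)).measurable
  set Y : ℝ → Ω → ℂ := fun t ω => (w t : ℂ) * (Z' t ω * W' t ω - e t) with hY
  have hYm : Measurable (Function.uncurry Y) :=
    (Complex.measurable_ofReal.comp (hwm.comp measurable_fst)).mul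
      (hprodm.sub (hem.comp measurable_fst))
  have hYae : ∀ t, (fun ω => (w t : ℂ) * (Z t ω * W t ω - e t)) =ᵐ[P] Y t := fun t => by
    filter_upwards [hZZ, hWW] with ω h h'
    simp only [hY]
    rw [h, h']
  have hHT : ENNReal.HolderTriple 4 4 2 := ⟨by
    rw [← ENNReal.toReal_eq_toReal_iff' (by simp) (by simp)]
    simp [ENNReal.toReal_add]
    norm_num⟩
  have hY2 : ∀ t, 1 ≤ t → MemLp (Y t) 2 P := fun t _ => by
    refine MemLp.ae_eq (hYae t) ?_
    exact (((m4 (hW t)).mul (m4 (hZ t))).sub (memLp_const _)).const_mul _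
  have hYcov : ∀ s t, 1 ≤ s → 1 ≤ t →
      ‖∫ ω, Y s ω * conj (Y t ω) ∂P‖ ≤ (2 * C) * (1 + ‖s - t‖) ^ (-2 : ℝ) := by
    intro s t hs ht
    have e1 : ∫ ω, Y s ω * conj (Y t ω) ∂P = ((w s * w t : ℝ) : ℂ) *
        ∫ ω, (Z s ω * W s ω - e s) * conj (Z t ω * W t ω - e t) ∂P := by
      rw [← integral_const_mul]
      refine integral_congr_ae ?_
      filter_upwards [hYae s, hYae t] with ω h h'
      rw [← h, ← h', map_mul, conj_ofReal]
      push_cast; ring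
    rw [e1, hf.covariance_mul (hZ s) (hW s) (hZ t) (hW t), norm_mul, Complex.norm_real,
      Real.norm_of_nonneg (mul_nonneg (hw0 s hs) (hw0 t ht))]
    have hs0 : 0 < s := by linarith
    have ht0 : 0 < t := by linarith
    have hww : w s * w t ≤ s ^ m * t ^ m :=
      mul_le_mul (hw s hs) (hw t ht) (hw0 t ht) (by positivity)
    refine (mul_le_mul hww (norm_add_le _ _) (norm_nonneg _) (by positivity)).trans ?_
    rw [norm_mul, norm_mul, mul_add]
    linarith [h1 s t hs ht, h2 s t hs ht]
  have hmain := ae_tendsto_bandAverage hYm (by positivity) hY2 hYcov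
  filter_upwards [hmain, hZZ, hWW] with ω hω hz hw'
  set h : ℝ → ℂ := fun t => (w t : ℂ) * (Z t ω * W t ω) with hh
  have hhi : ∀ Q, 1 ≤ Q → IntervalIntegrable h volume Q (2 * Q) := fun Q hQ => by
    refine ContinuousOn.intervalIntegrable ?_
    rw [Set.uIcc_of_le (by linarith)]
    refine ((Complex.continuous_ofReal.comp_continuousOn hwc).mul
      ((hZc ω).mul (hWc ω)).continuousOn).mono fun t ht => ?_
    exact hQ.trans ht.1
  have hYi : ∀ Q, 1 ≤ Q → IntervalIntegrable (fun t => Y t ω) volume Q (2 * Q) := fun Q hQ => by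
    rw [intervalIntegrable_iff, Set.uIoc_of_le (by linarith)]
    exact (hω.1 (2 * Q)).mono_set fun t ht => ⟨hQ.trans ht.1.le, ht.2⟩
  have hsplit : ∀ t, h t - Y t ω = (w t : ℂ) * e t := fun t => by
    simp only [hh, hY, ← hz t, ← hw' t]
    ring
  have hgi : ∀ Q, 1 ≤ Q → IntervalIntegrable (fun t => (w t : ℂ) * e t) volume Q (2 * Q) :=
    fun Q hQ => by
      have := (hhi Q hQ).sub (hYi Q hQ)
      simpa only [hsplit] using this
  -- The average splits into the centred part, which tends to zero by the law of large numbers, and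
  -- the mean, which is a deterministic Cesàro-type limit.
  have hsum := hω.2.add (tendsto_bandAverage_of_tendsto hL hgi)
  rw [zero_add] at hsum
  refine hsum.congr' ?_
  filter_upwards [eventually_ge_atTop 1] with Q hQ
  rw [← mul_add, ← intervalIntegral.integral_add (hYi Q hQ) (hgi Q hQ)]
  congr 2
  ext t
  rw [← hsplit]; ring

end Field

end

/-! ### Decorrelation at separated frequencies and the two almost sure limits. -/

noncomputable section

variable {d : ℕ}

/-- The weight `t^m` cancels the order of the symbol, as `|l|` differs from `t` by at most `τ`. The
parameter `r` lets frequency sums and differences be estimated alike through `s - t`. -/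
lemma exists_rpow_mul_norm_oscForm_le {m : ℝ} {σ : EuclRd d → EuclRd d → ℂ} (hσ : IsSymbol (-m) σ)
    (χ : TestFn d) {θ : EuclRd d} (hθ : ‖θ‖ = 1) {τ : ℝ} (hτ : 0 ≤ τ) :
    ∃ K, 0 ≤ K ∧ ∀ t l μ r : ℝ, 1 ≤ t → (|l| = t ∨ |l| = t + τ) → |r| ≤ |l + μ| →
      t ^ m * ‖oscForm σ χ θ l μ‖ ≤ K * (1 + ‖r‖) ^ (-1 : ℝ) := by
  obtain ⟨C, hC0, hC⟩ := exists_norm_oscForm_le (χ := χ) hσ hθ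
  refine ⟨C * (2 ^ |m| * (1 + τ) ^ |m|), by positivity, fun t l μ r ht hl hr => ?_⟩
  have ht0 : 0 < t := by linarith
  have h1 : t ^ m * (1 + |l|) ^ (-m) ≤ 2 ^ |m| * (1 + τ) ^ |m| := by
    have h2 := rpow_mul_one_add_rpow_neg_le ht m
    have h3 : 1 ≤ (1 + τ) ^ |m| := Real.one_le_rpow (by linarith) (abs_nonneg m)
    have h4 : (1 + |l|) ^ (-m) ≤ (1 + |t|) ^ (-m) * (1 + τ) ^ |m| := by
      rcases hl with h | h
      · rw [h, abs_of_pos ht0]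
        exact le_mul_of_one_le_right (by positivity) h3
      · have := one_add_norm_add_rpow_le τ t (-m)
        rwa [Real.norm_of_nonneg hτ, Real.norm_of_nonneg (by linarith : 0 ≤ τ + t), abs_neg,
          Real.norm_eq_abs, add_comm τ t, ← h] at this
    calc t ^ m * (1 + |l|) ^ (-m) ≤ t ^ m * ((1 + |t|) ^ (-m) * (1 + τ) ^ |m|) := by gcongr
      _ = (t ^ m * (1 + |t|) ^ (-m)) * (1 + τ) ^ |m| := by ring
      _ ≤ _ := by gcongr
  have h5 : (1 + |l + μ|) ^ (-1 : ℝ) ≤ (1 + ‖r‖) ^ (-1 : ℝ) := by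
    rw [Real.norm_eq_abs]
    exact Real.rpow_le_rpow_of_nonpos (by positivity) (by linarith) (by norm_num)
  calc t ^ m * ‖oscForm σ χ θ l μ‖
      ≤ t ^ m * (C * (1 + |l|) ^ (-m) * (1 + |l + μ|) ^ (-1 : ℝ)) := by gcongr; exact hC l μ
    _ = C * (t ^ m * (1 + |l|) ^ (-m)) * (1 + |l + μ|) ^ (-1 : ℝ) := by ring
    _ ≤ C * (2 ^ |m| * (1 + τ) ^ |m|) * (1 + ‖r‖) ^ (-1 : ℝ) := by gcongr

/-- The weight of the band averages, relative to the Fourier transform of the source. -/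
def bandWeight (d : ℕ) (m τ t : ℝ) : ℝ :=
  t ^ (m + 7 - d) * ((t + τ) ^ (((d : ℝ) - 7) / 2) * t ^ (((d : ℝ) - 7) / 2))

lemma measurable_bandWeight (m τ : ℝ) : Measurable (bandWeight d m τ) := by
  unfold bandWeight; fun_prop

lemma continuousOn_bandWeight (m : ℝ) {τ : ℝ} (hτ : 0 ≤ τ) :
    ContinuousOn (bandWeight d m τ) (Set.Ioi 0) := by
  unfold bandWeight
  refine (continuousOn_id.rpow_const fun t ht => Or.inl (Set.mem_Ioi.1 ht).ne').mul
    (ContinuousOn.mul ?_ (continuousOn_id.rpow_const fun t ht => Or.inl (Set.mem_Ioi.1 ht).ne'))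
  refine (continuousOn_id.add continuousOn_const).rpow_const fun t ht => Or.inl ?_
  have : 0 < t := ht
  exact (add_pos_of_pos_of_nonneg this hτ).ne'

lemma bandWeight_nonneg (m : ℝ) {τ t : ℝ} (hτ : 0 ≤ τ) (ht : 0 < t) : 0 ≤ bandWeight d m τ t := by
  unfold bandWeight; positivity

lemma bandWeight_eq (m : ℝ) {τ t : ℝ} (hτ : 0 ≤ τ) (ht : 0 < t) :
    bandWeight d m τ t = t ^ m * ((t + τ) / t) ^ (((d : ℝ) - 7) / 2) := by
  have h1 : t ^ (m + 7 - d) = t ^ m * t ^ (-(((d : ℝ) - 7) / 2)) * t ^ (-(((d : ℝ) - 7) / 2)) := by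
    rw [← Real.rpow_add ht, ← Real.rpow_add ht]
    congr 1; ring
  have h2 : t ^ (((d : ℝ) - 7) / 2) ≠ 0 := (Real.rpow_pos_of_pos ht _).ne'
  rw [bandWeight, h1, Real.div_rpow (by linarith) ht.le, Real.rpow_neg ht.le]
  field_simp

/-- Replacing `κ` by `κ + τ` in one of the two factors only lowers the weight, because the exponent
`(d-7)/2` is negative. -/
lemma bandWeight_le (hd : d = 2 ∨ d = 3) (m : ℝ) {τ t : ℝ} (hτ : 0 ≤ τ) (ht : 0 < t) :
    bandWeight d m τ t ≤ t ^ m := by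
  rw [bandWeight_eq m hτ ht]
  refine mul_le_of_le_one_right (by positivity) (Real.rpow_le_one_of_one_le_of_nonpos ?_ ?_)
  · rw [le_div_iff₀ ht]; linarith
  · rcases hd with rfl | rfl <;> norm_num

lemma tendsto_bandWeight_mul {m τ : ℝ} (hτ : 0 ≤ τ) {e : ℝ → ℂ} {L : ℂ}
    (he : Tendsto (fun t : ℝ => ((t ^ m : ℝ) : ℂ) * e t) atTop (𝓝 L)) :
    Tendsto (fun t : ℝ => (bandWeight d m τ t : ℂ) * e t) atTop (𝓝 L) := by
  have h1 : Tendsto (fun t : ℝ => (t + τ) / t) atTop (𝓝 1) := by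
    have : Tendsto (fun t : ℝ => 1 + τ / t) atTop (𝓝 (1 + 0)) :=
      tendsto_const_nhds.add (tendsto_const_nhds.div_atTop tendsto_id)
    rw [add_zero] at this
    refine this.congr' ?_
    filter_upwards [eventually_gt_atTop 0] with t ht
    field_simp
  have h2 := h1.rpow_const (p := ((d : ℝ) - 7) / 2) (Or.inl one_ne_zero)
  rw [Real.one_rpow] at h2
  have h3 := ((Complex.continuous_ofReal.tendsto 1).comp h2).mul he
  rw [Complex.ofReal_one, one_mul] at h3
  refine h3.congr' ?_
  filter_upwards [eventually_gt_atTop 0] with t ht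
  rw [bandWeight_eq m hτ ht]
  simp only [Function.comp_apply]
  push_cast; ring

lemma rpow_mul_mul_le {m s t a b K K' x : ℝ} (hs : 0 < s) (ht : 0 < t) (hx : 0 < x) (ha : 0 ≤ a)
    (hb : 0 ≤ b) (h1 : t ^ m * a ≤ K * x ^ (-1 : ℝ)) (h2 : s ^ m * b ≤ K' * x ^ (-1 : ℝ)) :
    s ^ m * t ^ m * (a * b) ≤ K * K' * x ^ (-2 : ℝ) := by
  have e : x ^ (-2 : ℝ) = x ^ (-1 : ℝ) * x ^ (-1 : ℝ) := by
    rw [← Real.rpow_add hx]; norm_num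
  calc s ^ m * t ^ m * (a * b) = (t ^ m * a) * (s ^ m * b) := by ring
    _ ≤ (K * x ^ (-1 : ℝ)) * (K' * x ^ (-1 : ℝ)) :=
        mul_le_mul h1 h2 (by positivity) (le_trans (by positivity) h1)
    _ = _ := by rw [e]; ring

section Field

variable {Ω : Type*} [MeasurableSpace Ω] {P : Measure Ω} {f : Ω → DistrRd d} {m : ℝ}
  {D : Opens (EuclRd d)} {ac ar : 𝓓(D, ℂ)}

/-- The source tested against `χ(x) e^{i l x·θ}`. -/
def fieldWave (f : Ω → DistrRd d) (χ : TestFn d) (θ : EuclRd d) (l : ℝ) (ω : Ω) : ℂ :=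
  f ω (waveTest ((-l) • θ) χ)

lemma continuous_fieldWave {Ω' : Type*} (f : Ω' → DistrRd d) (χ : TestFn d) (θ : EuclRd d)
    (ω : Ω') : Continuous fun l => fieldWave f χ θ l ω :=
  ((f ω).continuous_waveTest χ).comp (by fun_prop : Continuous fun l : ℝ => (-l) • θ)

lemma isFieldValue_fieldWave {Ω' : Type*} (f : Ω' → DistrRd d) (χ : TestFn d) (θ : EuclRd d)
    (l : ℝ) : IsFieldValue f (fieldWave f χ θ l) := ⟨_, Or.inl rfl⟩

lemma conjTest_waveTest {χ : TestFn d} (hχ : conjTest χ = χ) (ξ : EuclRd d) :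
    conjTest (waveTest ξ χ) = waveTest (-ξ) χ := by
  ext x
  have h : conj (χ x) = χ x := by
    have := congrArg (fun φ : TestFn d => φ x) hχ
    simpa using this
  rw [conjTest_apply, waveTest_apply, waveTest_apply, map_mul, conj_planeWave, h]

lemma IsCenteredGMIG.integral_fieldWave_mul (hf : IsCenteredGMIG P f m D ac ar)
    (χ : TestFn d) (θ : EuclRd d) :
    ∃ σ, HasPrincipalSymbol D m ar σ ∧ ∀ l μ, ∫ ω, fieldWave f χ θ l ω * fieldWave f χ θ μ ω ∂P =
      oscForm σ χ θ l μ := by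
  obtain ⟨σ, hσ, h⟩ := hf.relation
  exact ⟨σ, hσ, fun l μ => by rw [oscForm, ← h, hf.relForm_eq]; rfl⟩

/-- For a real cutoff, conjugation only reverses the modulation, so a correlation with a conjugated
value is a covariance form with one frequency negated. -/
lemma IsCenteredGMIG.integral_conj_fieldWave_mul (hf : IsCenteredGMIG P f m D ac ar)
    {χ : TestFn d} (hχ : conjTest χ = χ) (θ : EuclRd d) :
    ∃ σ, HasPrincipalSymbol D m ac σ ∧ ∀ l μ,
      ∫ ω, fieldWave f χ θ μ ω * conj (fieldWave f χ θ (-l) ω) ∂P = oscForm σ χ θ l μ := by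
  obtain ⟨σ, hσ, h⟩ := hf.covariance
  refine ⟨σ, hσ, fun l μ => ?_⟩
  rw [oscForm, ← h, hf.covForm_eq, conjTest_waveTest hχ]
  congr 1
  ext ω
  rw [mul_comm, fieldWave, fieldWave, neg_smul (-l) θ]

variable [IsProbabilityMeasure P] {χ : TestFn d}

/-- The pairing of like factors gives two covariance forms with frequency sum `±(s-t)`. The crossed
pairing gives two relation forms with frequency sum `-(s+t+τ)`, which is at least `|s-t|` in size.
Both are products of two decaying factors. -/
theorem IsCenteredGMIG.ae_tendsto_cov (hd : d = 2 ∨ d = 3) (hf : IsCenteredGMIG P f m D ac ar)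
    (hχ1 : ∀ x ∈ D, χ x = 1) (hχ : conjTest χ = χ) {θ : EuclRd d} (hθ : ‖θ‖ = 1) {τ : ℝ}
    (hτ : 0 ≤ τ) :
    ∀ᵐ ω ∂P, Tendsto (fun Q : ℝ => (1 / Q : ℂ) * ∫ t in Q..(2 * Q), (bandWeight d m τ t : ℂ) *
      (fieldWave f χ θ (-(t + τ)) ω * conj (fieldWave f χ θ (-t) ω))) atTop
      (𝓝 (fourierHat ac (τ • θ))) := by
  obtain ⟨σr, hσr, hr⟩ := hf.integral_fieldWave_mul χ θ
  obtain ⟨σc, hσc, hc⟩ := hf.integral_conj_fieldWave_mul hχ θ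
  obtain ⟨K, hK0, hK⟩ := exists_rpow_mul_norm_oscForm_le hσr.1 χ hθ hτ
  obtain ⟨K', hK0', hK'⟩ := exists_rpow_mul_norm_oscForm_le hσc.1 χ hθ hτ
  refine hf.ae_tendsto_product (Z := fun t => fieldWave f χ θ (-(t + τ)))
    (W := fun t ω => conj (fieldWave f χ θ (-t) ω))
    (fun t => isFieldValue_fieldWave f χ θ _) (fun t => (isFieldValue_fieldWave f χ θ _).conj)
    (fun ω => (continuous_fieldWave f χ θ ω).comp (by fun_prop : Continuous fun t => -(t + τ)))
    (fun ω => Complex.continuous_conj.comp ((continuous_fieldWave f χ θ ω).comp continuous_neg))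
    (measurable_bandWeight m τ) ((continuousOn_bandWeight m hτ).mono fun t (ht : 1 ≤ t) =>
      Set.mem_Ioi.2 (lt_of_lt_of_le one_pos ht))
    (fun t ht => bandWeight_nonneg m hτ (by linarith))
    (fun t ht => bandWeight_le hd m hτ (by linarith)) ?_ (C := K' * K' + K * K) (by positivity)
    ?_ ?_
  · refine tendsto_bandWeight_mul hτ ?_
    simp_rw [hc]
    exact tendsto_oscForm hσc hθ hχ1 τ
  · intro s t hs ht
    have e1 : ∫ ω, fieldWave f χ θ (-(s + τ)) ω * conj (fieldWave f χ θ (-(t + τ)) ω) ∂P =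
        oscForm σc χ θ (t + τ) (-(s + τ)) := hc _ _
    have e2 : ∫ ω, conj (fieldWave f χ θ (-s) ω) * conj (conj (fieldWave f χ θ (-t) ω)) ∂P =
        oscForm σc χ θ s (-t) := by
      rw [← hc]
      congr 1; ext ω
      rw [Complex.conj_conj, mul_comm]
    rw [e1, e2]
    refine (rpow_mul_mul_le (by linarith) (by linarith) (by positivity) (norm_nonneg _)
      (norm_nonneg _) (hK' t (t + τ) (-(s + τ)) (s - t) ht (Or.inr (abs_of_nonneg (by linarith)))
        (by rw [abs_sub_comm]; exact le_of_eq (by congr 1; ring)))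
      (hK' s s (-t) (s - t) hs (Or.inl (abs_of_nonneg (by linarith))) le_rfl)).trans ?_
    gcongr
    nlinarith
  · intro s t hs ht
    have e1 : ∫ ω, fieldWave f χ θ (-(s + τ)) ω * conj (conj (fieldWave f χ θ (-t) ω)) ∂P =
        oscForm σr χ θ (-(s + τ)) (-t) := by
      rw [← hr]; simp only [Complex.conj_conj]
    have e2 : ∫ ω, conj (fieldWave f χ θ (-s) ω) * conj (fieldWave f χ θ (-(t + τ)) ω) ∂P =
        conj (oscForm σr χ θ (-(t + τ)) (-s)) := by
      rw [← hr, ← integral_conj]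
      congr 1; ext ω
      rw [map_mul, mul_comm]
    rw [e1, e2, RCLike.norm_conj, mul_comm (s ^ m)]
    have ha : ∀ s t : ℝ, 1 ≤ s → 1 ≤ t → |s - t| ≤ |-(s + τ) + -t| := fun s t hs ht => by
      rw [show -(s + τ) + -t = -(s + t + τ) by ring, abs_neg, abs_of_nonneg (by linarith :
        0 ≤ s + t + τ), abs_le]
      constructor <;> linarith
    have hb : ∀ t : ℝ, 1 ≤ t → |-(t + τ)| = t + τ := fun t ht => by
      rw [abs_neg, abs_of_nonneg (by linarith)]
    refine (rpow_mul_mul_le (by linarith) (by linarith) (by positivity) (norm_nonneg _)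
      (norm_nonneg _) (hK s (-(s + τ)) (-t) (s - t) hs (Or.inr (hb s hs)) (ha s t hs ht))
      (hK t (-(t + τ)) (-s) (s - t) ht (Or.inr (hb t ht))
        (by rw [abs_sub_comm]; exact ha t s ht hs))).trans ?_
    gcongr
    nlinarith

/-- The mean comes from the relation operator, but all correlations in the variance pair a field
value with a conjugate and hence are covariance forms, with frequency sums `±(s-t)` or `-(s+t+τ)`.
-/
theorem IsCenteredGMIG.ae_tendsto_rel (hd : d = 2 ∨ d = 3) (hf : IsCenteredGMIG P f m D ac ar)
    (hχ1 : ∀ x ∈ D, χ x = 1) (hχ : conjTest χ = χ) {θ : EuclRd d} (hθ : ‖θ‖ = 1) {τ : ℝ}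
    (hτ : 0 ≤ τ) :
    ∀ᵐ ω ∂P, Tendsto (fun Q : ℝ => (1 / Q : ℂ) * ∫ t in Q..(2 * Q), (bandWeight d m τ t : ℂ) *
      (fieldWave f χ θ (-(t + τ)) ω * fieldWave f χ θ t ω)) atTop
      (𝓝 (fourierHat ar (τ • θ))) := by
  obtain ⟨σr, hσr, hr⟩ := hf.integral_fieldWave_mul χ θ
  obtain ⟨σc, hσc, hc⟩ := hf.integral_conj_fieldWave_mul hχ θ
  obtain ⟨K', hK0', hK'⟩ := exists_rpow_mul_norm_oscForm_le hσc.1 χ hθ hτ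
  have habs : ∀ t : ℝ, 1 ≤ t → |-t| = t := fun t ht => by
    rw [abs_neg, abs_of_nonneg (by linarith)]
  refine hf.ae_tendsto_product (Z := fun t => fieldWave f χ θ (-(t + τ)))
    (W := fun t => fieldWave f χ θ t)
    (fun t => isFieldValue_fieldWave f χ θ _) (fun t => isFieldValue_fieldWave f χ θ _)
    (fun ω => (continuous_fieldWave f χ θ ω).comp (by fun_prop : Continuous fun t => -(t + τ)))
    (fun ω => continuous_fieldWave f χ θ ω)
    (measurable_bandWeight m τ) ((continuousOn_bandWeight m hτ).mono fun t (ht : 1 ≤ t) =>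
      Set.mem_Ioi.2 (lt_of_lt_of_le one_pos ht))
    (fun t ht => bandWeight_nonneg m hτ (by linarith))
    (fun t ht => bandWeight_le hd m hτ (by linarith)) ?_ (C := K' * K') (by positivity)
    ?_ ?_
  · refine tendsto_bandWeight_mul hτ ?_
    have e : ∀ t, ∫ ω, fieldWave f χ θ (-(t + τ)) ω * fieldWave f χ θ t ω ∂P =
        oscForm σr χ θ t (-(t + τ)) := fun t => by
      rw [← hr]; simp only [mul_comm]
    simp_rw [e]
    exact tendsto_oscForm hσr hθ hχ1 τ
  · intro s t hs ht
    have e1 : ∫ ω, fieldWave f χ θ (-(s + τ)) ω * conj (fieldWave f χ θ (-(t + τ)) ω) ∂P =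
        oscForm σc χ θ (t + τ) (-(s + τ)) := hc _ _
    have e2 : ∫ ω, fieldWave f χ θ s ω * conj (fieldWave f χ θ t ω) ∂P =
        conj (oscForm σc χ θ (-s) t) := by
      rw [← hc, ← integral_conj, neg_neg]
      congr 1; ext ω
      rw [map_mul, Complex.conj_conj, mul_comm]
    rw [e1, e2, RCLike.norm_conj]
    refine rpow_mul_mul_le (by linarith) (by linarith) (by positivity) (norm_nonneg _)
      (norm_nonneg _) (hK' t (t + τ) (-(s + τ)) (s - t) ht (Or.inr (abs_of_nonneg (by linarith)))
        (by rw [abs_sub_comm]; exact le_of_eq (by congr 1; ring)))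
      (hK' s (-s) t (s - t) hs (Or.inl (habs s hs))
        (by rw [abs_sub_comm]; exact le_of_eq (by congr 1; ring)))
  · intro s t hs ht
    have e1 : ∫ ω, fieldWave f χ θ (-(s + τ)) ω * conj (fieldWave f χ θ t ω) ∂P =
        oscForm σc χ θ (-t) (-(s + τ)) := by
      rw [← hc, neg_neg]
    have e2 : ∫ ω, fieldWave f χ θ s ω * conj (fieldWave f χ θ (-(t + τ)) ω) ∂P =
        conj (oscForm σc χ θ (-s) (-(t + τ))) := by
      rw [← hc, ← integral_conj, neg_neg]
      congr 1; ext ω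
      rw [map_mul, Complex.conj_conj, mul_comm]
    rw [e1, e2, RCLike.norm_conj]
    have ha : ∀ s t : ℝ, 1 ≤ s → 1 ≤ t → |s - t| ≤ |-s + -(t + τ)| := fun s t hs ht => by
      rw [show -s + -(t + τ) = -(s + t + τ) by ring, abs_neg, abs_of_nonneg (by linarith :
        0 ≤ s + t + τ), abs_le]
      constructor <;> linarith
    exact rpow_mul_mul_le (by linarith) (by linarith) (by positivity) (norm_nonneg _)
      (norm_nonneg _) (hK' t (-t) (-(s + τ)) (s - t) ht (Or.inl (habs t ht))
        (by rw [abs_sub_comm]; exact ha t s ht hs))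
      (hK' s (-s) (-(t + τ)) (s - t) hs (Or.inl (habs s hs)) (ha s t hs ht))

end Field

end

noncomputable section

variable {d : ℕ}

/-! ### Uniqueness -/

lemma differentiable_integral_cexp_mul {a b : EuclRd d → ℝ} (ha : Continuous a) (hb : Continuous b)
    {g : EuclRd d → ℂ} (hg : Continuous g) (hc : HasCompactSupport g) :
    Differentiable ℂ fun z : ℂ => ∫ x, cexp (-(I * (a x + z * b x))) * g x := by
  intro z₀
  have hint : ∀ h : EuclRd d → ℂ, Continuous h → Integrable fun x => h x * g x := fun h hh =>
    (hh.mul hg).integrable_of_hasCompactSupport hc.mul_left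
  have hF : ∀ z : ℂ, Continuous fun x : EuclRd d => cexp (-(I * (a x + z * b x))) := fun z => by
    fun_prop
  refine (hasDerivAt_integral_of_dominated_loc_of_deriv_le (Metric.ball_mem_nhds z₀ one_pos)
    (F := fun z x => cexp (-(I * (a x + z * b x))) * g x)
    (F' := fun z x => (cexp (-(I * (a x + z * b x))) * -(I * b x)) * g x)
    (bound := fun x => Real.exp ((‖z₀‖ + 1) * |b x|) * |b x| * ‖g x‖)
    (Eventually.of_forall fun z => (hint _ (hF z)).aestronglyMeasurable) (hint _ (hF z₀))
    (hint (fun x => cexp (-(I * (a x + z₀ * b x))) * -(I * b x)) (by fun_prop)).aestronglyMeasurable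
    (Eventually.of_forall fun x z hz => ?_) ?_
    (Eventually.of_forall fun x z hz => ?_)).2.differentiableAt
  · have hz' : ‖z‖ ≤ ‖z₀‖ + 1 := by
      have h1 := norm_le_norm_add_norm_sub' z z₀
      have h2 : ‖z - z₀‖ < 1 := by simpa [dist_eq_norm] using hz
      linarith
    rw [norm_mul, norm_mul, Complex.norm_exp, norm_neg, norm_mul, Complex.norm_I, one_mul,
      Complex.norm_real, Real.norm_eq_abs]
    have e : (-(I * ((a x : ℂ) + z * b x))).re = z.im * b x := by simp
    rw [e]
    have h3 : z.im * b x ≤ (‖z₀‖ + 1) * |b x| := by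
      refine (le_abs_self _).trans ?_
      rw [abs_mul]
      exact mul_le_mul_of_nonneg_right ((Complex.abs_im_le_norm z).trans hz') (abs_nonneg _)
    exact mul_le_mul_of_nonneg_right (mul_le_mul_of_nonneg_right (Real.exp_le_exp.2 h3)
      (abs_nonneg _)) (norm_nonneg _)
  · refine Continuous.integrable_of_hasCompactSupport (by fun_prop) ?_
    exact HasCompactSupport.mul_left hc.norm
  · have h1 : HasDerivAt (fun z : ℂ => -(I * ((a x : ℂ) + z * b x))) (-(I * b x)) z := by
      have := ((((hasDerivAt_id z).mul_const (b x : ℂ)).const_add (a x : ℂ)).const_mul I).neg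
      rw [one_mul] at this
      exact this
    exact h1.cexp.mul_const _

/-- Restricted to the complex line through `ξ₀` and `ξ`, the Fourier transform of a compactly
supported function is entire. It vanishes for real parameters near 0, so the identity theorem in one
variable gives zero at parameter 1. -/
lemma fourierHat_eq_zero_of_eventually {g : EuclRd d → ℂ} (hg : Continuous g)
    (hc : HasCompactSupport g) {ξ₀ : EuclRd d} (h : ∀ᶠ ξ in 𝓝 ξ₀, fourierHat g ξ = 0)
    (ξ : EuclRd d) : fourierHat g ξ = 0 := by
  obtain ⟨G, hG⟩ : ∃ G : ℂ → ℂ, G = fun z => ∫ x : EuclRd d,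
      cexp (-(I * ((inner ℝ x ξ₀ : ℝ) + z * (inner ℝ x (ξ - ξ₀) : ℝ)))) * g x := ⟨_, rfl⟩
  have hdiff : Differentiable ℂ G := by
    rw [hG]
    exact differentiable_integral_cexp_mul (by fun_prop) (by fun_prop) hg hc
  have hreal : ∀ s : ℝ, G s = fourierHat g (ξ₀ + s • (ξ - ξ₀)) := fun s => by
    rw [hG, fourierHat]
    simp only [inner_add_right, inner_smul_right, Complex.ofReal_add, Complex.ofReal_mul]
  have han : AnalyticOnNhd ℂ G Set.univ := hdiff.differentiableOn.analyticOnNhd isOpen_univ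
  have hev : ∀ᶠ s : ℝ in 𝓝 0, G s = 0 := by
    have hcont : Tendsto (fun s : ℝ => ξ₀ + s • (ξ - ξ₀)) (𝓝 0) (𝓝 ξ₀) := by
      have : Continuous fun s : ℝ => ξ₀ + s • (ξ - ξ₀) := by fun_prop
      simpa using this.tendsto 0
    filter_upwards [hcont.eventually h] with s hs
    rw [hreal, hs]
  have hfreq : ∃ᶠ z in 𝓝[≠] (0 : ℂ), G z = 0 := by
    have h0 : Tendsto (fun s : ℝ => (s : ℂ)) (𝓝[≠] 0) (𝓝[≠] 0) := by
      refine tendsto_nhdsWithin_iff.2 ⟨?_, ?_⟩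
      · simpa using (Complex.continuous_ofReal.tendsto 0).mono_left nhdsWithin_le_nhds
      · filter_upwards [self_mem_nhdsWithin] with s hs
        simpa using hs
    exact h0.frequently (hev.filter_mono nhdsWithin_le_nhds).frequently
  have hz := han.eqOn_zero_of_preconnected_of_frequently_eq_zero isPreconnected_univ
    (Set.mem_univ 0) hfreq (Set.mem_univ ((1 : ℝ) : ℂ))
  rw [hreal, one_smul, add_sub_cancel] at hz
  exact hz

/-- Even if the given point has `τ = 0`, openness in `[0, ∞)` supplies a point with `τ > 0`, where
polar coordinates are invertible with continuous inverse. -/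
lemma exists_eventually_polar_mem {Θ : Set (ℝ≥0 × UnitSph d)} (hΘ : IsOpen Θ) (hne : Θ.Nonempty) :
    ∃ ξ₀ : EuclRd d, ∀ᶠ ξ in 𝓝 ξ₀, ∃ p ∈ Θ, ξ = (p.1 : ℝ) • (p.2 : EuclRd d) := by
  obtain ⟨⟨τ₀, θ₀⟩, hp⟩ := hne
  obtain ⟨U, V, hU, hV, hτ, hθ, hUV⟩ := isOpen_prod_iff.1 hΘ τ₀ θ₀ hp
  obtain ⟨W, hW, rfl⟩ := isOpen_induced_iff.1 hV
  obtain ⟨τ₁, hτ₁, hpos⟩ : ∃ τ₁ ∈ U, 0 < τ₁ := by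
    have h := (hU.mem_nhds hτ)
    have h1 : ∀ᶠ τ in 𝓝[>] τ₀, τ ∈ U := nhdsWithin_le_nhds h
    obtain ⟨τ, h2, h3⟩ := (h1.and self_mem_nhdsWithin).exists
    exact ⟨τ, h2, lt_of_le_of_lt (bot_le : (0 : ℝ≥0) ≤ τ₀) h3⟩
  have hθn : ‖(θ₀ : EuclRd d)‖ = 1 := by simp
  have hn : ‖(τ₁ : ℝ) • (θ₀ : EuclRd d)‖ = τ₁ := by
    rw [norm_smul, hθn, mul_one]
    exact Real.norm_of_nonneg τ₁.2
  have hne0 : ‖(τ₁ : ℝ) • (θ₀ : EuclRd d)‖ ≠ 0 := by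
    rw [hn]; exact_mod_cast hpos.ne'
  refine ⟨(τ₁ : ℝ) • (θ₀ : EuclRd d), ?_⟩
  have h1 : ∀ᶠ ξ in 𝓝 ((τ₁ : ℝ) • (θ₀ : EuclRd d)), ‖ξ‖₊ ∈ U := by
    refine continuous_nnnorm.continuousAt.eventually_mem (hU.mem_nhds ?_)
    have : ‖(τ₁ : ℝ) • (θ₀ : EuclRd d)‖₊ = τ₁ := NNReal.eq hn
    rwa [this]
  have h2 : ∀ᶠ ξ in 𝓝 ((τ₁ : ℝ) • (θ₀ : EuclRd d)), ‖ξ‖⁻¹ • ξ ∈ W := by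
    have hcont : ContinuousAt (fun ξ : EuclRd d => ‖ξ‖⁻¹ • ξ) ((τ₁ : ℝ) • (θ₀ : EuclRd d)) :=
      (continuous_norm.continuousAt.inv₀ hne0).smul continuousAt_id
    refine hcont.eventually_mem (hW.mem_nhds ?_)
    rw [hn, smul_smul, inv_mul_cancel₀ (by exact_mod_cast hpos.ne'), one_smul]
    exact hθ
  have h3 : ∀ᶠ ξ in 𝓝 ((τ₁ : ℝ) • (θ₀ : EuclRd d)), ‖ξ‖ ≠ 0 :=
    continuous_norm.continuousAt.eventually_ne hne0
  filter_upwards [h1, h2, h3] with ξ h1 h2 h3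
  have hmem : ‖ξ‖⁻¹ • ξ ∈ Metric.sphere (0 : EuclRd d) 1 := by
    rw [mem_sphere_zero_iff_norm, norm_smul, norm_inv, norm_norm, inv_mul_cancel₀ h3]
  refine ⟨(‖ξ‖₊, ⟨_, hmem⟩), hUV ⟨h1, h2⟩, ?_⟩
  rw [coe_nnnorm, smul_smul, mul_inv_cancel₀ h3, one_smul]

lemma TestFn.eq_of_fourierHat_eq {Θ : Set (ℝ≥0 × UnitSph d)} (hΘ : IsOpen Θ) (hne : Θ.Nonempty)
    {φ ψ : TestFn d} (h : ∀ p ∈ Θ, fourierHat φ ((p.1 : ℝ) • (p.2 : EuclRd d)) =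
      fourierHat ψ ((p.1 : ℝ) • (p.2 : EuclRd d))) : φ = ψ := by
  have hsub : ∀ ξ, fourierHat (φ - ψ : TestFn d) ξ = fourierHat φ ξ - fourierHat ψ ξ := fun ξ => by
    have hint : ∀ η : TestFn d, Integrable fun x => planeWave ξ x * η x := fun η =>
      ((contDiff_planeWave ξ).continuous.mul η.continuous).integrable_of_hasCompactSupport
        η.hasCompactSupport.mul_left
    rw [fourierHat_eq, fourierHat_eq, fourierHat_eq, ← integral_sub (hint φ) (hint ψ)]
    congr 1
    ext x
    rw [← mul_sub]; rfl
  obtain ⟨ξ₀, hξ₀⟩ := exists_eventually_polar_mem hΘ hne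
  have hz : ∀ ξ, fourierHat (φ - ψ : TestFn d) ξ = 0 := by
    refine fourierHat_eq_zero_of_eventually (ξ₀ := ξ₀) (φ - ψ).continuous
      (φ - ψ).hasCompactSupport ?_
    filter_upwards [hξ₀] with ξ hξ
    obtain ⟨p, hp, rfl⟩ := hξ
    rw [hsub, h p hp, sub_self]
  refine sub_eq_zero.1 ?_
  ext x
  have := fourierHat_inversion (φ - ψ) x
  simp only [hz, mul_zero, integral_zero] at this
  exact this.symm

/-- Almost sure statements are available only for countably many pairs. Continuity of both
transforms extends the equality from `Θ ∩ S` to `Θ`, because `Θ` is open and `S` dense. -/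
lemma coe_eq_of_fourierHat_eq {D D' : Opens (EuclRd d)} {a : 𝓓(D, ℂ)} {a' : 𝓓(D', ℂ)}
    {Θ : Set (ℝ≥0 × UnitSph d)} (hΘ : IsOpen Θ) (hne : Θ.Nonempty) {S : Set (ℝ≥0 × UnitSph d)}
    (hS : Dense S) (h : ∀ p ∈ Θ ∩ S, fourierHat a ((p.1 : ℝ) • (p.2 : EuclRd d)) =
      fourierHat a' ((p.1 : ℝ) • (p.2 : EuclRd d))) : (a : EuclRd d → ℂ) = a' := by
  obtain ⟨φ, hφ⟩ : ∃ φ : TestFn d, (φ : EuclRd d → ℂ) = a :=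
    ⟨mkTest a a.contDiff a.hasCompactSupport, rfl⟩
  obtain ⟨ψ, hψ⟩ : ∃ ψ : TestFn d, (ψ : EuclRd d → ℂ) = a' :=
    ⟨mkTest a' a'.contDiff a'.hasCompactSupport, rfl⟩
  rw [← hφ, ← hψ] at h ⊢
  rw [TestFn.eq_of_fourierHat_eq hΘ hne (φ := φ) (ψ := ψ) fun p hp => ?_]
  have hpol : Continuous fun p : ℝ≥0 × UnitSph d => (p.1 : ℝ) • (p.2 : EuclRd d) := by fun_prop
  exact Set.EqOn.closure (s := Θ ∩ S) h ((continuous_fourierHat φ).comp hpol)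
    ((continuous_fourierHat ψ).comp hpol) (hS.open_subset_closure_inter hΘ hp)

lemma HasBandAverage.unique {h : ℝ → ℂ} {L L' : ℂ} (h1 : HasBandAverage h L)
    (h2 : HasBandAverage h L') : L = L' := tendsto_nhds_unique h1.2 h2.2

lemma radConst_ne_zero (d : ℕ) : radConst d ≠ 0 := by
  have hpi := Real.pi_pos
  unfold radConst
  split_ifs
  · refine div_ne_zero (Complex.exp_ne_zero _) ?_
    exact_mod_cast (Real.sqrt_pos.2 (by positivity)).ne'
  · refine div_ne_zero one_ne_zero ?_
    exact_mod_cast (by positivity : (4 * Real.pi) ≠ 0)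

/-! ### Convergence of the averages -/

/-- A band average requires integrability on `[Q, 2Q]` for every `Q > 0`, not only for large `Q`;
hence the continuity on all of `(0, ∞)`. -/
lemma HasBandAverage.of_eq_const_mul {h g : ℝ → ℂ} {C L : ℂ} (hg : ContinuousOn g (Set.Ioi 0))
    (hlim : Tendsto (fun Q : ℝ => (1 / Q : ℂ) * ∫ t in Q..(2 * Q), g t) atTop (𝓝 L))
    (heq : ∀ t, 0 < t → h t = C * g t) : HasBandAverage h (C * L) := by
  have hpos : ∀ Q : ℝ, 0 < Q → Set.uIcc Q (2 * Q) ⊆ Set.Ioi 0 := fun Q hQ t ht => by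
    rw [Set.uIcc_of_le (by linarith)] at ht
    exact Set.mem_Ioi.2 (lt_of_lt_of_le hQ ht.1)
  constructor
  · intro Q hQ
    refine ContinuousOn.intervalIntegrable (ContinuousOn.congr
      ((continuousOn_const (c := C)).mul (hg.mono (hpos Q hQ))) fun t ht => ?_)
    exact heq t (hpos Q hQ ht)
  · refine (hlim.const_mul C).congr' ?_
    filter_upwards [eventually_gt_atTop 0] with Q hQ
    rw [intervalIntegral.integral_congr (g := fun t => C * g t)
      fun t ht => heq t (hpos Q hQ ht), intervalIntegral.integral_const_mul]
    ring

section Averages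

variable {Ω : Type*} [MeasurableSpace Ω] {P : Measure Ω} {f : Ω → DistrRd d} {m : ℝ}

  {D : Opens (EuclRd d)} {ac ar : 𝓓(D, ℂ)} [IsProbabilityMeasure P]
  {u : ℝ → Ω → DistrRd d} {v : Ω → UnitSph d → ℝ → ℂ}

theorem IsCenteredGMIG.ae_hasBandAverage (hd : d = 2 ∨ d = 3)
    (hD : Bornology.IsBounded (D : Set (EuclRd d))) (hf : IsCenteredGMIG P f m D ac ar)
    (hu : IsBiharmonicField P f u v) (θ : UnitSph d) {τ : ℝ} (hτ : 0 ≤ τ) :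
    ∀ᵐ ω ∂P, HasBandAverage (covData m (v ω) τ θ)
        (1 / 4 * (‖radConst d‖ : ℂ) ^ 2 * fourierHat ac (τ • (θ : EuclRd d))) ∧
      HasBandAverage (relData m (v ω) τ θ)
        (1 / 4 * radConst d ^ 2 * fourierHat ar (τ • (θ : EuclRd d))) := by
  obtain ⟨χ, hχ1, hχ, hv⟩ := exists_cutoff_farField hd hD hf hu
  have hθ : ‖(θ : EuclRd d)‖ = 1 := by simp
  filter_upwards [hv, hf.ae_tendsto_cov hd hχ1 hχ hθ hτ, hf.ae_tendsto_rel hd hχ1 hχ hθ hτ]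
    with ω hv hcov hrel
  have hp : ∀ κ : ℝ, 0 < κ → v ω θ κ = radConst d / 2 *
      ((κ ^ (((d : ℝ) - 7) / 2) : ℝ) : ℂ) * fieldWave f χ θ (-κ) ω := fun κ hκ => by
    rw [hv θ κ hκ, fieldWave, neg_neg]
  have hn : ∀ κ : ℝ, 0 < κ → v ω (-θ) κ = radConst d / 2 *
      ((κ ^ (((d : ℝ) - 7) / 2) : ℝ) : ℂ) * fieldWave f χ θ κ ω := fun κ hκ => by
    rw [hv (-θ) κ hκ, fieldWave, neg_smul, ← smul_neg]; rfl
  have hw := continuous_fieldWave f χ (θ : EuclRd d) ω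
  have hw1 : Continuous fun t : ℝ => fieldWave f χ θ (-(t + τ)) ω :=
    hw.comp (by fun_prop : Continuous fun t : ℝ => -(t + τ))
  have hb : ContinuousOn (fun t => (bandWeight d m τ t : ℂ)) (Set.Ioi 0) :=
    Complex.continuous_ofReal.comp_continuousOn (continuousOn_bandWeight m hτ)
  constructor
  · refine HasBandAverage.of_eq_const_mul (hb.mul (hw1.mul (Complex.continuous_conj.comp
      (hw.comp continuous_neg))).continuousOn) hcov fun κ hκ => ?_
    have hC : (‖radConst d‖ : ℂ) ^ 2 = radConst d * conj (radConst d) := by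
      rw [Complex.mul_conj, Complex.normSq_eq_norm_sq]; push_cast; rfl
    rw [covData, hp _ (add_pos_of_pos_of_nonneg hκ hτ), hp κ hκ, hC]
    simp only [bandWeight, Pi.mul_apply, Function.comp_apply, map_mul, map_div₀,
      Complex.conj_ofReal, map_ofNat]
    push_cast; ring
  · refine HasBandAverage.of_eq_const_mul (hb.mul (hw1.mul hw).continuousOn) hrel fun κ hκ => ?_
    rw [relData, hp _ (add_pos_of_pos_of_nonneg hκ hτ), hn κ hκ]
    simp only [bandWeight, Pi.mul_apply]
    push_cast; ring

theorem IsCenteredGMIG.ae_forall_hasBandAverage (hd : d = 2 ∨ d = 3)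
    (hD : Bornology.IsBounded (D : Set (EuclRd d))) (hf : IsCenteredGMIG P f m D ac ar)
    (hu : IsBiharmonicField P f u v) {S : Set (ℝ≥0 × UnitSph d)} (hS : S.Countable) :
    ∀ᵐ ω ∂P, ∀ p ∈ S, HasBandAverage (covData m (v ω) p.1 p.2)
        (1 / 4 * (‖radConst d‖ : ℂ) ^ 2 * fourierHat ac ((p.1 : ℝ) • (p.2 : EuclRd d))) ∧
      HasBandAverage (relData m (v ω) p.1 p.2)
        (1 / 4 * radConst d ^ 2 * fourierHat ar ((p.1 : ℝ) • (p.2 : EuclRd d))) :=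
  (ae_ball_iff hS).2 fun p _ => hf.ae_hasBandAverage hd hD hu p.2 p.1.2

end Averages

end

theorem mainTheorem2 (d : ℕ) (hd : d = 2 ∨ d = 3) (m : ℝ) (hm : (d : ℝ) - 6 < m ∧ m ≤ d)
    (D : Opens (EuclRd d)) (hD : Bornology.IsBounded (D : Set (EuclRd d)))
    {Ω : Type*} [MeasurableSpace Ω] (P : Measure Ω) [IsProbabilityMeasure P]
    (f : Ω → DistrRd d) (ac ar : 𝓓(D, ℂ)) (hf : IsCenteredGMIG P f m D ac ar)
    (u : ℝ → Ω → DistrRd d) (v : Ω → UnitSph d → ℝ → ℂ) (hu : IsBiharmonicField P f u v) :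
    (∀ (θ : UnitSph d) (τ : ℝ), 0 ≤ τ → ∀ᵐ ω ∂P,
      HasBandAverage (covData m (v ω) τ θ)
        (1 / 4 * (‖radConst d‖ : ℂ) ^ 2 * fourierHat ac (τ • (θ : EuclRd d))) ∧
      HasBandAverage (relData m (v ω) τ θ)
        (1 / 4 * radConst d ^ 2 * fourierHat ar (τ • (θ : EuclRd d)))) ∧
    (∀ Θ : Set (ℝ≥0 × UnitSph d), IsOpen Θ → Θ.Nonempty →
      ∀ (D' : Opens (EuclRd d)), Bornology.IsBounded (D' : Set (EuclRd d)) →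
      ∀ (Ω' : Type*) [MeasurableSpace Ω'] (P' : Measure Ω') [IsProbabilityMeasure P']
        (f' : Ω' → DistrRd d) (ac' ar' : 𝓓(D', ℂ)), IsCenteredGMIG P' f' m D' ac' ar' →
      ∀ (u' : ℝ → Ω' → DistrRd d) (v' : Ω' → UnitSph d → ℝ → ℂ),
        IsBiharmonicField P' f' u' v' →
      ∀ᵐ ω ∂P, ∀ᵐ ω' ∂P',
        ((∀ p ∈ Θ, ∀ L : ℂ, HasBandAverage (covData m (v ω) p.1 p.2) L ↔
            HasBandAverage (covData m (v' ω') p.1 p.2) L) →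
          (ac : EuclRd d → ℂ) = ac') ∧
        ((∀ p ∈ Θ, ∀ L : ℂ, HasBandAverage (relData m (v ω) p.1 p.2) L ↔
            HasBandAverage (relData m (v' ω') p.1 p.2) L) →
          (ar : EuclRd d → ℂ) = ar')) := by
  refine ⟨fun θ τ hτ => hf.ae_hasBandAverage hd hD hu θ hτ, ?_⟩
  intro Θ hΘ hne D' hD' Ω' _ P' _ f' ac' ar' hf' u' v' hu'
  -- `S` is fixed before the realizations and independently of both sources, so each source
  -- contributes a single null set.
  obtain ⟨S, hSc, hS⟩ := TopologicalSpace.exists_countable_dense (ℝ≥0 × UnitSph d)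
  filter_upwards [hf.ae_forall_hasBandAverage hd hD hu hSc] with ω hω
  filter_upwards [hf'.ae_forall_hasBandAverage hd hD' hu' hSc] with ω' hω'
  have hC := radConst_ne_zero d
  constructor
  · intro h
    refine coe_eq_of_fourierHat_eq hΘ hne hS fun p hp => ?_
    have hC' : (1 / 4 * (‖radConst d‖ : ℂ) ^ 2) ≠ 0 := by simpa using hC
    -- For pairs in `S` the average for `ω` does converge, to the predicted value. The hypothesis
    -- transfers this value to `ω'`, where uniqueness of limits identifies it with the value
    -- predicted there.
    exact mul_left_cancel₀ hC' (((h p hp.1 _).1 (hω p hp.2).1).unique (hω' p hp.2).1)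
  · intro h
    refine coe_eq_of_fourierHat_eq hΘ hne hS fun p hp => ?_
    have hC' : (1 / 4 * radConst d ^ 2) ≠ 0 := by simpa using hC
    exact mul_left_cancel₀ hC' (((h p hp.1 _).1 (hω p hp.2).2).unique (hω' p hp.2).2)
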